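/- **Proposition 3.2.** Let $0<q<1$. Let $\mathcal A$ be the polynomial $*$-algebra of the compact quantum group $SU_q(2)$, i.e. the universal unital $*$-algebra generated by $\alpha,\gamma$ with $\alpha^*\alpha+\gamma^*\gamma=1$, $\alpha\alpha^*+q^2\gamma^*\gamma=1$, $\gamma^*\gamma=\gamma\gamma^*$, $\alpha\gamma=q\gamma\alpha$, $\alpha\gamma^*=q\gamma^*\alpha$, with comultiplication $\Delta(\alpha)=\alpha\otimes\alpha-q\gamma^*\otimes\gamma$, $\Delta(\gamma)=\gamma\otimes\alpha+\alpha^*\otimes\gamma$ (a $*$-homomorphism). Let $h$ be the Haar state and $H=L^2(A,h)$, $A=C(SU_q(2))$, the GNS space of $h$, i.e. the completion of $\mathcal A$ for the inner product $(a,b)=h(a^*b)$; $\mathcal A$ acts on $H$ by left multiplication. Let $e,f,k,k^{-1}$ be the generators of $U_q(\mathfrak{su}_2)$, regarded as functionals on $\mathcal A$: $k$ and $k^{-1}$ are multiplicative, $e(ab)=e(a)k^{-1}(b)+k(a)e(b)$, $f(ab)=f(a)k^{-1}(b)+k(a)f(b)$, and on the matrix $\begin{pmatrix}\alpha&-q\gamma^*\\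 \gamma&\alpha^*\end{pmatrix}$ the values of $k,e,f$ are $\begin{pmatrix}q^{1/2}&0\\0&q^{-1/2}\end{pmatrix}$, $\begin{pmatrix}0&1\\0&0\end{pmatrix}$, $\begin{pmatrix}0&0\\1&0\end{pmatrix}$. Put $\partial_k(a)=(\iota\otimes k)\Delta(a)$ and, for $n\in\mathbb Z$, $\mathcal A_n=\{a\in\mathcal A:\partial_k(a)=q^{n/2}a\}$; let $L^2(A_n,h)$ be the closure of $\mathcal A_n$ in $H$. For $F\subset\mathbb Z$ let $p_F$ be the orthogonal projection of $H=\bigoplus_{n\in\mathbb Z}L^2(A_n,h)$ onto $\bigoplus_{n\in F}L^2(A_n,h)$. Let $\omega$ act on $\mathcal A$ by $a\mapsto(\hat S^{-1}(\omega)\otimes\iota)\Delta(a)$, where $\hat S$ is the antipode, $\hat S(k)=k^{-1}$, $\hat S(e)=-q^{-1}e$, $\hat S(f)=-qf$, and let $C$ be the positive self-adjoint operator on $H$ which is the closure of the action on $\mathcal A$ of the Casimir element $$fe+\Bigl(\frac{q^{1/2}k-q^{-1/2}k^{-1}}{q-q^{-1}}\Bigr)^2 .$$ For $t\in\mathbb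 R$ let $\|\xi\|_t=\|C^{t/2}\xi\|$, let $\mathcal H_t$ be the domain of $C^{t/2}$ with this norm (completed if $t<0$), and let $\mathcal H_\infty=\bigcap_t\mathcal H_t$. A linear operator $T:\mathcal H_\infty\to\mathcal H_\infty$ is of order $r\in\mathbb R$, written $T\in op^r$, if for every $t\in\mathbb R$ it extends to a bounded operator $\mathcal H_t\to\mathcal H_{t-r}$; for $T\in op^0$ let $\|T\|_t$ be its norm as an operator $\mathcal H_t\to\mathcal H_t$. A bounded operator on $H$ is said to belong to $op^r$ if it maps $\mathcal H_\infty$ into itself and its restriction to $\mathcal H_\infty$ is in $op^r$. Then: (i) $\mathcal A\subset op^0$, and $p_F\in op^0$ for every $F\subset\mathbb Z$; (ii) for all $n\in\mathbb Z$, $a\in\mathcal A_n$ and finite $F\subset\mathbb Z$, the operator $x=a\,p_F$ maps $\mathcal H_\infty$ into itself, the function $$\mathbb C\ni z\mapsto x(z)=(C^zxC^{-z}-q^{nz}x)\,C^{1/2}$$ takes values in $op^0$, and it has at most linear growth on vertical strips; more precisely, for every bounded interval $I\subset\mathbb R$ there is $\lambda>0$ such that $\|x(z)\|_t\le\lambda|z|$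 for all $t\in I$ and all $z\in\mathbb C$ with $\operatorname{Re}z\in I$. -/

import Mathlib

noncomputable section

open scoped TensorProduct ComplexConjugate InnerProductSpace

namespace SUq2

/-! ### The Hopf `*`-algebra of polynomial functions on `SU_q(2)` -/

/-- Symbols for the generators `α, α^*, γ, γ^*`. -/
inductive Gen
  | a | astar | c | cstar

/-- The free algebra on the four symbols. -/
abbrev Free : Type := FreeAlgebra ℂ Gen

/-- A generator of the free algebra. -/
abbrev gen (x : Gen) : Free := FreeAlgebra.ι ℂ x

/-- The defining relations of `SU_q(2)`; the last two are the adjoints of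
`α γ = q γ α` and `α γ^* = q γ^* α`, the other three are self-adjoint. -/
inductive Rel (q : ℝ) : Free → Free → Prop
  | r1 : Rel q (gen .astar * gen .a + gen .cstar * gen .c) 1
  | r2 : Rel q (gen .a * gen .astar + ((q : ℂ) ^ 2) • (gen .cstar * gen .c)) 1
  | r3 : Rel q (gen .cstar * gen .c) (gen .c * gen .cstar)
  | r4 : Rel q (gen .a * gen .c) ((q : ℂ) • (gen .c * gen .a))
  | r5 : Rel q (gen .a * gen .cstar) ((q : ℂ) • (gen .cstar * gen .a))
  | r6 : Rel q (gen .cstar * gen .astar) ((q : ℂ) • (gen .astar * gen .cstar))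
  | r7 : Rel q (gen .c * gen .astar) ((q : ℂ) • (gen .astar * gen .c))

/-- The polynomial algebra `𝒜` of `SU_q(2)`, `0 < q < 1`: the universal unital `*`-algebra with
generators `α, γ` and the relations above (the `*`-structure is constructed below). -/
def Poly (q : Set.Ioo (0 : ℝ) 1) : Type := RingQuot (Rel (q : ℝ))

variable (q : Set.Ioo (0 : ℝ) 1)

instance : Ring (Poly q) := inferInstanceAs (Ring (RingQuot (Rel (q : ℝ))))
instance : Algebra ℂ (Poly q) := inferInstanceAs (Algebra ℂ (RingQuot (Rel (q : ℝ))))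

/-- The class of a generator. -/
def mk (x : Gen) : Poly q := RingQuot.mkAlgHom ℂ (Rel (q : ℝ)) (gen x)

/-- The generator `α`. -/
abbrev α : Poly q := mk q .a
/-- The generator `α^*`. -/
abbrev αs : Poly q := mk q .astar
/-- The generator `γ`. -/
abbrev γ : Poly q := mk q .c
/-- The generator `γ^*`. -/
abbrev γs : Poly q := mk q .cstar

/-- The relations, for four elements of an algebra. -/
structure Good {R : Type*} [Ring R] [Algebra ℂ R] (f : Gen → R) : Prop where
  r1 : f .astar * f .a + f .cstar * f .c = 1
  r2 : f .a * f .astar + ((q : ℝ) : ℂ) ^ 2 • (f .cstar * f .c) = 1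
  r3 : f .cstar * f .c = f .c * f .cstar
  r4 : f .a * f .c = ((q : ℝ) : ℂ) • (f .c * f .a)
  r5 : f .a * f .cstar = ((q : ℝ) : ℂ) • (f .cstar * f .a)
  r6 : f .cstar * f .astar = ((q : ℝ) : ℂ) • (f .astar * f .cstar)
  r7 : f .c * f .astar = ((q : ℝ) : ℂ) • (f .astar * f .c)

theorem good_mk : Good q (mk q) := by
  have key : ∀ x y, Rel (q : ℝ) x y → RingQuot.mkAlgHom ℂ (Rel (q : ℝ)) x =
      RingQuot.mkAlgHom ℂ (Rel (q : ℝ)) y := fun x y h => RingQuot.mkAlgHom_rel ℂ h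
  constructor
  · have := key _ _ .r1; simp only [map_add, map_mul, map_one] at this; exact this
  · have := key _ _ .r2; simp only [map_add, map_mul, map_one, map_smul] at this; exact this
  · have := key _ _ .r3; simp only [map_mul] at this; exact this
  · have := key _ _ .r4; simp only [map_mul, map_smul] at this; exact this
  · have := key _ _ .r5; simp only [map_mul, map_smul] at this; exact this
  · have := key _ _ .r6; simp only [map_mul, map_smul] at this; exact this
  · have := key _ _ .r7; simp only [map_mul, map_smul] at this; exact this

variable {q}

/-- The universal property of `𝒜`. -/
def lift {R : Type*} [Ring R] [Algebra ℂ R] (f : Gen → R) (hf : Good q f) : Poly q →ₐ[ℂ] R :=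
  RingQuot.liftAlgHom ℂ ⟨FreeAlgebra.lift ℂ f, by
    intro x y h
    cases h <;>
    simp only [map_add, map_mul, map_smul, map_one, FreeAlgebra.lift_ι_apply]
    exacts [hf.r1, hf.r2, hf.r3, hf.r4, hf.r5, hf.r6, hf.r7]⟩

@[simp] theorem lift_mk {R : Type*} [Ring R] [Algebra ℂ R] (f : Gen → R) (hf : Good q f)
    (x : Gen) : lift f hf (mk q x) = f x := by
  unfold lift mk
  erw [RingQuot.liftAlgHom_mkAlgHom_apply]
  simp

/-- Induction over words in the generators. -/
theorem induction {P : Poly q → Prop} (h1 : P 1) (hg : ∀ x, P (mk q x))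
    (hadd : ∀ x y, P x → P y → P (x + y)) (hmul : ∀ x y, P x → P y → P (x * y))
    (hsmul : ∀ (t : ℂ) x, P x → P (t • x)) (x : Poly q) : P x := by
  obtain ⟨x, rfl⟩ := RingQuot.mkAlgHom_surjective ℂ (Rel (q : ℝ)) x
  induction x using FreeAlgebra.induction with
  | grade0 r =>
    have := hsmul r 1 h1
    rw [AlgHom.commutes]
    rwa [Algebra.algebraMap_eq_smul_one]
  | grade1 x => exact hg x
  | mul x y hx hy => rw [map_mul]; exact hmul _ _ hx hy
  | add x y hx hy => rw [map_add]; exact hadd _ _ hx hy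

theorem algHom_ext {R : Type*} [Ring R] [Algebra ℂ R] {f g : Poly q →ₐ[ℂ] R}
    (h : ∀ x, f (mk q x) = g (mk q x)) : f = g := by
  ext x
  induction x using induction with
  | h1 => simp
  | hg x => exact h x
  | hadd x y hx hy => simp [hx, hy]
  | hmul x y hx hy => simp [hx, hy]
  | hsmul t x hx => simp [hx]

/-- The opposite algebra with the complex conjugate scalar multiplication. -/
def ConjOp (R : Type*) : Type _ := Rᵐᵒᵖ

instance (R : Type*) [Ring R] : Ring (ConjOp R) := inferInstanceAs (Ring Rᵐᵒᵖ)

/-- The identity map to the conjugate opposite algebra. -/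
def ConjOp.op {R : Type*} (x : R) : ConjOp R := MulOpposite.op x

/-- The identity map from the conjugate opposite algebra. -/
def ConjOp.unop {R : Type*} (x : ConjOp R) : R := MulOpposite.unop x

instance (R : Type*) [Ring R] [Algebra ℂ R] : Algebra ℂ (ConjOp R) where
  smul t x := ConjOp.op (conj t • x.unop)
  algebraMap :=
    { toFun := fun t => ConjOp.op (algebraMap ℂ R (conj t))
      map_one' := congrArg ConjOp.op (by simp)
      map_mul' := fun s t => congrArg ConjOp.op
        (show _ = algebraMap ℂ R (conj t) * algebraMap ℂ R (conj s) by
          rw [mul_comm s t, map_mul, map_mul])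
      map_zero' := congrArg ConjOp.op (by simp)
      map_add' := fun s t => congrArg ConjOp.op
        (show _ = algebraMap ℂ R (conj s) + algebraMap ℂ R (conj t) by
          rw [map_add, map_add]) }
  commutes' t x := congrArg ConjOp.op (Algebra.commutes (conj t) x.unop).symm
  smul_def' t x := congrArg ConjOp.op
    ((Algebra.smul_def (conj t) x.unop).trans (Algebra.commutes (conj t) x.unop))

theorem ConjOp.op_mul {R : Type*} [Ring R] (x y : R) : op (x * y) = op y * op x := rfl
theorem ConjOp.op_add {R : Type*} [Ring R] (x y : R) : op (x + y) = op x + op y := rfl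
theorem ConjOp.op_one {R : Type*} [Ring R] : op (1 : R) = 1 := rfl
theorem ConjOp.op_smul {R : Type*} [Ring R] [Algebra ℂ R] (t : ℂ) (x : R) :
    op (conj t • x) = t • op x := rfl
theorem ConjOp.op_rsmul {R : Type*} [Ring R] [Algebra ℂ R] (t : ℝ) (x : R) :
    op ((t : ℂ) • x) = (t : ℂ) • op x := by
  rw [← ConjOp.op_smul, Complex.conj_ofReal]

/-- The involution on the generators. -/
def Gen.conj : Gen → Gen
  | .a => .astar | .astar => .a | .c => .cstar | .cstar => .c

theorem good_op : Good q fun x => ConjOp.op (mk q x.conj) := by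
  have h := good_mk q
  constructor <;>
  simp only [Gen.conj, ← ConjOp.op_mul, ← ConjOp.op_rsmul, ← ConjOp.op_add,
    ← Complex.ofReal_pow, ← ConjOp.op_one] <;>
  congr 1
  exacts [h.r1, by simpa only [Complex.ofReal_pow] using h.r2, h.r3, h.r6, h.r7, h.r4, h.r5]

/-- The conjugate-linear anti-homomorphism exchanging `α, α^*` and `γ, γ^*`. -/
def starHom : Poly q →ₐ[ℂ] ConjOp (Poly q) := lift _ good_op

instance : Star (Poly q) := ⟨fun x => ConjOp.unop (starHom x)⟩

theorem star_mk (x : Gen) : star (mk q x) = mk q x.conj := by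
  change ConjOp.unop (starHom _) = _
  rw [starHom, lift_mk]; rfl

theorem star_smul_aux (t : ℂ) (x : Poly q) : star (t • x) = conj t • star x := by
  change ConjOp.unop (starHom _) = _
  rw [map_smul]
  rfl

theorem star_add_aux (x y : Poly q) : star (x + y) = star x + star y :=
  congrArg ConjOp.unop (map_add starHom x y)

theorem star_mul_aux (x y : Poly q) : star (x * y) = star y * star x :=
  congrArg ConjOp.unop (map_mul starHom x y)

theorem star_one_aux : star (1 : Poly q) = 1 :=
  congrArg ConjOp.unop (map_one starHom)

instance : StarRing (Poly q) where
  star_involutive x := by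
    induction x using induction with
    | h1 => simp only [star_one_aux]
    | hg x => rw [star_mk, star_mk]; cases x <;> rfl
    | hadd x y hx hy => rw [star_add_aux, star_add_aux, hx, hy]
    | hmul x y hx hy => rw [star_mul_aux, star_mul_aux, hx, hy]
    | hsmul t x hx => rw [star_smul_aux, star_smul_aux, hx, Complex.conj_conj]
  star_mul := star_mul_aux
  star_add := star_add_aux

instance : StarModule ℂ (Poly q) := ⟨star_smul_aux⟩

variable (q) in
theorem q_ne : ((q : ℝ) : ℂ) ≠ 0 := by exact_mod_cast q.2.1.ne'

/-! Normal ordering rules. -/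

theorem αs_α : αs q * α q = 1 - γs q * γ q := eq_sub_of_add_eq (good_mk q).r1
theorem α_αs : α q * αs q = 1 - ((q : ℝ) : ℂ) ^ 2 • (γs q * γ q) := eq_sub_of_add_eq (good_mk q).r2
theorem γ_γs : γ q * γs q = γs q * γ q := (good_mk q).r3.symm
theorem α_γ : α q * γ q = ((q : ℝ) : ℂ) • (γ q * α q) := (good_mk q).r4
theorem α_γs : α q * γs q = ((q : ℝ) : ℂ) • (γs q * α q) := (good_mk q).r5
theorem γs_αs : γs q * αs q = ((q : ℝ) : ℂ) • (αs q * γs q) := (good_mk q).r6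
theorem γ_αs : γ q * αs q = ((q : ℝ) : ℂ) • (αs q * γ q) := (good_mk q).r7

/-- The values of the comultiplication on the generators:
`Δ α = α ⊗ α - q γ^* ⊗ γ`, `Δ γ = γ ⊗ α + α^* ⊗ γ`, and their adjoints. -/
def comulGen : Gen → Poly q ⊗[ℂ] Poly q
  | .a => α q ⊗ₜ α q - ((q : ℝ) : ℂ) • (γs q ⊗ₜ γ q)
  | .astar => αs q ⊗ₜ αs q - ((q : ℝ) : ℂ) • (γ q ⊗ₜ γs q)
  | .c => γ q ⊗ₜ α q + αs q ⊗ₜ γ q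
  | .cstar => γs q ⊗ₜ αs q + α q ⊗ₜ γs q

theorem good_comul : Good q (comulGen (q := q)) := by
  constructor <;>
  simp only [comulGen, mul_add, add_mul, mul_sub, sub_mul, Algebra.TensorProduct.tmul_mul_tmul,
    smul_mul_assoc, mul_smul_comm, Algebra.TensorProduct.one_def, αs_α, α_αs, γ_γs, α_γ, α_γs,
    γs_αs, γ_αs, TensorProduct.tmul_smul, ← TensorProduct.smul_tmul', TensorProduct.tmul_sub,
    TensorProduct.sub_tmul, smul_sub, smul_add, smul_smul] <;>
  module

/-- The comultiplication `Δ : 𝒜 → 𝒜 ⊗ 𝒜`. -/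
def comul : Poly q →ₐ[ℂ] Poly q ⊗[ℂ] Poly q := lift _ good_comul

/-! ### The quantized enveloping algebra as functionals on `𝒜` -/

variable (q) in
/-- `q^{1/2}`. -/
def sq : ℂ := (Real.sqrt q : ℂ)

theorem sq_ne : sq q ≠ 0 := by
  unfold sq; exact_mod_cast (Real.sqrt_pos.2 q.2.1).ne'

theorem sq_sq : sq q ^ 2 = ((q : ℝ) : ℂ) := by
  unfold sq; exact_mod_cast Real.sq_sqrt q.2.1.le

theorem sq_mul : sq q * sq q = ((q : ℝ) : ℂ) := by rw [← pow_two, sq_sq]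

/-- A character of `𝒜` with `α ↦ t`, `α^* ↦ t⁻¹`, `γ, γ^* ↦ 0`. -/
def character (t : ℂ) (ht : t ≠ 0) : Poly q →ₐ[ℂ] ℂ :=
  lift (fun | .a => t | .astar => t⁻¹ | .c => 0 | .cstar => 0) (by constructor <;> simp [ht])

variable (q) in
/-- The element `k`, as a functional on `𝒜`. It is group-like, and its values on the
fundamental corepresentation form the matrix `diag(q^{1/2}, q^{-1/2})`. -/
def k : Poly q →ₐ[ℂ] ℂ := character (sq q) sq_ne

variable (q) in
/-- The element `k⁻¹`, as a functional on `𝒜`. -/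
def kInv : Poly q →ₐ[ℂ] ℂ := character (sq q)⁻¹ (inv_ne_zero sq_ne)

/-- A homomorphism into upper triangular `2 × 2` matrices, with diagonal entries `k` and `k⁻¹`,
with upper right entries `u` and `v` for `γ` and `γ^*`. -/
def triang (u v : ℂ) (h : u = 0 ∨ v = 0) : Poly q →ₐ[ℂ] Matrix (Fin 2) (Fin 2) ℂ :=
  lift (fun
    | .a => !![sq q, 0; 0, (sq q)⁻¹]
    | .astar => !![(sq q)⁻¹, 0; 0, sq q]
    | .c => !![0, u; 0, 0]
    | .cstar => !![0, v; 0, 0]) (by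
  have h0 := sq_ne (q := q)
  have hs := sq_mul (q := q)
  constructor <;> ext i j <;> fin_cases i <;> fin_cases j <;>
    rcases h with rfl | rfl <;> simp [← hs, h0, -Complex.coe_smul] <;> field_simp)

variable (q) in
/-- The element `e`, as a functional on `𝒜`: by the comultiplication of `e` it satisfies
`e(ab) = e(a) k⁻¹(b) + k(a) e(b)`, and on the fundamental corepresentation
`((α, -q γ^*), (γ, α^*))` it takes the values `((0, 1), (0, 0))`. -/
def e : Poly q →ₗ[ℂ] ℂ :=
  Matrix.entryLinearMap ℂ ℂ 0 1 ∘ₗ (triang 0 (-((q : ℝ) : ℂ)⁻¹) (.inl rfl)).toLinearMap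

variable (q) in
/-- The element `f`, as a functional on `𝒜`: by the comultiplication of `f` it satisfies
`f(ab) = f(a) k⁻¹(b) + k(a) f(b)`, and on the fundamental corepresentation
`((α, -q γ^*), (γ, α^*))` it takes the values `((0, 0), (1, 0))`. -/
def f : Poly q →ₗ[ℂ] ℂ := Matrix.entryLinearMap ℂ ℂ 0 1 ∘ₗ (triang 1 0 (.inr rfl)).toLinearMap

theorem triang_spec (u v : ℂ) (h : u = 0 ∨ v = 0) (x : Poly q) :
    triang u v h x 0 0 = k q x ∧ triang u v h x 1 0 = 0 ∧ triang u v h x 1 1 = kInv q x := by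
  induction x using induction with
  | h1 => simp
  | hg x => cases x <;> simp [triang, k, kInv, character]
  | hadd x y hx hy => simp [hx, hy]
  | hmul x y hx hy => simp [Matrix.mul_apply, hx, hy]
  | hsmul t x hx => simp [hx]

theorem e_mul (x y : Poly q) : e q (x * y) = e q x * kInv q y + k q x * e q y := by
  have hx := triang_spec 0 (-((q : ℝ) : ℂ)⁻¹) (.inl rfl) x
  have hy := triang_spec 0 (-((q : ℝ) : ℂ)⁻¹) (.inl rfl) y
  simp only [e, LinearMap.comp_apply, Matrix.entryLinearMap_apply,
    AlgHom.toLinearMap_apply, map_mul, Matrix.mul_apply, Fin.sum_univ_two, hx, hy]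
  ring

theorem f_mul (x y : Poly q) : f q (x * y) = f q x * kInv q y + k q x * f q y := by
  have hx := triang_spec 1 0 (.inr rfl) x
  have hy := triang_spec 1 0 (.inr rfl) y
  simp only [f, LinearMap.comp_apply, Matrix.entryLinearMap_apply,
    AlgHom.toLinearMap_apply, map_mul, Matrix.mul_apply, Fin.sum_univ_two, hx, hy]
  ring

/-- The left action `∂_ω(a) = (ι ⊗ ω)Δ(a)` of a functional `ω` on `𝒜`. -/
def actL (ω : Poly q →ₗ[ℂ] ℂ) : Poly q →ₗ[ℂ] Poly q :=
  (TensorProduct.rid ℂ (Poly q)).toLinearMap ∘ₗ ω.lTensor (Poly q) ∘ₗ comul.toLinearMap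

/-- The right action `a ◁ ω = (ω ⊗ ι)Δ(a)` of a functional `ω` on `𝒜`. -/
def actR (ω : Poly q →ₗ[ℂ] ℂ) : Poly q →ₗ[ℂ] Poly q :=
  (TensorProduct.lid ℂ (Poly q)).toLinearMap ∘ₗ ω.rTensor (Poly q) ∘ₗ comul.toLinearMap

theorem actR_apply (ω : Poly q →ₗ[ℂ] ℂ) (x : Poly q) :
    actR ω x = TensorProduct.lid ℂ (Poly q) (ω.rTensor (Poly q) (comul x)) := rfl

theorem comul_mk (x : Gen) : comul (mk q x) = comulGen x := by
  rw [comul, lift_mk]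

theorem slice_mul (ω ω₁ ω₂ ω₃ ω₄ : Poly q →ₗ[ℂ] ℂ)
    (h : ∀ x y, ω (x * y) = ω₁ x * ω₂ y + ω₃ x * ω₄ y) (x y : Poly q) :
    actR ω (x * y) = actR ω₁ x * actR ω₂ y + actR ω₃ x * actR ω₄ y := by
  simp only [actR_apply, map_mul]
  generalize comul x = X
  generalize comul y = Y
  induction X using TensorProduct.induction_on with
  | zero => simp
  | add X X' hX hX' => simp only [add_mul, map_add, hX, hX']; abel
  | tmul a b =>
    induction Y using TensorProduct.induction_on with
    | zero => simp
    | add X X' hX hX' => simp only [mul_add, map_add, hX, hX']; abel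
    | tmul c d =>
      simp only [Algebra.TensorProduct.tmul_mul_tmul, LinearMap.rTensor_tmul,
        TensorProduct.lid_tmul, h, smul_mul_smul_comm, add_smul]

variable (q) in
/-- `a ↦ a ◁ k`. -/
abbrev K : Poly q →ₗ[ℂ] Poly q := actR (k q).toLinearMap
variable (q) in
/-- `a ↦ a ◁ k⁻¹`. -/
abbrev Kinv : Poly q →ₗ[ℂ] Poly q := actR (kInv q).toLinearMap
variable (q) in
/-- `a ↦ a ◁ e`. -/
abbrev E : Poly q →ₗ[ℂ] Poly q := actR (e q)
variable (q) in
/-- `a ↦ a ◁ f`. -/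
abbrev F : Poly q →ₗ[ℂ] Poly q := actR (f q)

theorem K_mul (x y : Poly q) : K q (x * y) = K q x * K q y := by
  simpa [actR] using slice_mul (k q).toLinearMap (k q).toLinearMap (k q).toLinearMap 0 0
    (by simp) x y

theorem Kinv_mul (x y : Poly q) : Kinv q (x * y) = Kinv q x * Kinv q y := by
  simpa [actR] using slice_mul (kInv q).toLinearMap (kInv q).toLinearMap (kInv q).toLinearMap 0 0
    (by simp) x y

theorem E_mul (x y : Poly q) : E q (x * y) = E q x * Kinv q y + K q x * E q y :=
  slice_mul _ _ _ _ _ e_mul x y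

theorem F_mul (x y : Poly q) : F q (x * y) = F q x * Kinv q y + K q x * F q y :=
  slice_mul _ _ _ _ _ f_mul x y

theorem actR_one (ω : Poly q →ₗ[ℂ] ℂ) : actR ω 1 = ω 1 • 1 := by
  simp [actR, Algebra.TensorProduct.one_def]

theorem actR_mk (ω : Poly q →ₗ[ℂ] ℂ) (x : Gen) : actR ω (mk q x) = match x with
    | .a => ω (α q) • α q - (((q : ℝ) : ℂ) * ω (γs q)) • γ q
    | .astar => ω (αs q) • αs q - (((q : ℝ) : ℂ) * ω (γ q)) • γs q
    | .c => ω (γ q) • α q + ω (αs q) • γ q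
    | .cstar => ω (γs q) • αs q + ω (α q) • γs q := by
  rw [actR_apply, comul_mk]
  cases x <;> simp [comulGen, smul_smul, -Complex.coe_smul]

theorem K_mk (x : Gen) : K q (mk q x) = match x with
    | .a => sq q • α q | .astar => (sq q)⁻¹ • αs q | .c => (sq q)⁻¹ • γ q | .cstar => sq q • γs q := by
  rw [K, actR_mk]; cases x <;> simp [k, character]

theorem Kinv_mk (x : Gen) : Kinv q (mk q x) = match x with
    | .a => (sq q)⁻¹ • α q | .astar => sq q • αs q | .c => sq q • γ q | .cstar => (sq q)⁻¹ • γs q := by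
  rw [Kinv, actR_mk]; cases x <;> simp [kInv, character]

theorem E_mk (x : Gen) : E q (mk q x) = match x with
    | .a => γ q | .astar => 0 | .c => 0 | .cstar => -(((q : ℝ) : ℂ)⁻¹ • αs q) := by
  have := q_ne q
  rw [E, actR_mk]; cases x <;> simp [e, triang, this, -Complex.coe_smul]

theorem F_mk (x : Gen) : F q (mk q x) = match x with
    | .a => 0 | .astar => -(((q : ℝ) : ℂ) • γs q) | .c => α q | .cstar => 0 := by
  rw [F, actR_mk]; cases x <;> simp [f, triang, -Complex.coe_smul]

theorem K_one : K q 1 = 1 := by simp [K, actR_one]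
theorem Kinv_one : Kinv q 1 = 1 := by simp [Kinv, actR_one]
theorem f_one : f q 1 = 0 := by simp [f]
theorem e_one : e q 1 = 0 := by simp [e]
theorem E_one : E q 1 = 0 := by simp [E, actR_one, e_one]
theorem F_one : F q 1 = 0 := by simp [F, actR_one, f_one]

theorem Kinv_K (x : Poly q) : Kinv q (K q x) = x := by
  induction x using induction with
  | h1 => simp only [K_one, Kinv_one]
  | hg x => rw [K_mk]; cases x <;> simp [Kinv_mk, smul_smul, sq_ne]
  | hadd x y hx hy => simp only [map_add, hx, hy]
  | hmul x y hx hy => rw [K_mul, Kinv_mul, hx, hy]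
  | hsmul t x hx => simp only [map_smul, hx]

theorem K_K' (x : Poly q) : K q (Kinv q x) = x := by
  induction x using induction with
  | h1 => simp only [K_one, Kinv_one]
  | hg x => rw [Kinv_mk]; cases x <;> simp [K_mk, smul_smul, sq_ne]
  | hadd x y hx hy => simp only [map_add, hx, hy]
  | hmul x y hx hy => rw [Kinv_mul, K_mul, hx, hy]
  | hsmul t x hx => simp only [map_smul, hx]

/-- The relation `k f = q⁻¹ f k`, on the level of right actions. -/
theorem F_K (x : Poly q) : F q (K q x) = ((q : ℝ) : ℂ)⁻¹ • K q (F q x) := by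
  have h0 := sq_ne (q := q)
  have h1 := sq_mul (q := q)
  induction x using induction with
  | h1 => simp [K_one, F_one]
  | hg x =>
    rw [K_mk]; cases x <;> simp [F_mk, K_mk, smul_smul, ← h1, h0]
    all_goals congr 1; field_simp
  | hadd x y hx hy => simp only [map_add, hx, hy, smul_add]
  | hmul x y hx hy =>
    rw [K_mul, F_mul, F_mul, map_add, K_mul, K_mul, Kinv_K, K_K', hx, hy]
    simp only [smul_add, smul_mul_assoc, mul_smul_comm]
  | hsmul t x hx => simp only [map_smul, hx, smul_comm t]

theorem E_K (x : Poly q) : E q (K q x) = ((q : ℝ) : ℂ) • K q (E q x) := by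
  have h0 := sq_ne (q := q)
  have h1 := sq_mul (q := q)
  induction x using induction with
  | h1 => simp [K_one, E_one]
  | hg x =>
    rw [K_mk]; cases x <;> simp [E_mk, K_mk, smul_smul, ← h1, h0]
    all_goals congr 1; field_simp
  | hadd x y hx hy => simp only [map_add, hx, hy, smul_add]
  | hmul x y hx hy =>
    rw [K_mul, E_mul, E_mul, map_add, K_mul, K_mul, Kinv_K, K_K', hx, hy]
    simp only [smul_add, smul_mul_assoc, mul_smul_comm]
  | hsmul t x hx => simp only [map_smul, hx, smul_comm t]

theorem conj_sq : conj (sq q) = sq q := by simp [sq]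

theorem star_K (x : Poly q) : star (K q x) = Kinv q (star x) := by
  induction x using induction with
  | h1 => simp [K_one, Kinv_one]
  | hg x => rw [K_mk, star_mk]; cases x <;> simp [Kinv_mk, star_mk, Gen.conj, conj_sq]
  | hadd x y hx hy => simp only [map_add, star_add, hx, hy]
  | hmul x y hx hy => rw [K_mul, star_mul, star_mul, Kinv_mul, hx, hy]
  | hsmul t x hx => simp only [map_smul, star_smul, hx]

theorem star_K' (x : Poly q) : star (Kinv q x) = K q (star x) := by
  have := star_K (Kinv q x)
  rw [K_K'] at this
  rw [this, K_K']

theorem star_F (x : Poly q) : star (F q x) = -(((q : ℝ) : ℂ) • E q (star x)) := by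
  have hq := q_ne q
  induction x using induction with
  | h1 => simp [F_one, E_one]
  | hg x =>
    rw [F_mk, star_mk]; cases x <;> simp [E_mk, star_mk, Gen.conj, smul_smul, hq]
  | hadd x y hx hy => simp only [map_add, star_add, hx, hy, smul_add]; abel
  | hmul x y hx hy =>
    rw [F_mul, star_add, star_mul, star_mul, star_mul, E_mul, hx, hy, star_K, star_K']
    simp only [smul_add, smul_mul_assoc, mul_smul_comm, mul_neg, neg_mul]; abel
  | hsmul t x hx => simp only [map_smul, star_smul, hx, smul_neg, smul_comm (star t)]

theorem star_E (x : Poly q) : star (E q x) = -(((q : ℝ) : ℂ)⁻¹ • F q (star x)) := by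
  have hq := q_ne q
  have := congrArg star (star_F (star x))
  simp only [star_star, star_neg, star_smul, Complex.star_def, Complex.conj_ofReal] at this
  rw [this]
  simp [smul_smul, hq, -Complex.coe_smul]

/-! ### Spanning monomials -/

/-- `γ^m γ^{*n} α^k`. -/
def mono (m n k : ℕ) : Poly q := γ q ^ m * γs q ^ n * α q ^ k
/-- `γ^m γ^{*n} α^{*k}`. -/
def mono' (m n k : ℕ) : Poly q := γ q ^ m * γs q ^ n * αs q ^ k

theorem γs_γ_pow (m : ℕ) : γs q * γ q ^ m = γ q ^ m * γs q :=
  ((show Commute (γs q) (γ q) from γ_γs.symm).pow_right m).eq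

theorem α_pow (m n : ℕ) : α q * (γ q ^ m * γs q ^ n) =
    ((q : ℝ) : ℂ) ^ (m + n) • (γ q ^ m * γs q ^ n * α q) := by
  have h1 : α q * γ q ^ m = ((q : ℝ) : ℂ) ^ m • (γ q ^ m * α q) := by
    induction m with
    | zero => simp
    | succ m ih =>
      rw [pow_succ, ← mul_assoc, ih, smul_mul_assoc, mul_assoc, α_γ, mul_smul_comm, smul_smul,
        mul_assoc, pow_succ]
  have h2 : α q * γs q ^ n = ((q : ℝ) : ℂ) ^ n • (γs q ^ n * α q) := by
    induction n with
    | zero => simp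
    | succ m ih =>
      rw [pow_succ, ← mul_assoc, ih, smul_mul_assoc, mul_assoc, α_γs, mul_smul_comm, smul_smul,
        mul_assoc, pow_succ]
  rw [← mul_assoc, h1, smul_mul_assoc, mul_assoc, h2, mul_smul_comm, smul_smul, mul_assoc, pow_add]

theorem star_gp (m n : ℕ) : star (γ q ^ m * γs q ^ n) = γ q ^ n * γs q ^ m := by
  rw [star_mul, star_pow, star_pow, star_mk, star_mk]
  rfl

theorem pow_αs (m n : ℕ) : γ q ^ m * γs q ^ n * αs q =
    ((q : ℝ) : ℂ) ^ (m + n) • (αs q * (γ q ^ m * γs q ^ n)) := by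
  have := congrArg star (α_pow (q := q) n m)
  rw [star_mul, star_gp, star_smul, star_mul, star_gp, star_mk] at this
  simp only [star_pow, Complex.star_def, Complex.conj_ofReal] at this
  rw [add_comm m n]
  exact this

theorem αs_pow (m n : ℕ) : αs q * (γ q ^ m * γs q ^ n) =
    (((q : ℝ) : ℂ) ^ (m + n))⁻¹ • (γ q ^ m * γs q ^ n * αs q) := by
  rw [pow_αs, smul_smul, inv_mul_cancel₀ (pow_ne_zero _ (q_ne q)), one_smul]

theorem α_pow_pow (m n k : ℕ) : α q ^ k * (γ q ^ m * γs q ^ n) =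
    ((q : ℝ) : ℂ) ^ ((m + n) * k) • (γ q ^ m * γs q ^ n * α q ^ k) := by
  induction k with
  | zero => simp
  | succ k ih =>
    rw [pow_succ', mul_assoc, ih, mul_smul_comm, ← mul_assoc, α_pow, smul_mul_assoc, smul_smul,
      mul_assoc, ← pow_succ', ← pow_add, ← Nat.mul_succ]

/-- Up to a scalar `mono'` is the adjoint of `mono`. -/
theorem mono'_eq (m n k : ℕ) :
    mono' m n k = ((q : ℝ) : ℂ) ^ ((n + m) * k) • star (mono (q := q) n m k) := by
  have := congrArg star (α_pow_pow (q := q) n m k)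
  rw [star_mul, star_gp, star_smul, star_pow, star_mk] at this
  simp only [star_pow, Complex.star_def, Complex.conj_ofReal] at this
  exact this

theorem γγs_comm (m n : ℕ) : (γ q ^ m * γs q ^ n) * (γs q * γ q) =
    γ q ^ (m + 1) * γs q ^ (n + 1) := by
  rw [← γ_γs, pow_succ, pow_succ, mul_assoc, mul_assoc, ← mul_assoc (γs q ^ n),
    ((show Commute (γs q) (γ q) from γ_γs.symm).pow_left n).eq, mul_assoc]

theorem mono_αsα (m n k : ℕ) : γ q ^ m * γs q ^ n * (αs q * α q ^ (k + 1)) =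
    mono m n k - mono (m + 1) (n + 1) k := by
  rw [pow_succ', ← mul_assoc (αs q), αs_α, sub_mul, one_mul, mul_sub, ← mul_assoc _ (γs q * γ q),
    γγs_comm]; rfl

theorem mono_ααs (m n k : ℕ) : γ q ^ m * γs q ^ n * (α q * αs q ^ (k + 1)) =
    mono' m n k - ((q : ℝ) : ℂ) ^ 2 • mono' (m + 1) (n + 1) k := by
  rw [pow_succ', ← mul_assoc (α q), α_αs, sub_mul, one_mul, mul_sub, smul_mul_assoc, mul_smul_comm,
    ← mul_assoc _ (γs q * γ q), γγs_comm]; rfl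

variable (q) in
/-- The span of the monomials. -/
def monoSpan : Submodule ℂ (Poly q) :=
  Submodule.span ℂ {x | ∃ m n k, x = mono m n k ∨ x = mono' m n k}

theorem mono_mem (m n k : ℕ) : mono m n k ∈ monoSpan q :=
  Submodule.subset_span ⟨m, n, k, .inl rfl⟩
theorem mono'_mem (m n k : ℕ) : mono' m n k ∈ monoSpan q :=
  Submodule.subset_span ⟨m, n, k, .inr rfl⟩

theorem gen_mul_mem (g : Gen) (x : Poly q) (hx : x ∈ monoSpan q) : mk q g * x ∈ monoSpan q := by
  induction hx using Submodule.span_induction with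
  | zero => simp
  | add x y _ _ hx hy => rw [mul_add]; exact add_mem hx hy
  | smul t x _ hx => rw [mul_smul_comm]; exact Submodule.smul_mem _ _ hx
  | mem x hx =>
    obtain ⟨m, n, k, rfl | rfl⟩ := hx
    · cases g
      · rw [mono, ← mul_assoc, α_pow, smul_mul_assoc, mul_assoc, ← pow_succ']
        exact Submodule.smul_mem _ _ (mono_mem m n (k + 1))
      · rw [mono, ← mul_assoc, αs_pow, smul_mul_assoc, mul_assoc]
        apply Submodule.smul_mem
        cases k with
        | zero => simpa [mono'] using mono'_mem (q := q) m n 1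
        | succ k => rw [mono_αsα]; exact sub_mem (mono_mem _ _ _) (mono_mem _ _ _)
      · rw [mono, ← mul_assoc, ← mul_assoc, ← pow_succ']; exact mono_mem _ _ _
      · rw [mono, ← mul_assoc, ← mul_assoc, γs_γ_pow, mul_assoc _ (γs q), ← pow_succ']
        exact mono_mem _ _ _
    · cases g
      · rw [mono', ← mul_assoc, α_pow, smul_mul_assoc, mul_assoc]
        apply Submodule.smul_mem
        cases k with
        | zero => simpa [mono] using mono_mem (q := q) m n 1
        | succ k =>
          rw [mono_ααs]
          exact sub_mem (mono'_mem _ _ _) (Submodule.smul_mem _ _ (mono'_mem _ _ _))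
      · rw [mono', ← mul_assoc, αs_pow, smul_mul_assoc, mul_assoc, ← pow_succ']
        exact Submodule.smul_mem _ _ (mono'_mem m n (k + 1))
      · rw [mono', ← mul_assoc, ← mul_assoc, ← pow_succ']; exact mono'_mem _ _ _
      · rw [mono', ← mul_assoc, ← mul_assoc, γs_γ_pow, mul_assoc _ (γs q), ← pow_succ']
        exact mono'_mem _ _ _

theorem monoSpan_eq_top : monoSpan q = ⊤ := by
  have h1 : (1 : Poly q) ∈ monoSpan q := by simpa [mono] using mono_mem (q := q) 0 0 0
  have key : ∀ x y : Poly q, y ∈ monoSpan q → x * y ∈ monoSpan q := by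
    intro x
    induction x using induction with
    | h1 => simp
    | hg x => exact gen_mul_mem x
    | hadd x y hx hy => intro z hz; rw [add_mul]; exact add_mem (hx z hz) (hy z hz)
    | hmul x y hx hy => intro z hz; rw [mul_assoc]; exact hx _ (hy z hz)
    | hsmul t x hx => intro z hz; rw [smul_mul_assoc]; exact Submodule.smul_mem _ _ (hx z hz)
  rw [eq_top_iff]
  intro x _
  simpa using key x 1 h1

/-- Induction over linear combinations of monomials. -/
theorem mono_induction {P : Poly q → Prop} (h : ∀ m n k, P (mono m n k))
    (h' : ∀ m n k, P (mono' m n k)) (h0 : P 0) (hadd : ∀ x y, P x → P y → P (x + y))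
    (hsmul : ∀ (t : ℂ) x, P x → P (t • x)) (x : Poly q) : P x := by
  have hx : x ∈ monoSpan q := by rw [monoSpan_eq_top]; trivial
  induction hx using Submodule.span_induction with
  | zero => exact h0
  | add x y _ _ hx hy => exact hadd _ _ hx hy
  | smul t x _ hx => exact hsmul _ _ hx
  | mem x hx => obtain ⟨m, n, k, rfl | rfl⟩ := hx; exacts [h m n k, h' m n k]

/-! ### The standard representation -/

/-- Finitely supported functions on `ℕ × ℤ`. -/
abbrev V : Type := (ℕ × ℤ) →₀ ℂ

/-- A weighted shift. -/
def wshift (c : ℕ → ℝ) (s : ℕ → ℕ) (t : ℤ) : V →ₗ[ℂ] V :=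
  Finsupp.lsum ℂ fun x => (c x.1 : ℂ) • Finsupp.lsingle (s x.1, x.2 + t)

theorem wshift_single (c : ℕ → ℝ) (s : ℕ → ℕ) (t : ℤ) (n : ℕ) (l : ℤ) (z : ℂ) :
    wshift c s t (Finsupp.single (n, l) z) = Finsupp.single (s n, l + t) (c n * z) := by
  simp [wshift]

variable (q) in
/-- Woronowicz's representation of `𝒜`:
`α e_{n,l} = (1 - q^{2n})^{1/2} e_{n-1,l}` and `γ e_{n,l} = q^n e_{n,l+1}`. -/
def repGen : Gen → Module.End ℂ V
  | .a => wshift (fun n => √(1 - (q : ℝ) ^ (2 * n))) (fun n => n - 1) 0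
  | .astar => wshift (fun n => √(1 - (q : ℝ) ^ (2 * (n + 1)))) (fun n => n + 1) 0
  | .c => wshift (fun n => (q : ℝ) ^ n) id 1
  | .cstar => wshift (fun n => (q : ℝ) ^ n) id (-1)

theorem sqrt_aux (n : ℕ) : ((√(1 - (q : ℝ) ^ n) : ℝ) : ℂ) * ((√(1 - (q : ℝ) ^ n) : ℝ) : ℂ) =
    1 - ((q : ℝ) : ℂ) ^ n := by
  rw [← Complex.ofReal_mul, Real.mul_self_sqrt]
  · push_cast; rfl
  · exact sub_nonneg.2 (pow_le_one₀ q.2.1.le q.2.2.le)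

theorem good_rep : Good q (repGen q) := by
  constructor <;> refine Finsupp.lhom_ext fun ⟨n, l⟩ z => ?_ <;>
    simp only [repGen, LinearMap.add_apply, Module.End.mul_apply, wshift_single,
      LinearMap.smul_apply, Module.End.one_apply, Finsupp.smul_single, smul_eq_mul, id,
      neg_add_cancel_right, add_neg_cancel_right, add_zero]
  case r1 =>
    cases n with
    | zero => simp
    | succ n =>
      rw [Nat.add_sub_cancel, ← mul_assoc, sqrt_aux, ← Finsupp.single_add]
      congr 1; push_cast; ring
  case r2 =>
    rw [Nat.add_sub_cancel, ← mul_assoc, sqrt_aux, ← Finsupp.single_add]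
    congr 1; push_cast; ring
  case r4 =>
    cases n with
    | zero => simp
    | succ n => congr 1; rw [Nat.add_sub_cancel]; push_cast; ring
  case r5 =>
    cases n with
    | zero => simp
    | succ n => congr 1; rw [Nat.add_sub_cancel]; push_cast; ring
  case r6 => congr 1; push_cast; ring
  case r7 => congr 1; push_cast; ring

variable (q) in
/-- Woronowicz's representation of `𝒜`. -/
def rep : Poly q →ₐ[ℂ] Module.End ℂ V := lift _ good_rep

theorem rep_mk (g : Gen) : rep q (mk q g) = repGen q g := by rw [rep, lift_mk]

/-- The standard inner product on finitely supported functions. -/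
def form (u v : V) : ℂ := u.sum fun x c => conj c * v x

theorem form_add_left (u u' v : V) : form (u + u') v = form u v + form u' v :=
  Finsupp.sum_add_index' (by simp) (by intros; simp [add_mul])
theorem form_add_right (u v v' : V) : form u (v + v') = form u v + form u v' := by
  simp [form, mul_add, Finsupp.sum_add]
theorem form_smul_left (t : ℂ) (u v : V) : form (t • u) v = conj t * form u v := by
  simp only [form, Finsupp.mul_sum]
  rw [Finsupp.sum_smul_index' (by simp)]
  simp [mul_assoc]
theorem form_smul_right (t : ℂ) (u v : V) : form u (t • v) = t * form u v := by
  simp only [form, Finsupp.mul_sum, Finsupp.smul_apply, smul_eq_mul]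
  congr 1; ext x c; ring
theorem form_single_left (x : ℕ × ℤ) (c : ℂ) (v : V) :
    form (Finsupp.single x c) v = conj c * v x := Finsupp.sum_single_index (by simp)

theorem form_gen (g : Gen) (u v : V) : form u (repGen q g v) = form (repGen q g.conj u) v := by
  induction u using Finsupp.induction_linear with
  | zero => simp [form]
  | add u u' h h' => simp only [map_add, form_add_left, h, h']
  | single x c =>
    induction v using Finsupp.induction_linear with
    | zero => simp [form]
    | add u u' h h' => simp only [map_add, form_add_right, h, h']
    | single y d =>
      obtain ⟨n, l⟩ := x
      obtain ⟨m, j⟩ := y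
      cases g <;> simp only [repGen, Gen.conj, wshift_single, form_single_left,
        Finsupp.single_apply, Prod.mk.injEq, add_zero, id]
      · rcases m with _ | m
        · simp
        · by_cases h : m = n ∧ j = l
          · obtain ⟨rfl, rfl⟩ := h; simp; ring
          · rw [if_neg (by simpa using h), if_neg (by simpa using h)]; simp
      · rcases n with _ | n
        · simp
        · by_cases h : m = n ∧ j = l
          · obtain ⟨rfl, rfl⟩ := h; simp; ring
          · rw [if_neg (by simpa using h), if_neg (by simpa using h)]; simp
      · by_cases h : m = n ∧ j + 1 = l
        · obtain ⟨rfl, rfl⟩ := h; simp; ring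
        · rw [if_neg h, if_neg (by omega)]; simp
      · by_cases h : m = n ∧ j + (-1) = l
        · obtain ⟨rfl, rfl⟩ := h; simp; ring
        · rw [if_neg h, if_neg (by omega)]; simp

theorem form_rep (a : Poly q) (u v : V) : form u (rep q a v) = form (rep q (star a) u) v := by
  induction a using induction generalizing u v with
  | h1 => simp
  | hg x => rw [star_mk, rep_mk, rep_mk, form_gen]
  | hadd x y hx hy =>
    simp only [map_add, star_add, LinearMap.add_apply, form_add_left, form_add_right, hx, hy]
  | hmul x y hx hy => simp only [map_mul, star_mul, Module.End.mul_apply, hx, hy]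
  | hsmul t x hx =>
    simp only [map_smul, star_smul, LinearMap.smul_apply, form_smul_left, form_smul_right, hx]
    simp

open scoped ComplexOrder in
theorem form_self_nonneg (u : V) : 0 ≤ form u u :=
  Finset.sum_nonneg fun x _ => star_mul_self_nonneg (u x)

/-- The diagonal matrix coefficients `(e_{n,0}, a e_{n,0})`. -/
def diag (n : ℕ) : Poly q →ₗ[ℂ] ℂ where
  toFun a := rep q a (Finsupp.single (n, 0) 1) (n, 0)
  map_add' a b := by simp
  map_smul' t a := by simp

theorem diag_eq (n : ℕ) (a : Poly q) :
    diag n a = form (Finsupp.single (n, 0) 1) (rep q a (Finsupp.single (n, 0) 1)) := by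
  rw [form_single_left]; simp [diag]

theorem form_conj (u v : V) : conj (form u v) = form v u := by
  induction u using Finsupp.induction_linear with
  | zero => simp [form]
  | add u u' h h' => simp only [map_add, form_add_left, form_add_right, h, h']
  | single x c =>
    induction v using Finsupp.induction_linear with
    | zero => simp [form]
    | add u u' h h' => simp only [map_add, form_add_left, form_add_right, h, h']
    | single y d =>
      simp only [form_single_left, Finsupp.single_apply]
      by_cases h : x = y
      · subst h; simp; ring
      · rw [if_neg h, if_neg (Ne.symm h)]; simp

theorem diag_star (n : ℕ) (a : Poly q) : diag n (star a) = conj (diag n a) := by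
  rw [diag_eq, diag_eq, form_conj, form_rep, star_star, ]

theorem repGen_γ (v : V) (n : ℕ) (l : ℤ) :
    repGen q .c v (n, l) = ((q : ℝ) : ℂ) ^ n * v (n, l - 1) := by
  induction v using Finsupp.induction_linear with
  | zero => simp
  | add u u' h h' => simp only [map_add, Finsupp.add_apply, h, h', mul_add]
  | single y d =>
    obtain ⟨m, j⟩ := y
    simp only [repGen, wshift_single, Finsupp.single_apply, Prod.mk.injEq, id]
    by_cases h : m = n ∧ j + 1 = l
    · obtain ⟨rfl, rfl⟩ := h; simp
    · rw [if_neg h, if_neg (by omega)]; simp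

theorem repGen_γs (v : V) (n : ℕ) (l : ℤ) :
    repGen q .cstar v (n, l) = ((q : ℝ) : ℂ) ^ n * v (n, l + 1) := by
  induction v using Finsupp.induction_linear with
  | zero => simp
  | add u u' h h' => simp only [map_add, Finsupp.add_apply, h, h', mul_add]
  | single y d =>
    obtain ⟨m, j⟩ := y
    simp only [repGen, wshift_single, Finsupp.single_apply, Prod.mk.injEq, id]
    by_cases h : m = n ∧ j + (-1) = l
    · obtain ⟨rfl, rfl⟩ := h; simp
    · rw [if_neg h, if_neg (by omega)]; simp

theorem repGen_α (v : V) (n : ℕ) (l : ℤ) :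
    repGen q .a v (n, l) = (√(1 - (q : ℝ) ^ (2 * (n + 1))) : ℝ) * v (n + 1, l) := by
  induction v using Finsupp.induction_linear with
  | zero => simp
  | add u u' h h' => simp only [map_add, Finsupp.add_apply, h, h', mul_add]
  | single y d =>
    obtain ⟨m, j⟩ := y
    simp only [repGen, wshift_single, Finsupp.single_apply, Prod.mk.injEq, add_zero]
    rcases m with _ | m
    · simp
    · by_cases h : m = n ∧ j = l
      · obtain ⟨rfl, rfl⟩ := h; simp
      · rw [if_neg (by simpa using h), if_neg (by simpa using h)]; simp

theorem diag_mono (j m n k : ℕ) :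
    diag j (mono (q := q) m n k) = if k = 0 ∧ m = n then ((q : ℝ) : ℂ) ^ (2 * j * m) else 0 := by
  have hγ : ∀ (m : ℕ) (v : V) (l : ℤ), rep q (γ q ^ m) v (j, l) =
      ((q : ℝ) : ℂ) ^ (j * m) * v (j, l - m) := by
    intro m
    induction m with
    | zero => simp
    | succ m ih =>
      intro v l
      rw [pow_succ, map_mul, Module.End.mul_apply, ih, rep_mk, repGen_γ, ← mul_assoc, ← pow_add]
      congr 2; push_cast; ring_nf
  have hγs : ∀ (m : ℕ) (v : V) (l : ℤ), rep q (γs q ^ m) v (j, l) =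
      ((q : ℝ) : ℂ) ^ (j * m) * v (j, l + m) := by
    intro m
    induction m with
    | zero => simp
    | succ m ih =>
      intro v l
      rw [pow_succ, map_mul, Module.End.mul_apply, ih, rep_mk, repGen_γs, ← mul_assoc, ← pow_add]
      congr 2; push_cast; ring_nf
  have hα : ∀ (k : ℕ), ∃ c : ℕ → ℂ, ∀ (v : V) (n : ℕ) (l : ℤ), rep q (α q ^ k) v (n, l) =
      c n * v (n + k, l) := by
    intro k
    induction k with
    | zero => exact ⟨1, by simp⟩
    | succ k ih =>
      obtain ⟨c, hc⟩ := ih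
      refine ⟨fun n => c n * (√(1 - (q : ℝ) ^ (2 * (n + k + 1))) : ℝ), fun v n l => ?_⟩
      rw [pow_succ, map_mul, Module.End.mul_apply, hc, rep_mk, repGen_α, ← mul_assoc]
      rfl
  obtain ⟨c, hc⟩ := hα k
  change rep q (γ q ^ m * γs q ^ n * α q ^ k) _ _ = _
  rw [map_mul, map_mul, Module.End.mul_apply, Module.End.mul_apply, hγ, hγs, hc]
  by_cases h : k = 0 ∧ m = n
  · obtain ⟨rfl, rfl⟩ := h
    have := hc (Finsupp.single (j, 0) 1) j 0
    simp at this
    rw [← this]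
    simp
    ring
  · rw [if_neg h, Finsupp.single_apply, if_neg (by simp only [Prod.mk.injEq]; omega)]; simp

theorem diag_bound (a : Poly q) : ∃ M : ℝ, ∀ j, ‖diag j a‖ ≤ M := by
  have h1 : ∀ m n k, ∀ j, ‖diag j (mono (q := q) m n k)‖ ≤ 1 := by
    intro m n k j
    rw [diag_mono]
    split_ifs
    · rw [norm_pow, Complex.norm_real, Real.norm_of_nonneg q.2.1.le]
      exact pow_le_one₀ q.2.1.le q.2.2.le
    · simp
  induction a using mono_induction with
  | h m n k => exact ⟨1, h1 m n k⟩
  | h' m n k =>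
    refine ⟨‖((q : ℝ) : ℂ) ^ ((n + m) * k)‖ * 1, fun j => ?_⟩
    rw [mono'_eq, map_smul, norm_smul, diag_star, RCLike.norm_conj]
    exact mul_le_mul_of_nonneg_left (h1 _ _ _ j) (norm_nonneg _)
  | h0 => exact ⟨0, by simp⟩
  | hadd x y hx hy =>
    obtain ⟨M, hM⟩ := hx
    obtain ⟨N, hN⟩ := hy
    exact ⟨M + N, fun j => by rw [map_add]; exact norm_add_le_of_le (hM j) (hN j)⟩
  | hsmul t x hx =>
    obtain ⟨M, hM⟩ := hx
    exact ⟨‖t‖ * M, fun j => by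
      rw [map_smul, norm_smul]; exact mul_le_mul_of_nonneg_left (hM j) (norm_nonneg _)⟩

theorem diag_summable (a : Poly q) :
    Summable fun j : ℕ => ((q : ℝ) : ℂ) ^ (2 * j) * diag j a := by
  obtain ⟨M, hM⟩ := diag_bound a
  refine Summable.of_norm_bounded (g := fun j => ((q : ℝ) ^ 2) ^ j * M) ?_ fun j => ?_
  · exact (summable_geometric_of_lt_one (by positivity)
      (pow_lt_one₀ q.2.1.le q.2.2 two_ne_zero)).mul_right M
  · rw [norm_mul, norm_pow, Complex.norm_real, Real.norm_of_nonneg q.2.1.le, pow_mul]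
    exact mul_le_mul_of_nonneg_left (hM j) (by have := q.2.1; positivity)

variable (q) in
/-- Woronowicz's formula `h(a) = (1 - q²) ∑_n q^{2n} (e_{n,0}, a e_{n,0})` for the Haar state. -/
def haar : Poly q →ₗ[ℂ] ℂ where
  toFun a := (1 - ((q : ℝ) : ℂ) ^ 2) * ∑' j : ℕ, ((q : ℝ) : ℂ) ^ (2 * j) * diag j a
  map_add' a b := by
    simp only [map_add, mul_add]
    rw [(diag_summable a).tsum_add (diag_summable b), mul_add]
  map_smul' t a := by
    simp only [map_smul, smul_eq_mul, RingHom.id_apply, mul_left_comm _ t, tsum_mul_left]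

theorem haar_apply (a : Poly q) : haar q a =
    (1 - ((q : ℝ) : ℂ) ^ 2) * ∑' j : ℕ, ((q : ℝ) : ℂ) ^ (2 * j) * diag j a := rfl

theorem haar_star (a : Poly q) : haar q (star a) = conj (haar q a) := by
  simp only [haar_apply, diag_star, map_mul, map_sub, map_one, map_pow, Complex.conj_ofReal,
    Complex.conj_tsum]

open scoped ComplexOrder in
theorem haar_nonneg (a : Poly q) : 0 ≤ haar q (star a * a) := by
  have hq : (0 : ℝ) < q := q.2.1
  have h1 : (0 : ℂ) ≤ 1 - ((q : ℝ) : ℂ) ^ 2 := by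
    rw [← Complex.ofReal_one, ← Complex.ofReal_pow, ← Complex.ofReal_sub, Complex.zero_le_real]
    exact sub_nonneg.2 (pow_le_one₀ q.2.1.le q.2.2.le)
  refine mul_nonneg h1 (tsum_nonneg fun j => mul_nonneg ?_ ?_)
  · rw [← Complex.ofReal_pow, Complex.zero_le_real]; positivity
  · rw [diag_eq, map_mul, Module.End.mul_apply, form_rep, star_star]
    exact form_self_nonneg _

theorem haar_mono (m n k : ℕ) : haar q (mono m n k) =
    if k = 0 ∧ m = n then (1 - ((q : ℝ) : ℂ) ^ 2) / (1 - ((q : ℝ) : ℂ) ^ (2 * m + 2)) else 0 := by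
  simp only [haar_apply, diag_mono]
  split_ifs with h
  · have : ∀ j : ℕ, ((q : ℝ) : ℂ) ^ (2 * j) * ((q : ℝ) : ℂ) ^ (2 * j * m) =
      (((q : ℝ) : ℂ) ^ (2 * m + 2)) ^ j := by intro j; ring
    simp only [this]
    rw [tsum_geometric_of_norm_lt_one, div_eq_mul_inv]
    rw [norm_pow, Complex.norm_real, Real.norm_of_nonneg q.2.1.le]
    exact pow_lt_one₀ q.2.1.le q.2.2 (by omega)
  · simp

theorem haar_mono' (m n k : ℕ) (hk : k ≠ 0) : haar q (mono' m n k) = 0 := by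
  rw [mono'_eq, map_smul, haar_star, haar_mono, if_neg (by tauto)]; simp

/-! ### Invariance of the Haar state -/

theorem mul_mono (m n k : ℕ) (t u v : ℂ) :
    (t • γ q) ^ m * (u • γs q) ^ n * (v • α q) ^ k = (t ^ m * u ^ n * v ^ k) • mono m n k := by
  rw [smul_pow, smul_pow, smul_pow, smul_mul_smul_comm, smul_mul_smul_comm]; rfl

theorem K_pow (x : Poly q) (n : ℕ) : K q (x ^ n) = K q x ^ n := by
  induction n with
  | zero => simp [K_one]
  | succ n ih => rw [pow_succ, K_mul, ih, pow_succ]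

theorem Kinv_pow (x : Poly q) (n : ℕ) : Kinv q (x ^ n) = Kinv q x ^ n := by
  induction n with
  | zero => simp [Kinv_one]
  | succ n ih => rw [pow_succ, Kinv_mul, ih, pow_succ]

theorem K_mono (m n k : ℕ) :
    K q (mono m n k) = ((sq q)⁻¹ ^ m * sq q ^ n * sq q ^ k) • mono m n k := by
  rw [mono, K_mul, K_mul, K_pow, K_pow, K_pow, K_mk, K_mk, K_mk, mul_mono]; rfl

variable (q) in
/-- The coefficient in `γ^m ◁ f`. -/
def cf (m : ℕ) : ℂ := sq q * (sq q ^ m)⁻¹ * ((1 - sq q ^ (4 * m)) / (1 - sq q ^ 4))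

theorem sq_pow_ne (m : ℕ) (hm : m ≠ 0) : 1 - sq q ^ m ≠ 0 := by
  rw [sq, ← Complex.ofReal_pow, ← Complex.ofReal_one, ← Complex.ofReal_sub]
  have : Real.sqrt q < 1 := by rw [Real.sqrt_lt' one_pos]; simpa using q.2.2
  exact_mod_cast (sub_pos.2 (pow_lt_one₀ (Real.sqrt_nonneg _) this hm)).ne'

theorem F_γ_pow (m : ℕ) : F q (γ q ^ (m + 1)) = cf q (m + 1) • (γ q ^ m * α q) := by
  have h0 := sq_ne (q := q)
  have h4 := sq_pow_ne (q := q) 4 (by norm_num)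
  induction m with
  | zero =>
    simp only [zero_add, pow_one, pow_zero, one_mul, F_mk, cf]
    rw [mul_one, div_self h4, mul_one, mul_inv_cancel₀ h0, one_smul]
  | succ m ih =>
    rw [pow_succ' _ (m + 1), F_mul, ih, F_mk, Kinv_pow, Kinv_mk, K_mk]
    have := α_pow (q := q) (m + 1) 0
    simp only [pow_zero, mul_one, add_zero] at this
    simp only [smul_pow, mul_smul_comm, smul_mul_assoc, this, smul_smul, ← mul_assoc, ← pow_succ']
    rw [← add_smul]
    congr 1
    rw [← sq_sq, cf, cf]
    field_simp
    ring

theorem F_γs (n : ℕ) : F q (γs q ^ n) = 0 := by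
  induction n with
  | zero => simp [F_one]
  | succ n ih => rw [pow_succ, F_mul, ih, F_mk]; simp

theorem F_α (n : ℕ) : F q (α q ^ n) = 0 := by
  induction n with
  | zero => simp [F_one]
  | succ n ih => rw [pow_succ, F_mul, ih, F_mk]; simp

theorem F_mono_zero (n k : ℕ) : F q (mono 0 n k) = 0 := by
  rw [mono, pow_zero, one_mul, F_mul, F_γs, F_α]; simp

theorem F_mono (m n k : ℕ) : ∃ t : ℂ, t ≠ 0 ∧ F q (mono (m + 1) n k) = t • mono m n (k + 1) := by
  have h0 := sq_ne (q := q)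
  have h4 := sq_pow_ne (q := q) 4 (by norm_num)
  have h5 := sq_pow_ne (q := q) (4 * (m + 1)) (by omega)
  refine ⟨cf q (m + 1) * (sq q)⁻¹ ^ n * (sq q)⁻¹ ^ k * ((q : ℝ) : ℂ) ^ n, ?_, ?_⟩
  · rw [cf]
    have := q_ne q
    positivity
  · rw [mono, F_mul, F_mul, F_γs, F_α, F_γ_pow, Kinv_pow, Kinv_pow, Kinv_mk, Kinv_mk, mono]
    have := α_pow (q := q) 0 n
    simp only [pow_zero, one_mul, zero_add] at this
    simp only [smul_pow, mul_smul_comm, smul_mul_assoc, mul_zero, add_zero, mul_assoc (γ q ^ m)]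
    rw [this]
    simp only [mul_smul_comm, smul_mul_assoc, smul_smul, mul_assoc, ← pow_succ']
    congr 1; ring

theorem F_αs (k : ℕ) : ∃ t : ℂ, F q (αs q ^ (k + 1)) = t • (γs q * αs q ^ k) := by
  induction k with
  | zero => exact ⟨-((q : ℝ) : ℂ), by rw [zero_add, pow_one, F_mk]; simp [-Complex.coe_smul]⟩
  | succ k ih =>
    obtain ⟨t, ht⟩ := ih
    refine ⟨t * sq q + (sq q)⁻¹ ^ (k + 1) * (-((q : ℝ) : ℂ)) * (((q : ℝ) : ℂ)⁻¹) ^ (k + 1), ?_⟩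
    have h : αs q ^ (k + 1) * γs q = (((q : ℝ) : ℂ)⁻¹) ^ (k + 1) • (γs q * αs q ^ (k + 1)) := by
      have := congrArg star (α_pow_pow (q := q) 1 0 (k + 1))
      simp only [pow_one, pow_zero, mul_one, star_mul, star_smul, star_pow, star_mk,
        Complex.star_def, Complex.conj_ofReal, add_zero, one_mul] at this
      change γs q * αs q ^ (k + 1) = _ • (αs q ^ (k + 1) * γs q) at this
      rw [this, smul_smul, ← mul_pow, inv_mul_cancel₀ (q_ne q), one_pow, one_smul]
    rw [pow_succ, F_mul, ht, F_mk, Kinv_mk, K_pow, K_mk]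
    simp only [smul_pow, mul_neg, h, smul_smul, add_smul, mul_smul_comm, smul_mul_assoc]
    rw [mul_assoc, ← pow_succ]
    module

theorem Kinv_gp (m n : ℕ) (x : Poly q) : K q (γ q ^ m * γs q ^ n) * x =
    ((sq q)⁻¹ ^ m * sq q ^ n) • (γ q ^ m * γs q ^ n * x) := by
  rw [K_mul, K_pow, K_pow, K_mk, K_mk, smul_pow, smul_pow, smul_mul_smul_comm, smul_mul_assoc]

/-- The formula for `γ^{m+1} γ^{*n} α^{*(k+1)} ◁ f`. -/
theorem F_mono' (m n k : ℕ) (u : ℂ) (hu : F q (αs q ^ (k + 1)) = u • (γs q * αs q ^ k)) :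
    F q (mono' (m + 1) n (k + 1)) =
    (cf q (m + 1) * (sq q)⁻¹ ^ n * sq q ^ (k + 1) * ((q : ℝ) : ℂ) ^ n) •
      (mono' m n k - ((q : ℝ) : ℂ) ^ 2 • mono' (m + 1) (n + 1) k) +
    ((sq q)⁻¹ ^ (m + 1) * sq q ^ n * u) • mono' (m + 1) (n + 1) k := by
  have := α_pow (q := q) 0 n
  simp only [pow_zero, one_mul, zero_add] at this
  rw [mono', F_mul, hu, Kinv_gp, F_mul, F_γs, F_γ_pow, Kinv_pow, Kinv_pow, Kinv_mk, Kinv_mk, ← mono_ααs]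
  congr 1
  · simp only [smul_pow, mul_smul_comm, smul_mul_assoc, mul_zero, add_zero, mul_assoc (γ q ^ m)]
    rw [this]
    simp only [mul_smul_comm, smul_mul_assoc, smul_smul, mul_assoc]
    congr 1; ring
  · rw [mul_smul_comm, smul_smul, ← mul_assoc, mul_assoc _ _ (γs q), ← pow_succ]; rfl

theorem F_mono'_zero (n k : ℕ) (u : ℂ) (hu : F q (αs q ^ (k + 1)) = u • (γs q * αs q ^ k)) :
    F q (mono' 0 n (k + 1)) = (sq q ^ n * u) • mono' 0 (n + 1) k := by
  rw [mono', F_mul, hu, Kinv_gp, F_mul, F_γs, pow_zero, F_one, mul_smul_comm, smul_smul,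
    ← mul_assoc, mul_assoc _ _ (γs q), ← pow_succ]
  simp [mono']

theorem mono'_eq_mono (m n : ℕ) : mono' (q := q) m n 0 = mono m n 0 := by simp [mono, mono']

theorem F_αs_one : F q (αs q ^ (0 + 1)) = (-((q : ℝ) : ℂ)) • (γs q * αs q ^ 0) := by
  rw [zero_add, pow_one, F_mk]; simp [-Complex.coe_smul]

theorem haar_F (a : Poly q) : haar q (F q a) = 0 := by
  have h0 := sq_ne (q := q)
  have h4 := sq_pow_ne (q := q) 4 (by norm_num)
  induction a using mono_induction with
  | h m n k =>
    rcases m with _ | m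
    · rw [F_mono_zero, map_zero]
    · obtain ⟨t, -, h⟩ := F_mono (q := q) m n k
      rw [h, map_smul, haar_mono, if_neg (by simp), smul_zero]
  | h' m n k =>
    rcases k with _ | k
    · rw [mono'_eq_mono]
      rcases m with _ | m
      · rw [F_mono_zero, map_zero]
      · obtain ⟨t, -, h⟩ := F_mono (q := q) m n 0
        rw [h, map_smul, haar_mono, if_neg (by simp), smul_zero]
    · obtain ⟨u, hu⟩ := F_αs (q := q) k
      rcases k with _ | k
      · rcases m with _ | m
        · rw [F_mono'_zero _ _ _ hu, mono'_eq_mono, map_smul, haar_mono, if_neg (by simp),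
            smul_zero]
        · rw [F_mono' _ _ _ _ F_αs_one, mono'_eq_mono, mono'_eq_mono]
          simp only [map_add, map_sub, map_smul, haar_mono, true_and, add_left_inj, smul_eq_mul]
          split_ifs with h
          · subst h
            rw [cf, ← sq_sq]
            simp only [← pow_mul, inv_pow]
            have h5 := sq_pow_ne (q := q) (4 * (m + 1)) (by omega)
            have h6 : 1 - sq q ^ (2 * (2 * m + 2)) ≠ 0 := sq_pow_ne _ (by omega)
            have h7 : 1 - sq q ^ (2 * (2 * (m + 1) + 2)) ≠ 0 := sq_pow_ne _ (by omega)
            field_simp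
            ring
          · simp
      · rcases m with _ | m
        · rw [F_mono'_zero _ _ _ hu, map_smul, haar_mono' _ _ _ (by omega), smul_zero]
        · rw [F_mono' _ _ _ _ hu]
          simp only [map_add, map_sub, map_smul, haar_mono' _ _ _ (Nat.succ_ne_zero k)]
          simp
  | h0 => simp
  | hadd x y hx hy => rw [map_add, map_add, hx, hy, add_zero]
  | hsmul t x hx => rw [map_smul, map_smul, hx, smul_zero]

theorem haar_E (a : Poly q) : haar q (E q a) = 0 := by
  rw [← star_star (E q a), haar_star, star_E, map_neg, map_smul, haar_F]; simp

theorem star_K_mono (m n k : ℕ) : K q (star (mono m n k)) =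
    ((sq q)⁻¹ ^ m * sq q ^ n * sq q ^ k)⁻¹ • star (mono m n k) := by
  have h0 := sq_ne (q := q)
  have h : Kinv q (mono m n k) = ((sq q)⁻¹ ^ m * sq q ^ n * sq q ^ k)⁻¹ • mono m n k := by
    have := Kinv_K (mono (q := q) m n k)
    rw [K_mono, map_smul] at this
    nth_rw 2 [← this]
    rw [smul_smul, inv_mul_cancel₀ (by positivity), one_smul]
  rw [← star_K', h, star_smul]
  simp [conj_sq]

theorem haar_K (a : Poly q) : haar q (K q a) = haar q a := by
  have h0 := sq_ne (q := q)
  have h : ∀ m n k, (sq q)⁻¹ ^ m * sq q ^ n * sq q ^ k = 1 ∨ haar q (mono m n k) = 0 := by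
    intro m n k
    rw [haar_mono]
    split_ifs with h
    · left; obtain ⟨rfl, rfl⟩ := h; simp [h0]
    · right; rfl
  induction a using mono_induction with
  | h m n k =>
    rw [K_mono, map_smul]
    rcases h m n k with h | h
    · rw [h, one_smul]
    · rw [h, smul_zero]
  | h' m n k =>
    rw [mono'_eq, map_smul, star_K_mono, map_smul, map_smul, map_smul, haar_star]
    rcases h n m k with h | h
    · rw [h, inv_one, one_smul]
    · rw [h]; simp
  | h0 => simp
  | hadd x y hx hy => simp only [map_add, hx, hy]
  | hsmul t x hx => simp only [map_smul, hx]

theorem haar_one : haar q 1 = 1 := by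
  have h := haar_mono (q := q) 0 0 0
  have h4 := sq_pow_ne (q := q) 4 (by norm_num)
  have : mono (q := q) 0 0 0 = 1 := by simp [mono]
  rw [this, if_pos ⟨rfl, rfl⟩, mul_zero, zero_add, div_self] at h
  · exact h
  · rwa [← sq_sq, ← pow_mul]

/-- A linear map on `𝒜` with values in `𝒜` which is invariant under the right action of
`e, f, k` and vanishes at the unit is zero. -/
theorem eq_zero_of_invariant (Ψ : Poly q →ₗ[ℂ] Poly q) (h1 : Ψ 1 = 0)
    (hE : ∀ a, Ψ (E q a) = 0) (hF : ∀ a, Ψ (F q a) = 0) (hK : ∀ a, Ψ (K q a) = Ψ a)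
    (a : Poly q) : Ψ a = 0 := by
  have h0 := sq_ne (q := q)
  have hq := q_ne q
  have h4 := sq_pow_ne (q := q) 4 (by norm_num)
  have A : ∀ m n k, Ψ (mono m n (k + 1)) = 0 := by
    intro m n k
    obtain ⟨t, ht, h⟩ := F_mono (q := q) m n k
    have := hF (mono (m + 1) n k)
    rw [h, map_smul] at this
    exact (smul_eq_zero.1 this).resolve_left ht
  have A' : ∀ m n k, Ψ (star (mono m n (k + 1))) = 0 := by
    intro m n k
    obtain ⟨t, ht, h⟩ := F_mono (q := q) m n k
    have := congrArg Ψ (star_F (mono (m + 1) n k))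
    rw [h, map_neg, map_smul, hE, star_smul, map_smul, smul_zero, neg_zero] at this
    exact (smul_eq_zero.1 this).resolve_left (star_ne_zero.2 ht)
  have B : ∀ m n, m ≠ n → Ψ (mono m n 0) = 0 := by
    intro m n hmn
    have h := hK (mono m n 0)
    rw [K_mono, map_smul, ← sub_eq_zero] at h
    nth_rw 2 [← one_smul ℂ (Ψ _)] at h
    rw [← sub_smul] at h
    refine (smul_eq_zero.1 h).resolve_left fun h => hmn ?_
    rw [pow_zero, mul_one, inv_pow, sub_eq_zero, inv_mul_eq_one₀ (pow_ne_zero _ h0), sq,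
      ← Complex.ofReal_pow, ← Complex.ofReal_pow, Complex.ofReal_inj] at h
    have h2 : Real.sqrt q < 1 := by rw [Real.sqrt_lt' one_pos]; simpa using q.2.2
    exact pow_right_injective₀ (Real.sqrt_pos.2 q.2.1) h2.ne h
  have C : ∀ m, Ψ (mono m m 0) = 0 := by
    intro m
    induction m with
    | zero => simpa [mono] using h1
    | succ m ih =>
      have h5 := sq_pow_ne (q := q) (4 * (m + 1)) (by omega)
      have := hF (mono' (m + 1) m 1)
      rw [F_mono' _ _ _ _ F_αs_one, mono'_eq_mono, mono'_eq_mono] at this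
      simp only [map_add, map_sub, map_smul, ih, zero_sub, smul_neg, smul_smul] at this
      rw [← neg_smul, ← add_smul] at this
      refine (smul_eq_zero.1 this).resolve_left ?_
      have h6 := sq_pow_ne (q := q) (4 * (m + 2)) (by omega)
      have h7 : ∀ x : ℂ, x = -(sq q * (1 - sq q ^ (4 * (m + 2))) / (1 - sq q ^ 4)) → x ≠ 0 := by
        rintro _ rfl
        exact neg_ne_zero.2 (div_ne_zero (mul_ne_zero h0 h6) h4)
      apply h7
      rw [cf, ← sq_sq]
      simp only [← pow_mul, inv_pow]
      field_simp
      ring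
  have D : ∀ m n, Ψ (mono m n 0) = 0 := by
    intro m n
    by_cases h : m = n
    · subst h; exact C m
    · exact B m n h
  induction a using mono_induction with
  | h m n k => rcases k with _ | k; exacts [D m n, A m n k]
  | h' m n k =>
    rcases k with _ | k
    · rw [mono'_eq_mono]; exact D m n
    · rw [mono'_eq, map_smul, A', smul_zero]
  | h0 => simp
  | hadd x y hx hy => rw [map_add, hx, hy, add_zero]
  | hsmul t x hx => rw [map_smul, hx, smul_zero]

/-! ### The Haar state -/

/-- Coassociativity. -/
theorem comul_coassoc (a : Poly q) :
    TensorProduct.assoc ℂ _ _ _ (comul.toLinearMap.rTensor (Poly q) (comul a)) =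
      comul.toLinearMap.lTensor (Poly q) (comul a) := by
  have : ((Algebra.TensorProduct.assoc ℂ ℂ ℂ (Poly q) (Poly q) (Poly q)).toAlgHom.comp
      (Algebra.TensorProduct.map comul (AlgHom.id ℂ (Poly q)))).comp comul =
      (Algebra.TensorProduct.map (AlgHom.id ℂ (Poly q)) comul).comp comul := by
    apply algHom_ext
    intro x
    cases x <;> simp [comul_mk, comulGen, TensorProduct.tmul_add, TensorProduct.add_tmul,
      TensorProduct.tmul_sub, TensorProduct.sub_tmul, ← TensorProduct.smul_tmul', smul_add,
      -Complex.coe_smul] <;> module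
  exact DFunLike.congr_fun this a

open scoped ComplexOrder in
/-- The Haar state of `SU_q(2)`: a functional `h` on `𝒜` with `h(1) = 1` and `h(a^* a) ≥ 0` such
that `(h ⊗ ι)Δ(a) = h(a) 1 = (ι ⊗ h)Δ(a)`. -/
structure IsHaarState (h : Poly q →ₗ[ℂ] ℂ) : Prop where
  map_one : h 1 = 1
  nonneg : ∀ a, 0 ≤ h (star a * a)
  left_invariant : ∀ a, actL h a = h a • 1
  right_invariant : ∀ a, actR h a = h a • 1

theorem actR_actR (h ω : Poly q →ₗ[ℂ] ℂ) (hω : ∀ a, h (actR ω a) = ω 1 * h a) (a : Poly q) :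
    actR h (actR ω a) = ω 1 • actR h a := by
  let T : Poly q ⊗[ℂ] (Poly q ⊗[ℂ] Poly q) →ₗ[ℂ] Poly q :=
    (TensorProduct.lid ℂ (Poly q)).toLinearMap ∘ₗ h.rTensor (Poly q) ∘ₗ
      (TensorProduct.lid ℂ (Poly q ⊗[ℂ] Poly q)).toLinearMap ∘ₗ ω.rTensor (Poly q ⊗[ℂ] Poly q)
  have h1 : ∀ X : Poly q ⊗[ℂ] Poly q, actR h (TensorProduct.lid ℂ (Poly q) (ω.rTensor (Poly q) X)) =
      T (comul.toLinearMap.lTensor (Poly q) X) := by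
    intro X
    induction X using TensorProduct.induction_on with
    | zero => simp
    | add X Y hX hY => simp only [map_add, hX, hY]
    | tmul a b => simp [T, actR]
  have h2 : ∀ X : Poly q ⊗[ℂ] Poly q,
      T (TensorProduct.assoc ℂ _ _ _ (comul.toLinearMap.rTensor (Poly q) X)) =
        TensorProduct.lid ℂ (Poly q) ((h ∘ₗ actR ω).rTensor (Poly q) X) := by
    intro X
    induction X using TensorProduct.induction_on with
    | zero => simp
    | add X Y hX hY => simp only [map_add, hX, hY]
    | tmul a b =>
      simp only [LinearMap.rTensor_tmul, AlgHom.toLinearMap_apply, LinearMap.comp_apply,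
        TensorProduct.lid_tmul, actR_apply]
      generalize comul a = Y
      induction Y using TensorProduct.induction_on with
      | zero => simp
      | add X Y hX hY => simp only [TensorProduct.add_tmul, map_add, hX, hY, add_smul]
      | tmul c d => simp [T, smul_smul]
  have h3 : h ∘ₗ actR ω = ω 1 • h := by
    ext a; simpa using hω a
  rw [actR_apply ω, h1, ← comul_coassoc, h2, h3, LinearMap.rTensor_smul, LinearMap.smul_apply,
    map_smul]; rfl

theorem haar_right_invariant (a : Poly q) : actR (haar q) a = haar q a • 1 := by
  have := eq_zero_of_invariant (q := q) (actR (haar q) - (haar q).smulRight 1) ?_ ?_ ?_ ?_ a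
  · simpa [sub_eq_zero] using this
  · simp [actR_one]
  · intro a
    have := actR_actR (haar q) (e q) (fun a => by rw [haar_E, e_one, zero_mul]) a
    simp [this, e_one, haar_E]
  · intro a
    have := actR_actR (haar q) (f q) (fun a => by rw [haar_F, f_one, zero_mul]) a
    simp [this, f_one, haar_F]
  · intro a
    have := actR_actR (haar q) (k q).toLinearMap (fun a => by rw [haar_K]; simp) a
    simp [this, haar_K]

/-- The values on the generators of the automorphism `θ` of `𝒜` which transposes the
fundamental corepresentation. -/
def transposeGen : Gen → Poly q
  | .a => α q
  | .astar => αs q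
  | .c => -(((q : ℝ) : ℂ) • γs q)
  | .cstar => -(((q : ℝ) : ℂ)⁻¹ • γ q)

theorem good_transpose : Good q (transposeGen (q := q)) := by
  have hq := q_ne q
  constructor <;>
  simp only [transposeGen, neg_mul, mul_neg, neg_neg, smul_mul_assoc, mul_smul_comm, smul_smul,
    hq, inv_mul_cancel₀, mul_inv_cancel₀, one_smul, ne_eq, not_false_eq_true, γ_γs, α_αs, αs_α,
    α_γ, α_γs, γs_αs, γ_αs, ne_eq, sub_add_cancel, smul_neg]

/-- The automorphism `θ` of `𝒜` which transposes the fundamental corepresentation. -/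
def transpose : Poly q →ₐ[ℂ] Poly q := lift _ good_transpose

theorem transpose_transpose (a : Poly q) : transpose (transpose a) = a := by
  have hq := q_ne q
  have : (transpose (q := q)).comp transpose = AlgHom.id ℂ _ := by
    apply algHom_ext
    intro x
    cases x <;>
      simp [transpose, transposeGen, smul_smul, hq, -Complex.coe_smul, -Complex.real_smul]
  exact DFunLike.congr_fun this a

theorem comul_transpose (a : Poly q) : comul (transpose a) = TensorProduct.comm ℂ _ _
    (TensorProduct.map transpose.toLinearMap transpose.toLinearMap (comul a)) := by
  have hq := q_ne q
  have : comul.comp (transpose (q := q)) = ((Algebra.TensorProduct.comm ℂ (Poly q) (Poly q)).toAlgHom.comp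
      (Algebra.TensorProduct.map transpose transpose)).comp comul := by
    apply algHom_ext
    intro x
    cases x <;>
      simp [transpose, transposeGen, comul_mk, comulGen, TensorProduct.tmul_neg,
        TensorProduct.neg_tmul, ← TensorProduct.smul_tmul', smul_smul, hq, -Complex.coe_smul]
  exact DFunLike.congr_fun this a

theorem haar_transpose (a : Poly q) : haar q (transpose a) = haar q a := by
  have hq := q_ne q
  have hg : ∀ m n, transpose (γ q ^ m * γs q ^ n) =
      ((-((q : ℝ) : ℂ)) ^ m * (-((q : ℝ) : ℂ)⁻¹) ^ n) • (γ q ^ n * γs q ^ m) := by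
    intro m n
    rw [map_mul, map_pow, map_pow, transpose, lift_mk, lift_mk, transposeGen, transposeGen,
      ← neg_smul, ← neg_smul, smul_pow, smul_pow, smul_mul_smul_comm,
      ((show Commute (γ q) (γs q) from γ_γs).pow_pow n m).eq]
  have ha : transpose (α q) = α q := by rw [transpose, lift_mk]; rfl
  have ha' : transpose (αs q) = αs q := by rw [transpose, lift_mk]; rfl
  have h1 : ∀ m n k, transpose (mono (q := q) m n k) =
      ((-((q : ℝ) : ℂ)) ^ m * (-((q : ℝ) : ℂ)⁻¹) ^ n) • mono n m k := by
    intro m n k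
    rw [mono, map_mul, hg, map_pow, ha, smul_mul_assoc]; rfl
  have h2 : ∀ m n k, transpose (mono' (q := q) m n k) =
      ((-((q : ℝ) : ℂ)) ^ m * (-((q : ℝ) : ℂ)⁻¹) ^ n) • mono' n m k := by
    intro m n k
    rw [mono', map_mul, hg, map_pow, ha', smul_mul_assoc]; rfl
  have h3 : ∀ m n k, haar q (transpose (mono m n k)) = haar q (mono m n k) := by
    intro m n k
    rw [h1, map_smul, haar_mono, haar_mono]
    by_cases h : k = 0 ∧ m = n
    · obtain ⟨rfl, rfl⟩ := h
      rw [← mul_pow, neg_mul_neg, mul_inv_cancel₀ hq, one_pow, one_smul]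
    · rw [if_neg h, if_neg (by omega), smul_zero]
  induction a using mono_induction with
  | h m n k => exact h3 m n k
  | h' m n k =>
    rcases k with _ | k
    · rw [mono'_eq_mono]; exact h3 m n 0
    · rw [h2, map_smul, haar_mono' _ _ _ (by omega), haar_mono' _ _ _ (by omega), smul_zero]
  | h0 => simp
  | hadd x y hx hy => simp only [map_add, hx, hy]
  | hsmul t x hx => simp only [map_smul, hx]

theorem haar_left_invariant (a : Poly q) : actL (haar q) a = haar q a • 1 := by
  have h1 : transpose (actL (haar q) a) = actR (haar q) (transpose a) := by
    rw [actR_apply, comul_transpose]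
    change transpose (TensorProduct.rid ℂ (Poly q) ((haar q).lTensor (Poly q) (comul a))) = _
    generalize comul a = X
    induction X using TensorProduct.induction_on with
    | zero => simp
    | add X Y hX hY => simp only [map_add, hX, hY]
    | tmul a b => simp [haar_transpose]
  rw [haar_right_invariant, haar_transpose] at h1
  rw [← transpose_transpose (actL (haar q) a), h1, map_smul, map_one]

variable (q) in
theorem isHaarState_haar : IsHaarState (haar q) :=
  ⟨haar_one, haar_nonneg, haar_left_invariant, haar_right_invariant⟩

/-! ### The Hilbert space `L²(A, h)` -/

variable (q) in
/-- The space `𝒜` with the inner product `(a, b) = h(a^* b)`. -/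
def PreH : Type := Poly q

instance : AddCommGroup (PreH q) := inferInstanceAs (AddCommGroup (Poly q))
instance : Module ℂ (PreH q) := inferInstanceAs (Module ℂ (Poly q))

variable (q) in
/-- The identity map `𝒜 → PreH`. -/
def toPre : Poly q ≃ₗ[ℂ] PreH q := LinearEquiv.refl ℂ _

variable (q) in
/-- The inner product `(a, b) = h(a^* b)`. -/
abbrev preCore : PreInnerProductSpace.Core ℂ (PreH q) where
  inner a b := haar q (star ((toPre q).symm a) * (toPre q).symm b)
  conj_inner_symm a b := by rw [← haar_star, star_mul, star_star]
  re_inner_nonneg a := (Complex.nonneg_iff.1 (haar_nonneg _)).1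
  add_left a b c := by rw [map_add, star_add, add_mul, map_add]
  smul_left a b t := by
    rw [map_smul, star_smul, smul_mul_assoc, map_smul]; rfl

instance : SeminormedAddCommGroup (PreH q) :=
  InnerProductSpace.Core.toSeminormedAddCommGroup (c := preCore q)
instance : InnerProductSpace ℂ (PreH q) := InnerProductSpace.ofCore (preCore q)

theorem inner_pre (a b : Poly q) : ⟪toPre q a, toPre q b⟫_ℂ = haar q (star a * b) := rfl

theorem norm_pre_sq (a : Poly q) : ‖toPre q a‖ ^ 2 = (haar q (star a * a)).re := by
  rw [← inner_pre, ← inner_self_eq_norm_sq (𝕜 := ℂ)]; rfl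

variable (q) in
/-- The Hilbert space `H = L²(A, h)` of the GNS representation for the Haar state. -/
abbrev H : Type := UniformSpace.Completion (PreH q)

variable (q) in
/-- The map `a ↦ a ξ_h` from `𝒜` to `H`. -/
def toH : Poly q →ₗ[ℂ] H q :=
  (UniformSpace.Completion.toComplL : PreH q →L[ℂ] H q).toLinearMap ∘ₗ (toPre q).toLinearMap

theorem inner_toH (a b : Poly q) : ⟪toH q a, toH q b⟫_ℂ = haar q (star a * b) := by
  rw [← inner_pre]
  exact UniformSpace.Completion.inner_coe _ _

theorem leftMul_bound (a : Poly q) : ∃ M : ℝ, ∀ x : Poly q, ‖toPre q (a * x)‖ ≤ M * ‖toPre q x‖ := by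
  have aux : ∀ (g b : Poly q), star g * g + star b * b = 1 → ∀ x : Poly q,
      ‖toPre q (g * x)‖ ≤ 1 * ‖toPre q x‖ := by
    intro g b h x
    rw [one_mul, ← sq_le_sq₀ (norm_nonneg _) (norm_nonneg _), norm_pre_sq, norm_pre_sq]
    have h1 : star x * x = star (g * x) * (g * x) + star (b * x) * (b * x) := by
      have : star x * (star g * g + star b * b) * x = star x * x := by rw [h, mul_one]
      rw [← this]; simp only [star_mul]; noncomm_ring
    rw [h1, map_add, Complex.add_re]
    exact le_add_of_nonneg_right (Complex.nonneg_iff.1 (haar_nonneg _)).1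
  induction a using induction with
  | h1 => exact ⟨1, fun x => by rw [one_mul, one_mul]⟩
  | hg g =>
    refine ⟨1, ?_⟩
    have e1 : αs q * α q + γs q * γ q = 1 := (good_mk q).r1
    have e2 : α q * αs q + ((q : ℝ) : ℂ) ^ 2 • (γs q * γ q) = 1 := (good_mk q).r2
    cases g
    · refine aux _ (γ q) ?_
      rw [star_mk, star_mk]; exact e1
    · refine aux _ (((q : ℝ) : ℂ) • γ q) ?_
      rw [star_smul, star_mk, star_mk, smul_mul_smul_comm, Complex.star_def, Complex.conj_ofReal,
        ← pow_two]
      exact e2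
    · refine aux _ (α q) ?_
      rw [star_mk, star_mk, add_comm]; exact e1
    · refine aux _ (α q) ?_
      rw [star_mk, star_mk, add_comm]
      change αs q * α q + γ q * γs q = 1
      rw [γ_γs]; exact e1
  | hadd a b ha hb =>
    obtain ⟨M, hM⟩ := ha
    obtain ⟨N, hN⟩ := hb
    refine ⟨M + N, fun x => ?_⟩
    rw [add_mul, map_add, add_mul]
    exact norm_add_le_of_le (hM x) (hN x)
  | hmul a b ha hb =>
    obtain ⟨M, hM⟩ := ha
    obtain ⟨N, hN⟩ := hb
    refine ⟨|M| * N, fun x => ?_⟩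
    rw [mul_assoc a, mul_assoc |M|]
    exact (hM _).trans ((mul_le_mul_of_nonneg_right (le_abs_self M) (norm_nonneg _)).trans
      (mul_le_mul_of_nonneg_left (hN x) (abs_nonneg M)))
  | hsmul t a ha =>
    obtain ⟨M, hM⟩ := ha
    refine ⟨‖t‖ * M, fun x => ?_⟩
    rw [smul_mul_assoc, map_smul, norm_smul, mul_assoc]
    exact mul_le_mul_of_nonneg_left (hM x) (norm_nonneg _)

/-- Left multiplication by `a ∈ 𝒜` as a bounded operator on `PreH`. -/
def preMul (a : Poly q) : PreH q →L[ℂ] PreH q :=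
  LinearMap.mkContinuousOfExistsBound
    ((toPre q).toLinearMap ∘ₗ LinearMap.mulLeft ℂ a ∘ₗ (toPre q).symm.toLinearMap)
    ((leftMul_bound a).imp fun _ h x => h ((toPre q).symm x))

/-- The element `a ∈ 𝒜` as a bounded operator on `H = L²(A, h)`. -/
def leftMul (a : Poly q) : H q →L[ℂ] H q := (preMul a).completion

theorem leftMul_toH (a b : Poly q) : leftMul a (toH q b) = toH q (a * b) :=
  ContinuousLinearMap.completion_apply_coe _ _

/-! ### The Casimir operator -/

variable (q) in
/-- The operator of `k` in the representation `ω ↦ (a ↦ a ◁ Ŝ⁻¹(ω))`; `Ŝ⁻¹(k) = k⁻¹`. -/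
def opK : Module.End ℂ (Poly q) := actR (kInv q).toLinearMap
variable (q) in
/-- The operator of `k⁻¹` in the representation `ω ↦ (a ↦ a ◁ Ŝ⁻¹(ω))`; `Ŝ⁻¹(k⁻¹) = k`. -/
def opKInv : Module.End ℂ (Poly q) := actR (k q).toLinearMap
variable (q) in
/-- The operator of `e` in the representation `ω ↦ (a ↦ a ◁ Ŝ⁻¹(ω))`; `Ŝ⁻¹(e) = -q e`. -/
def opE : Module.End ℂ (Poly q) := actR (-((q : ℝ) : ℂ) • e q)
variable (q) in
/-- The operator of `f` in the representation `ω ↦ (a ↦ a ◁ Ŝ⁻¹(ω))`; `Ŝ⁻¹(f) = -q⁻¹ f`. -/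
def opF : Module.End ℂ (Poly q) := actR (-((q : ℝ) : ℂ)⁻¹ • f q)

variable (q) in
/-- The Casimir `C = f e + ((q^{1/2} k - q^{-1/2} k⁻¹) / (q - q⁻¹))²` in the representation
`ω ↦ (a ↦ a ◁ Ŝ⁻¹(ω))` on `𝒜`. -/
def casimir : Module.End ℂ (Poly q) :=
  opF q * opE q +
    ((((q : ℝ) : ℂ) - ((q : ℝ) : ℂ)⁻¹)⁻¹ • (sq q • opK q - (sq q)⁻¹ • opKInv q)) ^ 2

variable (q) in
/-- The graph of the Casimir operator on `H`, the closure of the operator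
`a ξ_h ↦ C(a) ξ_h`, `a ∈ 𝒜`. -/
def casimirGraph : Submodule ℂ (H q × H q) :=
  (LinearMap.range ((toH q).prod (toH q ∘ₗ casimir q))).topologicalClosure

theorem actR_smul (t : ℂ) (ω : Poly q →ₗ[ℂ] ℂ) : actR (t • ω) = t • actR ω := by
  ext a
  simp [actR, LinearMap.rTensor_smul]

theorem opE_apply (a : Poly q) : opE q a = -((q : ℝ) : ℂ) • E q a := by
  rw [opE, actR_smul]; rfl
theorem opF_apply (a : Poly q) : opF q a = -((q : ℝ) : ℂ)⁻¹ • F q a := by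
  rw [opF, actR_smul]; rfl

theorem haar_opE (a b : Poly q) : haar q (star (opE q a) * b) = haar q (star a * opF q b) := by
  have hq := q_ne q
  have h1 : star (opE q a) = F q (star a) := by
    rw [opE_apply, star_smul, star_E]
    simp [smul_smul, hq, -Complex.coe_smul]
  have h2 := haar_F (star a * K q b)
  rw [F_mul, Kinv_K, F_K, mul_smul_comm, ← K_mul, map_add, map_smul, haar_K] at h2
  rw [h1, opF_apply, mul_smul_comm, map_smul, neg_smul]
  exact eq_neg_of_add_eq_zero_left h2

theorem haar_opF (a b : Poly q) : haar q (star (opF q a) * b) = haar q (star a * opE q b) := by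
  have := congrArg conj (haar_opE b a)
  rw [← haar_star, ← haar_star, star_mul, star_mul, star_star, star_star] at this
  exact this.symm

theorem haar_opKInv (a b : Poly q) :
    haar q (star (opKInv q a) * b) = haar q (star a * opKInv q b) := by
  change haar q (star (K q a) * b) = haar q (star a * K q b)
  rw [star_K, ← haar_K, K_mul, K_K']

theorem haar_opK (a b : Poly q) : haar q (star (opK q a) * b) = haar q (star a * opK q b) := by
  change haar q (star (Kinv q a) * b) = haar q (star a * Kinv q b)
  rw [star_K', ← haar_K (star a * _), K_mul, K_K']

theorem haar_casimir (a b : Poly q) :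
    haar q (star (casimir q a) * b) = haar q (star a * casimir q b) := by
  have h : ∀ a b, haar q (star (((((q : ℝ) : ℂ) - ((q : ℝ) : ℂ)⁻¹)⁻¹ •
      (sq q • opK q - (sq q)⁻¹ • opKInv q)) a) * b) = haar q (star a * ((((q : ℝ) : ℂ) -
      ((q : ℝ) : ℂ)⁻¹)⁻¹ • (sq q • opK q - (sq q)⁻¹ • opKInv q)) b) := by
    intro a b
    simp only [LinearMap.smul_apply, LinearMap.sub_apply, star_smul, star_sub, smul_mul_assoc,
      sub_mul, mul_sub, mul_smul_comm, map_smul, map_sub, haar_opK, haar_opKInv, Complex.star_def,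
      map_inv₀, Complex.conj_ofReal, conj_sq]
  simp only [casimir, LinearMap.add_apply, star_add, add_mul, mul_add, map_add, pow_two,
    Module.End.mul_apply, h, haar_opF, haar_opE]

theorem casimirGraph_symm {x y : H q × H q} (hx : x ∈ casimirGraph q) (hy : y ∈ casimirGraph q) :
    ⟪x.2, y.1⟫_ℂ = ⟪x.1, y.2⟫_ℂ := by
  have h1 : ∀ a : Poly q, ∀ y ∈ casimirGraph q, ⟪toH q (casimir q a), y.1⟫_ℂ = ⟪toH q a, y.2⟫_ℂ := by
    intro a y hy
    refine closure_minimal (s := (LinearMap.range ((toH q).prod (toH q ∘ₗ casimir q)) :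
      Set (H q × H q))) (t := {y | ⟪toH q (casimir q a), y.1⟫_ℂ = ⟪toH q a, y.2⟫_ℂ}) ?_ ?_ hy
    · rintro _ ⟨b, rfl⟩
      simp only [Set.mem_ofPred_eq, LinearMap.prod_apply, Function.prod_apply, LinearMap.comp_apply,
        inner_toH, haar_casimir]
    · exact isClosed_eq (by fun_prop) (by fun_prop)
  refine closure_minimal (s := (LinearMap.range ((toH q).prod (toH q ∘ₗ casimir q)) :
    Set (H q × H q))) (t := {x | ⟪x.2, y.1⟫_ℂ = ⟪x.1, y.2⟫_ℂ}) ?_ ?_ hx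
  · rintro _ ⟨b, rfl⟩
    exact h1 b y hy
  · exact isClosed_eq (by fun_prop) (by fun_prop)

variable (q) in
/-- The eigenspace `ker (C - lam)` of the Casimir operator. -/
def eigenspace (lam : ℝ) : Submodule ℂ (H q) :=
  (casimirGraph q).comap (LinearMap.id.prod ((lam : ℂ) • LinearMap.id))

theorem isClosed_eigenspace (lam : ℝ) : IsClosed (eigenspace q lam : Set (H q)) := by
  have h : IsClosed (casimirGraph q : Set (H q × H q)) := Submodule.isClosed_topologicalClosure _
  have hc : Continuous fun x : H q => (x, (lam : ℂ) • x) :=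
    continuous_id.prodMk (continuous_const_smul _)
  change IsClosed ((fun x : H q => (x, (lam : ℂ) • x)) ⁻¹' (casimirGraph q : Set (H q × H q)))
  exact h.preimage hc

instance (lam : ℝ) : CompleteSpace (eigenspace q lam) :=
  (isClosed_eigenspace lam).completeSpace_coe

theorem eigenspace_ortho {lam mu : ℝ} (h : lam ≠ mu) : eigenspace q lam ⟂ eigenspace q mu := by
  rw [Submodule.isOrtho_iff_inner_eq]
  intro x hx y hy
  have := casimirGraph_symm hx hy
  simp only [LinearMap.prod_apply, Function.prod_apply, LinearMap.id_apply, LinearMap.smul_apply,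
    inner_smul_left, inner_smul_right, Complex.conj_ofReal] at this
  by_contra h0
  exact h (by exact_mod_cast mul_right_cancel₀ h0 this)

variable (q) in
/-- The spectral projection of the Casimir operator for the eigenvalue `lam`. -/
def specProj (lam : ℝ) : H q →L[ℂ] H q := (eigenspace q lam).starProjection

/-! ### Complex powers of the Casimir operator and the Sobolev scale -/

variable (q) in
/-- The domain of `C^z`: the vectors `ξ` with `∑ |lam^z|² ‖P_lam ξ‖² < ∞`, where `lam` runs
through the positive reals and `P_lam` is the projection onto `ker (C - lam)`. (The Casimir
operator is diagonalizable with eigenvalues `[s + 1/2]_q² > 0`, so that this is the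
functional calculus of `C`.) -/
def domPow (z : ℂ) : Submodule ℂ (H q) where
  carrier := {ξ | Summable fun lam : Set.Ioi (0 : ℝ) =>
    ‖((lam : ℝ) : ℂ) ^ z • specProj q lam ξ‖ ^ 2}
  zero_mem' := by simp [summable_zero]
  add_mem' := by
    intro x y hx hy
    refine Summable.of_nonneg_of_le (fun _ => by positivity) (fun lam => ?_)
      ((hx.mul_left 2).add (hy.mul_left 2))
    rw [map_add, smul_add, ← mul_add]
    exact (pow_le_pow_left₀ (norm_nonneg _) (norm_add_le _ _) 2).trans (add_sq_le)
  smul_mem' := by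
    intro t x hx
    refine (hx.mul_left (‖t‖ ^ 2)).congr fun lam => ?_
    rw [map_smul, smul_comm, norm_smul t, mul_pow]

variable (q) in
/-- The space `H_∞ = ⋂_t H_t`, `H_t = Domain(C^{t/2})`. (For `t < 0` the domain of `C^{t/2}`
is all of `H`.) -/
def Hinf : Submodule ℂ (H q) := ⨅ t : ℝ, domPow q ((t / 2 : ℝ) : ℂ)

theorem mem_domPow_iff {z : ℂ} {ξ : H q} : ξ ∈ domPow q z ↔ Summable fun lam : Set.Ioi (0 : ℝ) =>
    ‖((lam : ℝ) : ℂ) ^ z • specProj q lam ξ‖ ^ 2 := Iff.rfl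

theorem mem_domPow {z : ℂ} {ξ : H q} : ξ ∈ domPow q z ↔ ξ ∈ domPow q ((z.re : ℝ) : ℂ) := by
  rw [mem_domPow_iff, mem_domPow_iff]
  refine summable_congr fun lam => ?_
  rw [norm_smul, norm_smul, Complex.norm_cpow_eq_rpow_re_of_pos lam.2,
    Complex.norm_cpow_eq_rpow_re_of_pos lam.2, Complex.ofReal_re]

theorem Hinf_le (z : ℂ) : Hinf q ≤ domPow q z := by
  intro ξ h
  rw [mem_domPow]
  have := (Submodule.mem_iInf _).1 h (2 * z.re)
  rwa [mul_div_cancel_left₀ _ (two_ne_zero' ℝ)] at this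

theorem summable_pow {z : ℂ} {ξ : H q} (h : ξ ∈ domPow q z) :
    Summable fun lam : Set.Ioi (0 : ℝ) => ((lam : ℝ) : ℂ) ^ z • specProj q lam ξ := by
  have hV : OrthogonalFamily ℂ (fun lam : Set.Ioi (0 : ℝ) => eigenspace q lam)
      fun lam => (eigenspace q lam).subtypeₗᵢ :=
    OrthogonalFamily.of_pairwise fun i j hij => eigenspace_ortho (by simpa [Subtype.ext_iff] using hij)
  exact (hV.summable_iff_norm_sq_summable fun lam : Set.Ioi (0 : ℝ) =>
    (⟨((lam : ℝ) : ℂ) ^ z • specProj q lam ξ, Submodule.smul_mem _ _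
      (Submodule.starProjection_apply_mem _ _)⟩ : eigenspace q lam)).2 h

variable (q) in
/-- `C^z ξ = ∑ lam^z P_lam ξ`. -/
def powSum (z : ℂ) (ξ : H q) : H q :=
  ∑' lam : Set.Ioi (0 : ℝ), ((lam : ℝ) : ℂ) ^ z • specProj q lam ξ

theorem specProj_powSum {z : ℂ} {ξ : H q} (h : ξ ∈ domPow q z) (mu : Set.Ioi (0 : ℝ)) :
    specProj q mu (powSum q z ξ) = ((mu : ℝ) : ℂ) ^ z • specProj q mu ξ := by
  rw [powSum, (specProj q mu).map_tsum (summable_pow h), tsum_eq_single mu]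
  · rw [map_smul]
    congr 1
    exact Submodule.starProjection_eq_self_iff.2 (Submodule.starProjection_apply_mem _ _)
  · intro lam hlam
    rw [map_smul]
    have : specProj q mu (specProj q lam ξ) = 0 := by
      refine (Submodule.starProjection_apply_eq_zero_iff _).2 ?_
      exact (eigenspace_ortho (fun h => hlam (Subtype.ext h))).le
        (Submodule.starProjection_apply_mem _ _)
    rw [this, smul_zero]

theorem powSum_mem (z : ℂ) {ξ : H q} (h : ξ ∈ Hinf q) : powSum q z ξ ∈ Hinf q := by
  refine (Submodule.mem_iInf _).2 fun t => ?_
  refine (mem_domPow_iff.1 (Hinf_le (((t / 2 : ℝ) : ℂ) + z) h)).congr fun lam => ?_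
  rw [specProj_powSum (Hinf_le z h), smul_smul, Complex.cpow_add]
  exact_mod_cast lam.2.ne'

variable (q) in
/-- The operator `C^z` on `H_∞`. -/
def cpow (z : ℂ) : Hinf q →ₗ[ℂ] Hinf q where
  toFun ξ := ⟨powSum q z ξ, powSum_mem z ξ.2⟩
  map_add' x y := by
    ext
    simp only [powSum, Submodule.coe_add, map_add, smul_add]
    exact (summable_pow (Hinf_le z x.2)).tsum_add (summable_pow (Hinf_le z y.2))
  map_smul' t x := by
    ext
    simp only [powSum, Submodule.coe_smul, map_smul, RingHom.id_apply, smul_comm _ t]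
    exact (summable_pow (Hinf_le z x.2)).tsum_const_smul t

/-- The Sobolev norm `‖ξ‖_t = ‖C^{t/2} ξ‖` on `H_∞`, `t ∈ ℝ`. -/
def sobNorm (t : ℝ) (ξ : Hinf q) : ℝ := ‖(cpow q ((t / 2 : ℝ) : ℂ) ξ : H q)‖

/-- `T ∈ op^r`: the operator `T : H_∞ → H_∞` extends by continuity to a bounded operator
`H_t → H_{t-r}` for every `t ∈ ℝ`. -/
def IsOfOrder (r : ℝ) (T : Hinf q →ₗ[ℂ] Hinf q) : Prop :=
  ∀ t : ℝ, ∃ M : ℝ, ∀ ξ : Hinf q, sobNorm (t - r) (T ξ) ≤ M * sobNorm t ξ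

/-- The norm `‖T‖_t` of the extension of `T ∈ op^0` to an operator `H_t → H_t`. -/
def opNorm (t : ℝ) (T : Hinf q →ₗ[ℂ] Hinf q) : ℝ :=
  sInf {M : ℝ | 0 ≤ M ∧ ∀ ξ : Hinf q, sobNorm t (T ξ) ≤ M * sobNorm t ξ}

/-! ### The spectral subspaces and the projections `p_F` -/

variable (q) in
/-- `𝒜_n = {a ∈ 𝒜 | ∂_k(a) = q^{n/2} a}`. -/
def spectralPart (n : ℤ) : Submodule ℂ (Poly q) :=
  LinearMap.ker (actL (k q).toLinearMap - (((q : ℝ) ^ ((n : ℝ) / 2) : ℝ) : ℂ) • LinearMap.id)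

variable (q) in
/-- `L²(A_n, h)`, the closure of `𝒜_n ξ_h` in `H`. -/
def L2 (n : ℤ) : Submodule ℂ (H q) := ((spectralPart q n).map (toH q)).topologicalClosure

variable (q) in
/-- The projection `p_F` onto the closed linear span of the subspaces `L²(A_n, h)`, `n ∈ F`. -/
def projF (F : Set ℤ) : H q →L[ℂ] H q := (⨆ n ∈ F, L2 q n).topologicalClosure.starProjection

/-- The operator `(C^z x C^{-z} - q^{nz} x) C^{1/2}` on `H_∞`. -/
def defect (n : ℤ) (x : Hinf q →ₗ[ℂ] Hinf q) (z : ℂ) : Hinf q →ₗ[ℂ] Hinf q :=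
  (cpow q z ∘ₗ x ∘ₗ cpow q (-z) - ((q : ℝ) : ℂ) ^ ((n : ℂ) * z) • x) ∘ₗ cpow q (1 / 2)

end SUq2

end

noncomputable section

open scoped TensorProduct ComplexConjugate InnerProductSpace

namespace SUq2

variable {q : Set.Ioo (0 : ℝ) 1}

/-! ### The Casimir operator on monomials -/

/-! Operators on `H` are treated as block matrices `P_i T P_j`, where `P_j` (`casProj`) is the
projection onto the eigenspace of `C` with eigenvalue `ev q j`, the square of the `q`-number
`[(j+1)/2]`. On monomials `γ^m γ^{*n} α^k` the Casimir is triangular, lowering the degree in steps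
of two (`casimir_mono`). The diagonal entries `ev q j` are pairwise distinct, so joint eigenvectors
of `C` and `∂_k` span `𝒜` (`span_joint_eq_top`), and the Sobolev norms become weighted `ℓ²` norms of
the components `P_j ξ` (`sobNorm_sq`).

A generator of `𝒜` changes the index `j` by exactly one, so elements of `𝒜` are banded matrices,
while `p_F` commutes with every `P_j`. Eigenvalues whose indices are at bounded distance have
bounded ratio (`rpow_ev_le`), hence a bounded banded operator is bounded in every Sobolev norm
(`sobNorm_le_of_banded`). This is (i).

For (ii), the block `(i, j)` of `x(z)` is that of `x` multiplied by `(ev_i^z ev_j^{-z} - q^{nz})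
ev_j^{1/2}`. By the mean value inequality the first factor is at most a constant times `|z| |log
ev_i - log ev_j - n log q|`, uniformly for bounded `Re z`; this gives the linear growth. For `i = j
- n` the logarithmic term is `O(q^j)` and absorbs `ev_j^{1/2}`, which is of size `q^{-j/2}`
(`exists_log_ev_sub_le`). For the other `i` it is only bounded, and the block of `x` itself has to
be `O(ev_j^{-1/2})`.

That decay is the heart of the matter (`exists_norm_casProj_succ_le`). The Casimir can also be
written through the left action `∂` (`casimir_eq_left`). For `u = α` or `γ`, where `∂_e u = 0`, this
gives `C(ux) = (q ev_j + const) ux + const · ∂_f(u) ∂_e(x)` for `x` in `𝒜_m` with `C x = ev_j x`,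
and `‖∂_e x‖ ≤ ev_j^{1/2} ‖x‖`. Applying `P_{j+1}` and using `ev_{j+1} - q ev_j ≥ (q⁻¹ - q) ev_j -
const`, the block of `u` raising the index is `O(ev_j^{-1/2})` on `L²(A_m, h)`. The property passes
to adjoints, products and sums (`IsHomog`), hence to all of `𝒜_n`, which is spanned by monomials.
The constants depend on `m`, which is where finiteness of `F` enters. -/

theorem F_Kinv (x : Poly q) : F q (Kinv q x) = ((q : ℝ) : ℂ) • Kinv q (F q x) := by
  have h := congrArg (Kinv q) (F_K (Kinv q x))
  rw [K_K', map_smul, Kinv_K] at h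
  rw [h, smul_smul, mul_inv_cancel₀ (q_ne q), one_smul]

theorem E_Kinv (x : Poly q) : E q (Kinv q x) = ((q : ℝ) : ℂ)⁻¹ • Kinv q (E q x) := by
  have h := congrArg (Kinv q) (E_K (Kinv q x))
  rw [K_K', map_smul, Kinv_K] at h
  rw [h, smul_smul, inv_mul_cancel₀ (q_ne q), one_smul]

variable (q) in
/-- The scalar `q - q⁻¹`. -/
def qdiff : ℂ := ((q : ℝ) : ℂ) - ((q : ℝ) : ℂ)⁻¹

theorem qdiff_eq_ofReal : qdiff q = (((q : ℝ) - (q : ℝ)⁻¹ : ℝ) : ℂ) := by simp [qdiff]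

theorem qdiff_real_neg : (q : ℝ) - (q : ℝ)⁻¹ < 0 :=
  sub_neg.2 (q.2.2.trans ((one_lt_inv₀ q.2.1).2 q.2.2))

theorem qdiff_ne : qdiff q ≠ 0 := by
  rw [qdiff_eq_ofReal]; exact_mod_cast qdiff_real_neg.ne

/-- The relation between `e` and `f`, on the level of right actions. -/
theorem E_F_sub (x : Poly q) : E q (F q x) =
    F q (E q x) - (qdiff q)⁻¹ • (K q (K q x) - Kinv q (Kinv q x)) := by
  have hq := q_ne q
  have h0 := sq_ne (q := q)
  have h1 := sq_mul (q := q)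
  have hd : (qdiff q)⁻¹ * ((q : ℝ) : ℂ) - (qdiff q)⁻¹ * ((q : ℝ) : ℂ)⁻¹ = 1 := by
    rw [← mul_sub]; exact inv_mul_cancel₀ qdiff_ne
  have h2 : (sq q)⁻¹ * (sq q)⁻¹ = ((q : ℝ) : ℂ)⁻¹ := by rw [← mul_inv, h1]
  induction x using induction with
  | h1 => simp [E_one, F_one, K_one, Kinv_one]
  | hg x =>
    cases x <;> simp only [F_mk, E_mk, K_mk, Kinv_mk, map_smul, map_neg, map_zero, smul_smul, h1, h2,
      smul_sub, smul_neg, mul_inv_cancel₀ hq, inv_mul_cancel₀ hq, neg_neg, one_smul]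
    · rw [← sub_smul, hd, one_smul, sub_self]
    · rw [← sub_smul, zero_sub, ← neg_smul, neg_sub, hd, one_smul]
    · rw [← sub_smul, zero_sub, ← neg_smul, neg_sub, hd, one_smul]
    · rw [← sub_smul, hd, one_smul, sub_self]
  | hadd x y hx hy => simp only [map_add, hx, hy, smul_add, smul_sub]; abel
  -- Expanded on a product, `E ∘ F` and `F ∘ E` have the same mixed terms, thanks to the commutation
  -- of `E`, `F` with `K`, `Kinv`. The remaining terms telescope to `K² - Kinv²` of the product.
  | hmul x y hx hy =>
    simp only [F_mul, E_mul, K_mul, Kinv_mul, map_add, hx, hy, E_K, F_K, E_Kinv, F_Kinv, mul_sub,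
      sub_mul, smul_mul_assoc, mul_smul_comm, smul_sub]
    abel
  | hsmul t x hx => simp only [map_smul, hx, smul_sub, smul_comm t]

/-- The scalars `-q` and `-q⁻¹` coming from the antipode cancel in `opF * opE`, and the two mixed
products `K Kinv` in the square contribute the `-2`. -/
theorem casimir_apply (x : Poly q) : casimir q x = F q (E q x) + ((qdiff q)⁻¹ ^ 2) •
    (((q : ℝ) : ℂ) • Kinv q (Kinv q x) + ((q : ℝ) : ℂ)⁻¹ • K q (K q x) - (2 : ℂ) • x) := by
  have hq := q_ne q
  have h0 := sq_ne (q := q)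
  have h1 := sq_mul (q := q)
  have h2 : (sq q)⁻¹ * (sq q)⁻¹ = ((q : ℝ) : ℂ)⁻¹ := by rw [← mul_inv, h1]
  have hK : opK q = Kinv q := rfl
  have hK' : opKInv q = K q := rfl
  rw [casimir, LinearMap.add_apply, Module.End.mul_apply, opF_apply, opE_apply, map_smul, smul_smul,
    neg_mul_neg, inv_mul_cancel₀ hq, one_smul, pow_two, Module.End.mul_apply, hK, hK']
  congr 1
  simp only [LinearMap.smul_apply, LinearMap.sub_apply, map_smul, map_sub, Kinv_K, K_K', smul_sub,
    smul_smul, smul_add]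
  rw [show ((q : ℝ) : ℂ) - ((q : ℝ) : ℂ)⁻¹ = qdiff q from rfl]
  rw [← h2, ← h1]
  match_scalars
  all_goals field_simp
  ring

/-- Commuting `E` past `F` exchanges the roles of `K` and `Kinv`. This form suits vectors killed by
`F`, and it is the mirror image of the previous one under the involution. -/
theorem casimir_apply' (x : Poly q) : casimir q x = E q (F q x) + ((qdiff q)⁻¹ ^ 2) •
    (((q : ℝ) : ℂ) • K q (K q x) + ((q : ℝ) : ℂ)⁻¹ • Kinv q (Kinv q x) - (2 : ℂ) • x) := by
  have hd : (qdiff q)⁻¹ = ((qdiff q)⁻¹) ^ 2 * ((q : ℝ) : ℂ) - (qdiff q)⁻¹ ^ 2 * ((q : ℝ) : ℂ)⁻¹ := by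
    have := qdiff_ne (q := q)
    rw [← mul_sub, ← qdiff, pow_two, mul_assoc, inv_mul_cancel₀ this, mul_one]
  rw [casimir_apply, E_F_sub]
  nth_rw 2 [hd]
  module

/-- The involution interchanges `E` with `F` (up to scalars whose product is one) and `K` with
`Kinv`, so it turns one of the two forms of the Casimir into the other. -/
theorem casimir_star (x : Poly q) : casimir q (star x) = star (casimir q x) := by
  have hq := q_ne q
  rw [casimir_apply, casimir_apply']
  have hd : star (qdiff q) = qdiff q := by rw [qdiff_eq_ofReal]; exact Complex.conj_ofReal _
  simp only [star_add, star_smul, star_sub, star_K, star_K', star_E, star_F, map_neg, map_smul,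
    smul_neg, neg_neg, smul_smul, Complex.star_def, Complex.conj_ofReal, map_inv₀, map_pow]
  rw [← Complex.star_def, hd, inv_mul_cancel₀ hq, one_smul, star_ofNat]

theorem Kinv_mono (m n k : ℕ) :
    Kinv q (mono m n k) = ((sq q)⁻¹ ^ m * sq q ^ n * sq q ^ k)⁻¹ • mono m n k := by
  have h0 := sq_ne (q := q)
  have := Kinv_K (mono (q := q) m n k)
  rw [K_mono, map_smul] at this
  nth_rw 2 [← this]
  rw [smul_smul, inv_mul_cancel₀ (by positivity), one_smul]

theorem E_γ_pow (n : ℕ) : E q (γ q ^ n) = 0 := by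
  induction n with
  | zero => simp [E_one]
  | succ n ih => rw [pow_succ, E_mul, ih, E_mk]; simp

theorem conj_cf (m : ℕ) : conj (cf q m) = cf q m := by
  simp [cf, conj_sq]

theorem E_α_pow (k : ℕ) : E q (α q ^ (k + 1)) = cf q (k + 1) • (γ q * α q ^ k) := by
  have h0 := sq_ne (q := q)
  have h4 := sq_pow_ne (q := q) 4 (by norm_num)
  induction k with
  | zero =>
    simp only [zero_add, pow_one, pow_zero, mul_one, E_mk, cf]
    rw [div_self h4, mul_one, mul_inv_cancel₀ h0, one_smul]
  | succ k ih =>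
    rw [pow_succ' _ (k + 1), E_mul, ih, E_mk, Kinv_pow, Kinv_mk, K_mk]
    simp only [smul_pow, mul_smul_comm, smul_mul_assoc]
    rw [← mul_assoc (α q), α_γ, smul_mul_assoc, mul_assoc (γ q) (α q), ← pow_succ', smul_smul,
      smul_smul, ← add_smul]
    congr 1
    simp only [← sq_sq, cf, inv_pow]
    field_simp
    ring

theorem E_γs_pow (n : ℕ) : E q (γs q ^ (n + 1)) =
    (-(((q : ℝ) : ℂ)⁻¹ * cf q (n + 1) * (((q : ℝ) : ℂ) ^ n)⁻¹)) • (γs q ^ n * αs q) := by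
  have hq := q_ne q
  have h := star_F (γ q ^ (n + 1))
  have h2 := αs_pow (q := q) 0 n
  simp only [pow_zero, one_mul, zero_add] at h2
  rw [F_γ_pow, star_smul, star_mul, star_pow, star_pow, star_mk, star_mk, Complex.star_def, conj_cf] at h
  simp only [Gen.conj] at h
  rw [h2] at h
  have h3 := congrArg (fun x => -(((q : ℝ) : ℂ)⁻¹ • x)) h
  simp only [smul_neg, neg_neg, smul_smul, inv_mul_cancel₀ hq, one_smul] at h3
  rw [neg_smul, mul_assoc]
  exact h3.symm

/-- `γ^m γ^{*n} α^{k+1} ◁ e`. -/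
theorem E_mono_succ (m n k : ℕ) : E q (mono m (n + 1) (k + 1)) =
    ((sq q)⁻¹ ^ m * (-(((q : ℝ) : ℂ)⁻¹ * cf q (n + 1) * (((q : ℝ) : ℂ) ^ n)⁻¹)) *
      (sq q)⁻¹ ^ (k + 1)) • (mono m n k - mono (m + 1) (n + 1) k) +
    ((sq q)⁻¹ ^ m * sq q ^ (n + 1) * cf q (k + 1)) • mono (m + 1) (n + 1) k := by
  rw [mono, mul_assoc, E_mul, E_γ_pow, E_mul, E_α_pow, E_γs_pow, zero_mul, zero_add, Kinv_pow, Kinv_mk,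
    K_pow, K_pow, K_mk, K_mk, ← mono_αsα, mul_add]
  congr 1
  · simp only [smul_pow, mul_smul_comm, smul_mul_assoc, smul_smul, mul_assoc, mul_comm, mul_left_comm]
  · simp only [smul_pow, mul_smul_comm, smul_mul_assoc, smul_smul, mono]
    rw [← mul_assoc (γs q ^ _) (γ q), ((show Commute (γs q) (γ q) from γ_γs.symm).pow_left _).eq,
      ← mul_assoc, ← mul_assoc, ← pow_succ]
    congr 1; ring

theorem E_mono_zero (m k : ℕ) : E q (mono m 0 (k + 1)) =
    ((sq q)⁻¹ ^ m * cf q (k + 1)) • mono (m + 1) 0 k := by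
  rw [mono, pow_zero, mul_one, E_mul, E_γ_pow, E_α_pow, zero_mul, zero_add, K_pow, K_mk, mono, pow_zero,
    mul_one]
  simp only [smul_pow, mul_smul_comm, smul_mul_assoc, smul_smul]
  rw [← mul_assoc, ← pow_succ, mul_comm]

theorem F_mono_succ (m n k : ℕ) : F q (mono (m + 1) n k) =
    (cf q (m + 1) * (sq q)⁻¹ ^ n * (sq q)⁻¹ ^ k * ((q : ℝ) : ℂ) ^ n) • mono m n (k + 1) := by
  rw [mono, F_mul, F_mul, F_γs, F_α, F_γ_pow, Kinv_pow, Kinv_pow, Kinv_mk, Kinv_mk, mono]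
  have := α_pow (q := q) 0 n
  simp only [pow_zero, one_mul, zero_add] at this
  simp only [smul_pow, mul_smul_comm, smul_mul_assoc, mul_zero, add_zero, mul_assoc (γ q ^ m)]
  rw [this]
  simp only [mul_smul_comm, smul_mul_assoc, smul_smul, mul_assoc, ← pow_succ']
  congr 1; ring

variable (q) in
/-- The eigenvalues `[(j+1)/2]_q²` of the Casimir operator. -/
def ev (j : ℕ) : ℝ := ((q : ℝ) ^ (j + 1) + ((q : ℝ) ^ (j + 1))⁻¹ - 2) / ((q : ℝ) - (q : ℝ)⁻¹) ^ 2

theorem ev_ofReal (j : ℕ) : ((ev q j : ℝ) : ℂ) =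
    (qdiff q)⁻¹ ^ 2 * (((q : ℝ) : ℂ) ^ (j + 1) + (((q : ℝ) : ℂ) ^ (j + 1))⁻¹ - 2) := by
  rw [ev, qdiff_eq_ofReal]; push_cast; rw [div_eq_inv_mul, inv_pow]

variable (q) in
/-- The subleading coefficient of the Casimir operator on monomials. -/
def lowerCoeff (m n k : ℕ) : ℂ := -(cf q (m + 1) * cf q (n + 1) * (sq q)⁻¹ ^ (m + n + 2 * k + 2))

theorem lowerCoeff_symm (m n k : ℕ) : lowerCoeff q m n k = lowerCoeff q n m k := by
  rw [lowerCoeff, lowerCoeff, mul_comm (cf q _), add_comm m n]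

/-- Without a factor `γ` the monomial is killed by `F`, so only the part of the Casimir in `K` and
`Kinv` contributes. -/
theorem casimir_mono_zero_left (n k : ℕ) :
    casimir q (mono 0 n k) = ((ev q (n + k) : ℝ) : ℂ) • mono 0 n k := by
  have h0 := sq_ne (q := q)
  have hd := qdiff_ne (q := q)
  rw [casimir_apply', F_mono_zero, map_zero, zero_add, K_mono, Kinv_mono, map_smul, map_smul, K_mono,
    Kinv_mono, ev_ofReal, ← sq_sq]
  simp only [smul_smul, ← add_smul, ← sub_smul]
  congr 1
  field_simp
  ring

/-- Here `F` trades a `γ` for an `α` and `E` trades it back. Since no `γ^*` is present, `α^* α`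
never appears and no lower term arises. -/
theorem casimir_mono_zero_right (m k : ℕ) :
    casimir q (mono m 0 k) = ((ev q (m + k) : ℝ) : ℂ) • mono m 0 k := by
  rcases m with _ | m
  · simpa using casimir_mono_zero_left (q := q) 0 k
  have h0 := sq_ne (q := q)
  have h4 := sq_pow_ne (q := q) 4 (by norm_num)
  rw [casimir_apply', F_mono_succ, map_smul, E_mono_zero, K_mono, Kinv_mono, map_smul, map_smul, K_mono,
    Kinv_mono, ev_ofReal]
  simp only [smul_smul, ← add_smul, ← sub_smul]
  congr 1
  simp only [qdiff, cf, ← sq_sq, inv_pow]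
  have h5 : sq q ^ 2 - (sq q ^ 2)⁻¹ ≠ 0 := by rw [sq_sq]; exact qdiff_ne
  have h6 : sq q ^ 2 - (sq q ^ 2)⁻¹ = -(sq q ^ 2)⁻¹ * (1 - sq q ^ 4) := by field_simp; ring
  rw [h6]
  field_simp
  ring

/-- The derivation `E` turns a `γ^*` into an `α^*`, and rewriting `α^* α = 1 - γ^* γ` creates the
term of degree two less. This triangularity is what makes the spectrum of the Casimir on `𝒜`
explicit. -/
theorem casimir_mono (m n k : ℕ) : casimir q (mono (m + 1) (n + 1) k) =
    ((ev q (m + n + k + 2) : ℝ) : ℂ) • mono (m + 1) (n + 1) k + lowerCoeff q m n k • mono m n k := by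
  have h0 := sq_ne (q := q)
  have h4 := sq_pow_ne (q := q) 4 (by norm_num)
  rw [casimir_apply', F_mono_succ, map_smul, E_mono_succ, K_mono, Kinv_mono, map_smul, map_smul, K_mono,
    Kinv_mono, ev_ofReal, lowerCoeff, qdiff, ← sq_sq]
  simp only [cf, inv_pow]
  have h5 : sq q ^ 2 - (sq q ^ 2)⁻¹ ≠ 0 := by rw [sq_sq]; exact qdiff_ne
  have h6 : sq q ^ 2 - (sq q ^ 2)⁻¹ = -(sq q ^ 2)⁻¹ * (1 - sq q ^ 4) := by field_simp; ring
  rw [h6]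
  match_scalars
  · field_simp
    ring
  · field_simp
    ring

theorem conj_lowerCoeff (m n k : ℕ) : conj (lowerCoeff q m n k) = lowerCoeff q m n k := by
  simp [lowerCoeff, conj_cf, conj_sq]

theorem star_ofReal_smul (t : ℝ) (x : Poly q) : star ((t : ℂ) • x) = (t : ℂ) • star x := by
  rw [star_smul, Complex.star_def, Complex.conj_ofReal]

theorem casimir_mono'_zero_left (n k : ℕ) :
    casimir q (mono' 0 n k) = ((ev q (n + k) : ℝ) : ℂ) • mono' 0 n k := by
  rw [mono'_eq, map_smul, casimir_star, casimir_mono_zero_right, star_ofReal_smul, smul_comm]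

theorem casimir_mono'_zero_right (m k : ℕ) :
    casimir q (mono' m 0 k) = ((ev q (m + k) : ℝ) : ℂ) • mono' m 0 k := by
  rw [mono'_eq, map_smul, casimir_star, casimir_mono_zero_left, star_ofReal_smul, smul_comm]

/-- Taking adjoints of `casimir_mono` gives this; the factor `q^{2k}` is the ratio of the normal
ordering scalars of `mono'_eq` for the two monomials. -/
theorem casimir_mono' (m n k : ℕ) : casimir q (mono' (m + 1) (n + 1) k) =
    ((ev q (m + n + k + 2) : ℝ) : ℂ) • mono' (m + 1) (n + 1) k +
      (((q : ℝ) : ℂ) ^ (2 * k) * lowerCoeff q m n k) • mono' m n k := by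
  rw [mono'_eq (m + 1), mono'_eq m n, map_smul, casimir_star, casimir_mono, star_add, star_ofReal_smul,
    star_smul, Complex.star_def, conj_lowerCoeff, lowerCoeff_symm n m, add_comm n m]
  match_scalars <;> ring

/-! ### The Casimir operator in terms of the left action -/

theorem transpose_mk (x : Gen) : transpose (mk q x) = transposeGen x := by
  rw [transpose, lift_mk]

theorem transpose_gp (m n : ℕ) : transpose (γ q ^ m * γs q ^ n) =
    ((-((q : ℝ) : ℂ)) ^ m * (-((q : ℝ) : ℂ)⁻¹) ^ n) • (γ q ^ n * γs q ^ m) := by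
  rw [map_mul, map_pow, map_pow, transpose, lift_mk, lift_mk, transposeGen, transposeGen,
    ← neg_smul, ← neg_smul, smul_pow, smul_pow, smul_mul_smul_comm,
    ((show Commute (γ q) (γs q) from γ_γs).pow_pow n m).eq]

theorem transpose_mono (m n k : ℕ) : transpose (mono (q := q) m n k) =
    ((-((q : ℝ) : ℂ)) ^ m * (-((q : ℝ) : ℂ)⁻¹) ^ n) • mono n m k := by
  rw [mono, map_mul, transpose_gp, map_pow, transpose_mk, transposeGen, smul_mul_assoc]; rfl

theorem transpose_mono' (m n k : ℕ) : transpose (mono' (q := q) m n k) =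
    ((-((q : ℝ) : ℂ)) ^ m * (-((q : ℝ) : ℂ)⁻¹) ^ n) • mono' n m k := by
  rw [mono', map_mul, transpose_gp, map_pow, transpose_mk, transposeGen, smul_mul_assoc]; rfl

/-- Up to a scalar `θ` exchanges the exponents of `γ` and `γ^*`, and the action of the Casimir on
monomials is symmetric in them. As `θ` exchanges left and right actions, this expresses that the
Casimir is central. -/
theorem casimir_transpose (x : Poly q) : casimir q (transpose x) = transpose (casimir q x) := by
  have hq := q_ne q
  -- The leading and the lower term of the Casimir on a monomial are multiplied by the same scalar
  -- under `θ`.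
  have hc : ∀ m n : ℕ, (-((q : ℝ) : ℂ)) ^ (m + 1) * (-((q : ℝ) : ℂ)⁻¹) ^ (n + 1) =
      (-((q : ℝ) : ℂ)) ^ m * (-((q : ℝ) : ℂ)⁻¹) ^ n := by
    intro m n
    rw [pow_succ, pow_succ]
    field_simp
  induction x using mono_induction with
  | h m n k =>
    rw [transpose_mono, map_smul]
    rcases m with _ | m
    · rw [casimir_mono_zero_left, casimir_mono_zero_right, map_smul, transpose_mono, smul_comm]
    rcases n with _ | n
    · rw [casimir_mono_zero_left, casimir_mono_zero_right, map_smul, transpose_mono, smul_comm]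
    rw [casimir_mono, casimir_mono, map_add, map_smul, map_smul, transpose_mono, transpose_mono, hc,
      smul_add, lowerCoeff_symm n m, add_comm n m, smul_comm _ (lowerCoeff q m n k),
      smul_comm _ ((ev q _ : ℝ) : ℂ)]
  | h' m n k =>
    rw [transpose_mono', map_smul]
    rcases m with _ | m
    · rw [casimir_mono'_zero_left, casimir_mono'_zero_right, map_smul, transpose_mono', smul_comm]
    rcases n with _ | n
    · rw [casimir_mono'_zero_left, casimir_mono'_zero_right, map_smul, transpose_mono', smul_comm]
    rw [casimir_mono', casimir_mono', map_add, map_smul, map_smul, transpose_mono', transpose_mono', hc,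
      smul_add, lowerCoeff_symm n m, add_comm n m, smul_comm _ (_ * lowerCoeff q m n k),
      smul_comm _ ((ev q _ : ℝ) : ℂ)]
  | h0 => simp
  | hadd x y hx hy => simp only [map_add, hx, hy]
  | hsmul t x hx => simp only [map_smul, hx]

variable (q) in
/-- `∂_k`. -/
abbrev dK : Poly q →ₗ[ℂ] Poly q := actL (k q).toLinearMap
variable (q) in
/-- `∂_{k⁻¹}`. -/
abbrev dKinv : Poly q →ₗ[ℂ] Poly q := actL (kInv q).toLinearMap
variable (q) in
/-- `∂_e`. -/
abbrev dE : Poly q →ₗ[ℂ] Poly q := actL (e q)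
variable (q) in
/-- `∂_f`. -/
abbrev dF : Poly q →ₗ[ℂ] Poly q := actL (f q)

theorem actL_apply (ω : Poly q →ₗ[ℂ] ℂ) (x : Poly q) :
    actL ω x = TensorProduct.rid ℂ (Poly q) (ω.lTensor (Poly q) (comul x)) := rfl

/-- The automorphism `θ` exchanges the left and the right actions. -/
theorem actL_eq (ω η : Poly q →ₗ[ℂ] ℂ) (h : ∀ x, ω (transpose x) = η x) (x : Poly q) :
    actL ω x = transpose (actR η (transpose x)) := by
  rw [actR_apply, comul_transpose, actL_apply]
  generalize comul x = X
  induction X using TensorProduct.induction_on with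
  | zero => simp
  | add X Y hX hY => simp only [map_add, hX, hY]
  | tmul a b => simp [transpose_transpose, ← h]

theorem k_transpose (x : Poly q) : k q (transpose x) = k q x := by
  have : (k q).comp transpose = k q := by
    apply algHom_ext
    intro x
    cases x <;> simp [transpose_mk, transposeGen, k, character, -Complex.coe_smul]
  exact DFunLike.congr_fun this x

theorem kInv_transpose (x : Poly q) : kInv q (transpose x) = kInv q x := by
  have : (kInv q).comp transpose = kInv q := by
    apply algHom_ext
    intro x
    cases x <;> simp [transpose_mk, transposeGen, kInv, character, -Complex.coe_smul]
  exact DFunLike.congr_fun this x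

theorem e_transpose (x : Poly q) : e q (transpose x) = f q x := by
  have hq := q_ne q
  induction x using induction with
  | h1 => simp [e_one, f_one]
  | hg x => cases x <;> simp [transpose_mk, transposeGen, e, f, triang, hq, -Complex.coe_smul]
  | hadd x y hx hy => simp only [map_add, hx, hy]
  | hmul x y hx hy => rw [map_mul, e_mul, f_mul, hx, hy, k_transpose, kInv_transpose]
  | hsmul t x hx => simp only [map_smul, hx]

theorem f_transpose (x : Poly q) : f q (transpose x) = e q x := by
  rw [← e_transpose, transpose_transpose]

theorem dK_apply (x : Poly q) : dK q x = transpose (K q (transpose x)) :=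
  actL_eq _ _ k_transpose x
theorem dKinv_apply (x : Poly q) : dKinv q x = transpose (Kinv q (transpose x)) :=
  actL_eq _ _ kInv_transpose x
theorem dE_apply (x : Poly q) : dE q x = transpose (F q (transpose x)) :=
  actL_eq _ _ e_transpose x
theorem dF_apply (x : Poly q) : dF q x = transpose (E q (transpose x)) :=
  actL_eq _ _ f_transpose x

theorem dK_mul (x y : Poly q) : dK q (x * y) = dK q x * dK q y := by
  simp only [dK_apply, map_mul, K_mul]
theorem dE_mul (x y : Poly q) : dE q (x * y) = dE q x * dKinv q y + dK q x * dE q y := by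
  simp only [dK_apply, dKinv_apply, dE_apply, map_mul, F_mul, map_add]
theorem dF_mul (x y : Poly q) : dF q (x * y) = dF q x * dKinv q y + dK q x * dF q y := by
  simp only [dK_apply, dKinv_apply, dF_apply, map_mul, E_mul, map_add]

theorem dK_one : dK q 1 = 1 := by simp [dK_apply, K_one]
theorem dE_one : dE q 1 = 0 := by simp [dE_apply, F_one]
theorem dF_one : dF q 1 = 0 := by simp [dF_apply, E_one]

theorem dK_mk (x : Gen) : dK q (mk q x) = match x with
    | .a => sq q • α q | .astar => (sq q)⁻¹ • αs q | .c => sq q • γ q | .cstar => (sq q)⁻¹ • γs q := by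
  have hq := q_ne q
  rw [dK_apply, transpose_mk]
  cases x <;> simp [transposeGen, K_mk, transpose_mk, smul_smul, -Complex.coe_smul] <;>
    congr 1 <;> field_simp

theorem dE_mk (x : Gen) : dE q (mk q x) = match x with
    | .a => 0 | .astar => γ q | .c => 0 | .cstar => -(((q : ℝ) : ℂ)⁻¹ • α q) := by
  have hq := q_ne q
  rw [dE_apply, transpose_mk]
  cases x <;> simp [transposeGen, F_mk, transpose_mk, smul_smul, hq, -Complex.coe_smul]

theorem dF_mk (x : Gen) : dF q (mk q x) = match x with
    | .a => -(((q : ℝ) : ℂ) • γs q) | .astar => 0 | .c => αs q | .cstar => 0 := by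
  have hq := q_ne q
  rw [dF_apply, transpose_mk]
  cases x <;> simp [transposeGen, E_mk, transpose_mk, smul_smul, hq, -Complex.coe_smul]

theorem dKinv_dK (x : Poly q) : dKinv q (dK q x) = x := by
  rw [dKinv_apply, dK_apply, transpose_transpose, Kinv_K, transpose_transpose]
theorem dK_dKinv (x : Poly q) : dK q (dKinv q x) = x := by
  rw [dKinv_apply, dK_apply, transpose_transpose, K_K', transpose_transpose]
theorem dE_dK (x : Poly q) : dE q (dK q x) = ((q : ℝ) : ℂ)⁻¹ • dK q (dE q x) := by
  simp only [dE_apply, dK_apply, transpose_transpose, F_K, map_smul]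
theorem dF_dK (x : Poly q) : dF q (dK q x) = ((q : ℝ) : ℂ) • dK q (dF q x) := by
  simp only [dF_apply, dK_apply, transpose_transpose, E_K, map_smul]

/-- Conjugating the right-action formula by `θ` gives one in the operators `∂`. These are the ones
tied to the grading `𝒜 = ⨁ 𝒜_n`, and they satisfy a Leibniz rule for left multiplication by elements
of known weight. -/
theorem casimir_eq_left (x : Poly q) : casimir q x = dF q (dE q x) + ((qdiff q)⁻¹ ^ 2) •
    (((q : ℝ) : ℂ) • dK q (dK q x) + ((q : ℝ) : ℂ)⁻¹ • dKinv q (dKinv q x) - (2 : ℂ) • x) := by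
  rw [← transpose_transpose (casimir q x), ← casimir_transpose, casimir_apply']
  simp only [dE_apply, dF_apply, dK_apply, dKinv_apply, transpose_transpose, map_add, map_sub, map_smul]

theorem star_dK (x : Poly q) : star (dK q x) = dKinv q (star x) := by
  have h : ∀ x : Poly q, dK q (star (dK q x)) = star x := by
    intro x
    induction x using induction with
    | h1 => simp [dK_one]
    | hg x => rw [dK_mk, star_mk]; cases x <;> simp [dK_mk, star_mk, Gen.conj, conj_sq, smul_smul, sq_ne]
    | hadd x y hx hy => simp only [map_add, star_add, hx, hy]
    | hmul x y hx hy => rw [dK_mul, star_mul, star_mul, dK_mul, hx, hy]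
    | hsmul t x hx => simp only [map_smul, star_smul, hx]
  rw [← h x, dKinv_dK]

theorem star_dKinv (x : Poly q) : star (dKinv q x) = dK q (star x) := by
  have := star_dK (dKinv q x)
  rw [dK_dKinv] at this
  rw [this, dK_dKinv]

theorem star_dE (x : Poly q) : star (dE q x) = -(((q : ℝ) : ℂ)⁻¹ • dF q (star x)) := by
  have hq := q_ne q
  induction x using induction with
  | h1 => simp [dF_one, dE_one]
  | hg x =>
    rw [dE_mk, star_mk]; cases x <;> simp [dF_mk, star_mk, Gen.conj, smul_smul, hq, -Complex.coe_smul]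
  | hadd x y hx hy => simp only [map_add, star_add, hx, hy, smul_add]; abel
  | hmul x y hx hy =>
    rw [dE_mul, star_add, star_mul, star_mul, star_mul, dF_mul, hx, hy, star_dK, star_dKinv]
    simp only [smul_add, smul_mul_assoc, mul_smul_comm, mul_neg, neg_mul]; abel
  | hsmul t x hx => simp only [map_smul, star_smul, hx, smul_neg, smul_comm (star t)]

theorem haar_dF (x : Poly q) : haar q (dF q x) = 0 := by
  rw [dF_apply, haar_transpose, haar_E]

theorem haar_dK (x : Poly q) : haar q (dK q x) = haar q x := by
  rw [dK_apply, haar_transpose, haar_K, haar_transpose]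

/-! ### Weights -/

variable (q) in
/-- `q^{n/2}`. -/
def wt (n : ℤ) : ℝ := (q : ℝ) ^ ((n : ℝ) / 2)

theorem wt_pos (n : ℤ) : 0 < wt q n := Real.rpow_pos_of_pos q.2.1 _

theorem wt_ne (n : ℤ) : ((wt q n : ℝ) : ℂ) ≠ 0 := by exact_mod_cast (wt_pos n).ne'

theorem wt_add (m n : ℤ) : wt q (m + n) = wt q m * wt q n := by
  rw [wt, wt, wt, ← Real.rpow_add q.2.1]; push_cast; ring_nf

theorem wt_zero : wt q 0 = 1 := by simp [wt]

theorem wt_neg (n : ℤ) : wt q (-n) = (wt q n)⁻¹ := by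
  rw [wt, wt, ← Real.rpow_neg q.2.1.le]; push_cast; ring_nf

theorem wt_one : ((wt q 1 : ℝ) : ℂ) = sq q := by
  rw [wt, sq, Real.sqrt_eq_rpow]; norm_num

theorem wt_two : wt q 2 = q := by simp [wt]

theorem wt_injective : Function.Injective (wt q) := by
  intro m n h
  have := (Real.rpow_right_inj q.2.1 q.2.2.ne).1 h
  have h2 : (m : ℝ) = n := by linarith
  exact_mod_cast h2

theorem mem_spectralPart {n : ℤ} {x : Poly q} :
    x ∈ spectralPart q n ↔ dK q x = ((wt q n : ℝ) : ℂ) • x := by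
  rw [spectralPart, LinearMap.mem_ker, LinearMap.sub_apply, sub_eq_zero]; rfl

theorem one_mem_spectralPart : (1 : Poly q) ∈ spectralPart q 0 := by
  rw [mem_spectralPart, dK_one, wt_zero]; simp

theorem mul_mem_spectralPart {m n : ℤ} {x y : Poly q} (hx : x ∈ spectralPart q m)
    (hy : y ∈ spectralPart q n) : x * y ∈ spectralPart q (m + n) := by
  rw [mem_spectralPart] at *
  rw [dK_mul, hx, hy, smul_mul_smul_comm, wt_add]; push_cast; rfl

theorem pow_mem_spectralPart {m : ℤ} {x : Poly q} (hx : x ∈ spectralPart q m) (n : ℕ) :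
    x ^ n ∈ spectralPart q (n * m) := by
  induction n with
  | zero => simpa using one_mem_spectralPart
  | succ n ih =>
    rw [pow_succ, Nat.cast_succ, add_mul, one_mul]; exact mul_mem_spectralPart ih hx

/-- The degree of a generator for the grading `𝒜 = ⨁ 𝒜_n`. -/
def Gen.deg : Gen → ℤ
  | .a => 1 | .astar => -1 | .c => 1 | .cstar => -1

theorem mk_mem_spectralPart (x : Gen) : mk q x ∈ spectralPart q x.deg := by
  rw [mem_spectralPart, dK_mk]
  cases x <;> simp [Gen.deg, wt_neg, wt_one]

theorem mono_mem_spectralPart (m n k : ℕ) : mono m n k ∈ spectralPart q (m - n + k) := by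
  have h := mul_mem_spectralPart (mul_mem_spectralPart
    (pow_mem_spectralPart (mk_mem_spectralPart (q := q) .c) m)
    (pow_mem_spectralPart (mk_mem_spectralPart (q := q) .cstar) n))
    (pow_mem_spectralPart (mk_mem_spectralPart (q := q) .a) k)
  simp only [Gen.deg, mul_one, mul_neg, ← sub_eq_add_neg] at h
  exact h

theorem mono'_mem_spectralPart (m n k : ℕ) : mono' m n k ∈ spectralPart q (m - n - k) := by
  have h := mul_mem_spectralPart (mul_mem_spectralPart
    (pow_mem_spectralPart (mk_mem_spectralPart (q := q) .c) m)
    (pow_mem_spectralPart (mk_mem_spectralPart (q := q) .cstar) n))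
    (pow_mem_spectralPart (mk_mem_spectralPart (q := q) .astar) k)
  simp only [Gen.deg, mul_one, mul_neg, ← sub_eq_add_neg] at h
  exact h

theorem dKinv_of_mem {n : ℤ} {x : Poly q} (hx : x ∈ spectralPart q n) :
    dKinv q x = (((wt q n)⁻¹ : ℝ) : ℂ) • x := by
  have h := congrArg (dKinv q) (mem_spectralPart.1 hx)
  rw [dKinv_dK, map_smul] at h
  nth_rw 2 [h]
  rw [smul_smul, Complex.ofReal_inv, inv_mul_cancel₀ (wt_ne n), one_smul]

theorem dE_mem_spectralPart {n : ℤ} {x : Poly q} (hx : x ∈ spectralPart q n) :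
    dE q x ∈ spectralPart q (n + 2) := by
  have h := congrArg (fun y => ((q : ℝ) : ℂ) • y) (dE_dK x)
  simp only [mem_spectralPart.1 hx, map_smul, smul_smul, mul_inv_cancel₀ (q_ne q), one_smul] at h
  rw [mem_spectralPart, wt_add, wt_two, ← h, mul_comm]; push_cast; rfl

variable (q) in
/-- The contribution of the weight to the Casimir operator. -/
def wtCasimir (n : ℤ) : ℝ := (wt q (2 * (n + 1)) + (wt q (2 * (n + 1)))⁻¹ - 2) / ((q : ℝ) - (q : ℝ)⁻¹) ^ 2

theorem wtCasimir_nonneg (n : ℤ) : 0 ≤ wtCasimir q n := by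
  have h := wt_pos (q := q) (2 * (n + 1))
  refine div_nonneg ?_ (sq_nonneg _)
  have : wt q (2 * (n + 1)) + (wt q (2 * (n + 1)))⁻¹ - 2 = (wt q (2 * (n + 1)) - 1) ^ 2 / wt q (2 * (n + 1)) := by
    field_simp; ring
  rw [this]; positivity

theorem casimir_of_mem {n : ℤ} {x : Poly q} (hx : x ∈ spectralPart q n) :
    casimir q x = dF q (dE q x) + ((wtCasimir q n : ℝ) : ℂ) • x := by
  have h := wt_ne (q := q) n
  have hq := q_ne q
  rw [casimir_eq_left, dKinv_of_mem hx, map_smul, dKinv_of_mem hx, mem_spectralPart.1 hx, map_smul,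
    mem_spectralPart.1 hx]
  simp only [smul_smul, ← add_smul, ← sub_smul]
  have h2 : wt q (2 * (n + 1)) = wt q n * wt q n * q := by
    rw [← wt_two (q := q), ← wt_add, ← wt_add]; congr 1; ring
  rw [wtCasimir, h2, qdiff_eq_ofReal]
  congr 2
  push_cast
  have hd := qdiff_ne (q := q)
  rw [qdiff] at hd
  field_simp

/-- Invariance of `h` under `∂_f`, applied to `x^* ∂_k ∂_e(x)`, is an integration by parts;
invariance under `∂_k` removes the twist. It makes `‖∂_e x‖²` computable from the Casimir. -/
theorem haar_star_dE_mul {n : ℤ} {x : Poly q} (hx : x ∈ spectralPart q n) :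
    haar q (star (dE q x) * dE q x) = haar q (star x * dF q (dE q x)) := by
  have hq := q_ne q
  have h := haar_dF (star x * dK q (dE q x))
  have hw := wt_ne (q := q) n
  rw [dF_mul, dKinv_dK, dF_dK, ← star_dKinv, dKinv_of_mem hx, mul_smul_comm, map_add, map_smul] at h
  have h2 := haar_dK (star x * dF q (dE q x))
  rw [dK_mul, ← star_dKinv, dKinv_of_mem hx] at h2
  rw [h2] at h
  rw [star_dE, neg_mul, map_neg, smul_mul_assoc, map_smul, eq_neg_of_add_eq_zero_left h]
  simp [hq]

/-! ### The spectral decomposition of `𝒜` -/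

theorem qdiff_sq_pos : 0 < ((q : ℝ) - (q : ℝ)⁻¹) ^ 2 := sq_pos_of_neg qdiff_real_neg

theorem ev_eq (j : ℕ) : ev q j = (1 - (q : ℝ) ^ (j + 1)) ^ 2 / (q : ℝ) ^ (j + 1) /
    ((q : ℝ) - (q : ℝ)⁻¹) ^ 2 := by
  have := pow_pos q.2.1 (j + 1)
  rw [ev]; congr 1; field_simp; ring

theorem qpow_lt_one (j : ℕ) : (q : ℝ) ^ (j + 1) < 1 := pow_lt_one₀ q.2.1.le q.2.2 (by omega)

theorem ev_pos (j : ℕ) : 0 < ev q j := by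
  rw [ev_eq]
  have h1 := pow_pos q.2.1 (j + 1)
  have h2 := sub_pos.2 (qpow_lt_one (q := q) j)
  have h3 := qdiff_sq_pos (q := q)
  positivity

theorem ev_strictMono : StrictMono (ev q) := by
  intro i j h
  rw [ev, ev]
  refine div_lt_div_of_pos_right (sub_lt_sub_right ?_ 2) qdiff_sq_pos
  have h1 := pow_pos q.2.1 (j + 1)
  have h2 := pow_pos q.2.1 (i + 1)
  have h3 : (q : ℝ) ^ (j + 1) < (q : ℝ) ^ (i + 1) := pow_lt_pow_right_of_lt_one₀ q.2.1 q.2.2 (by omega)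
  generalize (q : ℝ) ^ (j + 1) = y at *
  have h4 := qpow_lt_one (q := q) i
  generalize (q : ℝ) ^ (i + 1) = x at *
  -- The function `y + y⁻¹` decreases on `(0, 1)`, and `q^{j+1}` decreases with `j`.
  have : y + y⁻¹ - (x + x⁻¹) = (x - y) * (1 - x * y) / (x * y) := by field_simp; ring
  have h5 : 0 < (x - y) * (1 - x * y) / (x * y) :=
    div_pos (mul_pos (by linarith) (by nlinarith)) (by positivity)
  linarith

theorem ev_injective : Function.Injective (ev q) := ev_strictMono.injective

variable (q) in
/-- The span of the monomials whose degree is at most `J` and has the parity of `J`. -/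
def fil (J : ℕ) : Submodule ℂ (Poly q) :=
  Submodule.span ℂ {x | ∃ m n k, (m + n + k ≤ J ∧ (m + n + k) % 2 = J % 2) ∧
    (x = mono m n k ∨ x = mono' m n k)}

theorem mono_mem_fil {m n k J : ℕ} (h : m + n + k ≤ J) (h' : (m + n + k) % 2 = J % 2) :
    mono m n k ∈ fil q J := Submodule.subset_span ⟨m, n, k, ⟨h, h'⟩, .inl rfl⟩

theorem mono'_mem_fil {m n k J : ℕ} (h : m + n + k ≤ J) (h' : (m + n + k) % 2 = J % 2) :
    mono' m n k ∈ fil q J := Submodule.subset_span ⟨m, n, k, ⟨h, h'⟩, .inr rfl⟩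

theorem fil_mono {i J : ℕ} (h : i ≤ J) (h' : i % 2 = J % 2) : fil q i ≤ fil q J := by
  refine Submodule.span_mono ?_
  rintro x ⟨m, n, k, ⟨h1, h2⟩, h3⟩
  exact ⟨m, n, k, ⟨h1.trans h, h2.trans h'⟩, h3⟩

/-- Normal ordering only uses relations whose terms differ in degree by `0` or `2`, so parity is
kept. The parity is needed later to exclude blocks of a generator that preserve the index. -/
theorem gen_mul_fil (g : Gen) {J : ℕ} {x : Poly q} (hx : x ∈ fil q J) : mk q g * x ∈ fil q (J + 1) := by
  induction hx using Submodule.span_induction with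
  | zero => simp
  | add x y _ _ hx hy => rw [mul_add]; exact add_mem hx hy
  | smul t x _ hx => rw [mul_smul_comm]; exact Submodule.smul_mem _ _ hx
  | mem x hx =>
    obtain ⟨m, n, k, ⟨h1, h2⟩, rfl | rfl⟩ := hx
    · cases g
      · rw [mono, ← mul_assoc, α_pow, smul_mul_assoc, mul_assoc, ← pow_succ']
        exact Submodule.smul_mem _ _ (mono_mem_fil (k := k + 1) (by omega) (by omega))
      · rw [mono, ← mul_assoc, αs_pow, smul_mul_assoc, mul_assoc]
        apply Submodule.smul_mem
        cases k with
        | zero =>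
          have : mono' m n 1 ∈ fil q (J + 1) := mono'_mem_fil (by omega) (by omega)
          simpa [mono'] using this
        | succ k =>
          rw [mono_αsα]
          exact sub_mem (mono_mem_fil (by omega) (by omega)) (mono_mem_fil (by omega) (by omega))
      · rw [mono, ← mul_assoc, ← mul_assoc, ← pow_succ']
        exact mono_mem_fil (m := m + 1) (by omega) (by omega)
      · rw [mono, ← mul_assoc, ← mul_assoc, γs_γ_pow, mul_assoc _ (γs q), ← pow_succ']
        exact mono_mem_fil (n := n + 1) (by omega) (by omega)
    · cases g
      · rw [mono', ← mul_assoc, α_pow, smul_mul_assoc, mul_assoc]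
        apply Submodule.smul_mem
        cases k with
        | zero =>
          have : mono m n 1 ∈ fil q (J + 1) := mono_mem_fil (by omega) (by omega)
          simpa [mono] using this
        | succ k =>
          rw [mono_ααs]
          exact sub_mem (mono'_mem_fil (by omega) (by omega))
            (Submodule.smul_mem _ _ (mono'_mem_fil (by omega) (by omega)))
      · rw [mono', ← mul_assoc, αs_pow, smul_mul_assoc, mul_assoc, ← pow_succ']
        exact Submodule.smul_mem _ _ (mono'_mem_fil (k := k + 1) (by omega) (by omega))
      · rw [mono', ← mul_assoc, ← mul_assoc, ← pow_succ']
        exact mono'_mem_fil (m := m + 1) (by omega) (by omega)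
      · rw [mono', ← mul_assoc, ← mul_assoc, γs_γ_pow, mul_assoc _ (γs q), ← pow_succ']
        exact mono'_mem_fil (n := n + 1) (by omega) (by omega)

variable (q) in
/-- The eigenvectors of the Casimir operator in `𝒜_w` with eigenvalue `ev q j` which lie in the
span of the monomials of degree at most `j`. -/
def joint (w : ℤ) (j : ℕ) : Submodule ℂ (Poly q) :=
  spectralPart q w ⊓ LinearMap.ker (casimir q - ((ev q j : ℝ) : ℂ) • LinearMap.id) ⊓ fil q j

theorem mem_joint {w : ℤ} {j : ℕ} {x : Poly q} : x ∈ joint q w j ↔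
    x ∈ spectralPart q w ∧ casimir q x = ((ev q j : ℝ) : ℂ) • x ∧ x ∈ fil q j := by
  rw [joint, Submodule.mem_inf, Submodule.mem_inf, LinearMap.mem_ker, LinearMap.sub_apply, sub_eq_zero,
    and_assoc]
  rfl

variable (q) in
/-- The span of the spaces `joint q w i`, where `i ≤ J` has the parity of `J`. -/
def jointSpan (w : ℤ) (J : ℕ) : Submodule ℂ (Poly q) :=
  Submodule.span ℂ {x | ∃ i, (i ≤ J ∧ i % 2 = J % 2) ∧ x ∈ joint q w i}

theorem joint_le_jointSpan {w : ℤ} {i J : ℕ} (h : i ≤ J) (h' : i % 2 = J % 2) :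
    joint q w i ≤ jointSpan q w J := fun _ hx => Submodule.subset_span ⟨i, ⟨h, h'⟩, hx⟩

theorem jointSpan_mono {w : ℤ} {i J : ℕ} (h : i ≤ J) (h' : i % 2 = J % 2) :
    jointSpan q w i ≤ jointSpan q w J := by
  refine Submodule.span_mono ?_
  rintro x ⟨l, ⟨h1, h2⟩, h3⟩
  exact ⟨l, ⟨h1.trans h, h2.trans h'⟩, h3⟩

theorem jointSpan_le (w : ℤ) (J : ℕ) : jointSpan q w J ≤ spectralPart q w ⊓ fil q J := by
  refine Submodule.span_le.2 ?_
  rintro x ⟨i, ⟨h1, h2⟩, h3⟩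
  rw [mem_joint] at h3
  exact ⟨h3.1, fil_mono h1 h2 h3.2.2⟩

/-- All eigenvalues on `jointSpan q w J` have index at most `J < L` and hence differ from `ev q L`,
so `C - ev q L` can be inverted eigenvector by eigenvector. -/
theorem exists_casimir_sub {w : ℤ} {J L : ℕ} (hL : J < L) {u : Poly q} (hu : u ∈ jointSpan q w J) :
    ∃ v ∈ jointSpan q w J, casimir q v - ((ev q L : ℝ) : ℂ) • v = u := by
  induction hu using Submodule.span_induction with
  | zero => exact ⟨0, zero_mem _, by simp⟩
  | add x y _ _ hx hy =>
    obtain ⟨v, hv, rfl⟩ := hx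
    obtain ⟨v', hv', rfl⟩ := hy
    exact ⟨v + v', add_mem hv hv', by rw [map_add, smul_add]; abel⟩
  | smul t x _ hx =>
    obtain ⟨v, hv, rfl⟩ := hx
    exact ⟨t • v, Submodule.smul_mem _ _ hv, by rw [map_smul, smul_sub, smul_comm]⟩
  | mem x hx =>
    obtain ⟨i, ⟨h1, h2⟩, h3⟩ := hx
    have hne : ((ev q i : ℝ) : ℂ) - ((ev q L : ℝ) : ℂ) ≠ 0 :=
      sub_ne_zero.2 (by exact_mod_cast ev_injective.ne (by omega))
    refine ⟨(((ev q i : ℝ) : ℂ) - ((ev q L : ℝ) : ℂ))⁻¹ • x,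
      Submodule.smul_mem _ _ (joint_le_jointSpan h1 h2 h3), ?_⟩
    rw [map_smul, (mem_joint.1 h3).2.1, smul_smul, smul_smul, ← sub_smul,
      mul_comm _ ((ev q i : ℝ) : ℂ), ← sub_mul, mul_inv_cancel₀ hne, one_smul]

/-- The inductive step in diagonalising a triangular operator: with `v` solving `(C - ev q (J + 2))
v = u`, the difference `x - v` is a genuine eigenvector. -/
theorem mem_jointSpan_of_casimir {w : ℤ} {J : ℕ} {x u : Poly q} (hw : x ∈ spectralPart q w)
    (hf : x ∈ fil q (J + 2)) (hu : u ∈ jointSpan q w J)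
    (h : casimir q x = ((ev q (J + 2) : ℝ) : ℂ) • x + u) : x ∈ jointSpan q w (J + 2) := by
  obtain ⟨v, hv, hvu⟩ := exists_casimir_sub (L := J + 2) (by omega) hu
  have hv' := jointSpan_mono (J := J + 2) (by omega) (by omega) hv
  have h1 : x - v ∈ joint q w (J + 2) := by
    refine mem_joint.2 ⟨sub_mem hw (jointSpan_le _ _ hv').1, ?_, sub_mem hf (jointSpan_le _ _ hv').2⟩
    rw [map_sub, h, ← hvu, smul_sub]; abel
  rw [← sub_add_cancel x v]
  exact add_mem (joint_le_jointSpan le_rfl rfl h1) hv'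

/-- Monomials lacking `γ` or `γ^*` are eigenvectors. Otherwise the error term of `casimir_mono` is a
monomial with both exponents lowered by one, which has the same weight and is covered by induction.
-/
theorem mono_mem_jointSpan (m n k : ℕ) : mono m n k ∈ jointSpan q (m - n + k) (m + n + k) := by
  induction m generalizing n with
  | zero =>
    refine joint_le_jointSpan le_rfl rfl (mem_joint.2 ⟨mono_mem_spectralPart _ _ _, ?_,
      mono_mem_fil le_rfl rfl⟩)
    rw [casimir_mono_zero_left, zero_add]
  | succ m ih =>
    rcases n with _ | n
    · refine joint_le_jointSpan le_rfl rfl (mem_joint.2 ⟨mono_mem_spectralPart _ _ _, ?_,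
        mono_mem_fil le_rfl rfl⟩)
      rw [casimir_mono_zero_right, add_zero]
    · rw [show m + 1 + (n + 1) + k = m + n + k + 2 by ring]
      refine mem_jointSpan_of_casimir (mono_mem_spectralPart _ _ _)
        (mono_mem_fil (by omega) (by omega)) ?_ (casimir_mono m n k)
      have := ih n
      rw [show (((m + 1 : ℕ) : ℤ) - ((n + 1 : ℕ) : ℤ) + k) = m - n + k by push_cast; ring]
      exact Submodule.smul_mem _ _ this

theorem mono'_mem_jointSpan (m n k : ℕ) : mono' m n k ∈ jointSpan q (m - n - k) (m + n + k) := by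
  induction m generalizing n with
  | zero =>
    refine joint_le_jointSpan le_rfl rfl (mem_joint.2 ⟨mono'_mem_spectralPart _ _ _, ?_,
      mono'_mem_fil le_rfl rfl⟩)
    rw [casimir_mono'_zero_left, zero_add]
  | succ m ih =>
    rcases n with _ | n
    · refine joint_le_jointSpan le_rfl rfl (mem_joint.2 ⟨mono'_mem_spectralPart _ _ _, ?_,
        mono'_mem_fil le_rfl rfl⟩)
      rw [casimir_mono'_zero_right, add_zero]
    · rw [show m + 1 + (n + 1) + k = m + n + k + 2 by ring]
      refine mem_jointSpan_of_casimir (mono'_mem_spectralPart _ _ _)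
        (mono'_mem_fil (by omega) (by omega)) ?_ (casimir_mono' m n k)
      have := ih n
      rw [show (((m + 1 : ℕ) : ℤ) - ((n + 1 : ℕ) : ℤ) - k) = m - n - k by push_cast; ring]
      exact Submodule.smul_mem _ _ this

/-- Elements of `fil q J` are sums of eigenvectors with eigenvalues `ev q i`, where `i ≤ J` has the
parity of `J`. -/
theorem fil_le_span (J : ℕ) : fil q J ≤
    Submodule.span ℂ {x | ∃ w i, (i ≤ J ∧ i % 2 = J % 2) ∧ x ∈ joint q w i} := by
  have h : ∀ w i, i ≤ J → i % 2 = J % 2 → jointSpan q w i ≤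
      Submodule.span ℂ {x | ∃ w i, (i ≤ J ∧ i % 2 = J % 2) ∧ x ∈ joint q w i} := by
    intro w i h1 h2
    refine (jointSpan_mono h1 h2).trans (Submodule.span_mono ?_)
    rintro x ⟨i, h, h'⟩
    exact ⟨w, i, h, h'⟩
  refine Submodule.span_le.2 ?_
  rintro x ⟨m, n, k, ⟨h1, h2⟩, rfl | rfl⟩
  · exact h _ _ h1 h2 (mono_mem_jointSpan m n k)
  · exact h _ _ h1 h2 (mono'_mem_jointSpan m n k)

/-- This plays the role of the Peter–Weyl decomposition: identities between bounded operators on `H`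
need only be tested on joint eigenvectors. -/
theorem span_joint_eq_top : Submodule.span ℂ {x | ∃ w j, x ∈ joint q w j} = ⊤ := by
  rw [eq_top_iff, ← monoSpan_eq_top]
  have h : ∀ w J, jointSpan q w J ≤ Submodule.span ℂ {x | ∃ w j, x ∈ joint q w j} := by
    intro w J
    refine Submodule.span_mono ?_
    rintro x ⟨i, -, h⟩
    exact ⟨w, i, h⟩
  refine Submodule.span_le.2 ?_
  rintro x ⟨m, n, k, rfl | rfl⟩
  · exact h _ _ (mono_mem_jointSpan m n k)
  · exact h _ _ (mono'_mem_jointSpan m n k)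

/-! ### Homogeneous elements are sums of homogeneous monomials -/

theorem spectralPart_eq_eigenspace (n : ℤ) :
    spectralPart q n = Module.End.eigenspace (dK q) ((wt q n : ℝ) : ℂ) := by
  ext x; rw [mem_spectralPart, Module.End.mem_eigenspace_iff]

theorem iSupIndep_spectralPart : iSupIndep (spectralPart q) := by
  have h := (Module.End.eigenspaces_iSupIndep (dK q)).comp
    (f := fun n : ℤ => ((wt q n : ℝ) : ℂ)) (fun m n h => wt_injective (Complex.ofReal_injective h))
  simpa only [Function.comp_def, ← spectralPart_eq_eigenspace] using h

variable (q) in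
/-- The span of the monomials in `𝒜_n`. -/
def homSpan (n : ℤ) : Submodule ℂ (Poly q) :=
  Submodule.span ℂ ({x | ∃ m l k : ℕ, (m : ℤ) - l + k = n ∧ x = mono m l k} ∪
    {x | ∃ m l k : ℕ, (m : ℤ) - l - k = n ∧ x = mono' m l k})

theorem homSpan_le (n : ℤ) : homSpan q n ≤ spectralPart q n := by
  refine Submodule.span_le.2 ?_
  rintro x (⟨m, l, k, rfl, rfl⟩ | ⟨m, l, k, rfl, rfl⟩)
  · exact mono_mem_spectralPart m l k
  · exact mono'_mem_spectralPart m l k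

theorem iSup_homSpan : ⨆ n, homSpan q n = ⊤ := by
  rw [eq_top_iff, ← monoSpan_eq_top]
  refine Submodule.span_le.2 ?_
  rintro x ⟨m, n, k, rfl | rfl⟩
  · exact Submodule.mem_iSup_of_mem _ (Submodule.subset_span (.inl ⟨m, n, k, rfl, rfl⟩))
  · exact Submodule.mem_iSup_of_mem _ (Submodule.subset_span (.inr ⟨m, n, k, rfl, rfl⟩))

/-- The spans of homogeneous monomials already exhaust `𝒜`, and they sit inside the spaces `𝒜_n`,
which are independent as eigenspaces of `∂_k`; so no `𝒜_n` can be larger. This reduces statements on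
`𝒜_n` to monomials. -/
theorem spectralPart_eq_homSpan (n : ℤ) : spectralPart q n = homSpan q n := by
  refine le_antisymm (fun x hx => ?_) (homSpan_le n)
  have h1 : homSpan q n ⊔ ⨆ m ≠ n, homSpan q m = ⊤ := by
    rw [eq_top_iff, ← iSup_homSpan]
    refine iSup_le fun m => ?_
    by_cases h : m = n
    · subst h; exact le_sup_left
    · exact le_sup_of_le_right (le_iSup₂_of_le m h le_rfl)
  obtain ⟨y, hy, z, hz, rfl⟩ := Submodule.mem_sup.1 (h1 ▸ Submodule.mem_top : x ∈ _)
  have h2 : z ∈ spectralPart q n := by simpa using sub_mem hx (homSpan_le n hy)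
  have h3 : z ∈ ⨆ m ≠ n, spectralPart q m := (iSup₂_mono fun m _ => homSpan_le m) hz
  have h4 := (Submodule.disjoint_def.1 (iSupIndep_spectralPart n)) z h2 h3
  rwa [h4, add_zero]

/-! ### The spectral projections on `H` -/

theorem denseRange_toH : DenseRange (toH q) := by
  have h : DenseRange ((↑) : PreH q → H q) := UniformSpace.Completion.denseRange_coe
  exact h.comp (toPre q).surjective.denseRange (UniformSpace.Completion.continuous_coe _)

/-- Bounded operators on `H` which agree on the joint eigenvectors in `𝒜` are equal. -/
theorem clm_ext {T S : H q →L[ℂ] H q}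
    (h : ∀ w j, ∀ x ∈ joint q w j, T (toH q x) = S (toH q x)) : T = S := by
  have h1 : T.toLinearMap ∘ₗ toH q = S.toLinearMap ∘ₗ toH q := by
    refine LinearMap.ext_on (s := {x | ∃ w j, x ∈ joint q w j}) span_joint_eq_top ?_
    rintro x ⟨w, j, hx⟩
    exact h w j x hx
  have h2 := denseRange_toH.equalizer T.continuous S.continuous (funext fun x => DFunLike.congr_fun h1 x)
  exact DFunLike.coe_injective h2

theorem toH_mem_eigenspace {w : ℤ} {j : ℕ} {x : Poly q} (hx : x ∈ joint q w j) :
    toH q x ∈ eigenspace q (ev q j) := by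
  rw [eigenspace, Submodule.mem_comap]
  refine subset_closure ⟨x, ?_⟩
  simp only [LinearMap.prod_apply, Function.prod_apply, LinearMap.comp_apply, LinearMap.id_apply,
    LinearMap.smul_apply, (mem_joint.1 hx).2.1, map_smul]

theorem specProj_toH {w : ℤ} {j : ℕ} {x : Poly q} (hx : x ∈ joint q w j) :
    specProj q (ev q j) (toH q x) = toH q x :=
  Submodule.starProjection_eq_self_iff.2 (toH_mem_eigenspace hx)

theorem specProj_toH_of_ne {w : ℤ} {j : ℕ} {x : Poly q} (hx : x ∈ joint q w j) {lam : ℝ}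
    (h : lam ≠ ev q j) : specProj q lam (toH q x) = 0 :=
  (Submodule.starProjection_apply_eq_zero_iff _).2
    ((eigenspace_ortho (Ne.symm h)).le (toH_mem_eigenspace hx))

/-- The closed Casimir operator has no eigenvalues beyond those found in `𝒜`, because an eigenvector
would be orthogonal to a dense subspace. Sums over all positive reals thereby become sums over `ℕ`.
-/
theorem specProj_eq_zero {lam : ℝ} (h : lam ∉ Set.range (ev q)) : specProj q lam = 0 :=
  clm_ext fun _ j _ hx => by
    rw [specProj_toH_of_ne hx (fun h' => h ⟨j, h'.symm⟩)]; rfl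

variable (q) in
/-- The spectral projection of the Casimir operator for the eigenvalue `ev q j`. -/
def casProj (j : ℕ) : H q →L[ℂ] H q := specProj q (ev q j)

variable (q) in
/-- The projection onto `L²(A_n, h)`. -/
def wtProj (n : ℤ) : H q →L[ℂ] H q := projF q {n}

theorem casProj_toH {w : ℤ} {j : ℕ} {x : Poly q} (hx : x ∈ joint q w j) (i : ℕ) :
    casProj q i (toH q x) = if i = j then toH q x else 0 := by
  split_ifs with h
  · subst h; exact specProj_toH hx
  · exact specProj_toH_of_ne hx (ev_injective.ne h)

theorem haar_star_dK_mul (a b : Poly q) :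
    haar q (star (dK q a) * b) = haar q (star a * dK q b) := by
  rw [star_dK, ← haar_dK, dK_mul, dK_dKinv]

/-- The operator `∂_k` is symmetric for the Haar inner product, and its real eigenvalues `q^{m/2}`
and `q^{n/2}` are different. -/
theorem inner_toH_eq_zero {m n : ℤ} (hmn : m ≠ n) {x y : Poly q} (hx : x ∈ spectralPart q m)
    (hy : y ∈ spectralPart q n) : ⟪toH q x, toH q y⟫_ℂ = 0 := by
  have h := haar_star_dK_mul x y
  rw [mem_spectralPart.1 hx, mem_spectralPart.1 hy, star_ofReal_smul, smul_mul_assoc, mul_smul_comm,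
    map_smul, map_smul, ← sub_eq_zero, ← sub_smul] at h
  rw [inner_toH]
  exact (smul_eq_zero.1 h).resolve_left (sub_ne_zero.2 (by exact_mod_cast wt_injective.ne hmn))

theorem toH_mem_L2 {n : ℤ} {x : Poly q} (hx : x ∈ spectralPart q n) : toH q x ∈ L2 q n :=
  subset_closure ⟨x, hx, rfl⟩

theorem projF_toH {w : ℤ} {x : Poly q} (hx : x ∈ spectralPart q w) (S : Set ℤ) [Decidable (w ∈ S)] :
    projF q S (toH q x) = if w ∈ S then toH q x else 0 := by
  split_ifs with h
  · refine Submodule.starProjection_eq_self_iff.2 (Submodule.le_topologicalClosure _ ?_)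
    exact (le_iSup₂_of_le w h le_rfl : L2 q w ≤ _) (toH_mem_L2 hx)
  · refine (Submodule.starProjection_apply_eq_zero_iff _).2 ?_
    have h1 : (⨆ n ∈ S, L2 q n).topologicalClosure ≤ (ℂ ∙ toH q x)ᗮ := by
      refine Submodule.topologicalClosure_minimal _ (iSup₂_le fun n hn => ?_)
        (Submodule.isClosed_orthogonal _)
      refine Submodule.topologicalClosure_minimal _ ?_ (Submodule.isClosed_orthogonal _)
      rintro _ ⟨y, hy, rfl⟩
      rw [Submodule.mem_orthogonal_singleton_iff_inner_right]
      exact inner_toH_eq_zero (by rintro rfl; exact h hn) hx hy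
    rw [Submodule.mem_orthogonal]
    intro y hy
    exact Submodule.mem_orthogonal_singleton_iff_inner_left.1 (h1 hy)

theorem wtProj_toH {w : ℤ} {x : Poly q} (hx : x ∈ spectralPart q w) (m : ℤ) :
    wtProj q m (toH q x) = if w = m then toH q x else 0 := projF_toH hx {m}

theorem casProj_mul_casProj (i j : ℕ) :
    casProj q i * casProj q j = if i = j then casProj q i else 0 := by
  refine clm_ext fun w l x hx => ?_
  rw [mul_apply_eq_comp, casProj_toH hx]
  by_cases h : j = l <;> by_cases h' : i = j
  · subst h h'; simp [casProj_toH hx]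
  · subst h; simp [casProj_toH hx, h']
  · subst h'; simp [casProj_toH hx, h]
  · simp [h, h']

theorem casProj_projF (j : ℕ) (S : Set ℤ) :
    casProj q j * projF q S = projF q S * casProj q j := by
  classical
  refine clm_ext fun w l x hx => ?_
  rw [mul_apply_eq_comp, mul_apply_eq_comp, casProj_toH hx,
    projF_toH (mem_joint.1 hx).1]
  split_ifs <;> simp_all [casProj_toH hx, projF_toH (mem_joint.1 hx).1]

theorem casProj_wtProj (j : ℕ) (m : ℤ) : casProj q j * wtProj q m = wtProj q m * casProj q j :=
  casProj_projF j {m}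

theorem projF_eq_sum (S : Finset ℤ) : projF q (S : Set ℤ) = ∑ m ∈ S, wtProj q m := by
  classical
  refine clm_ext fun w l x hx => ?_
  rw [projF_toH (mem_joint.1 hx).1, sum_apply]
  simp [wtProj_toH (mem_joint.1 hx).1]

theorem star_casProj (j : ℕ) : star (casProj q j) = casProj q j :=
  isSelfAdjoint_starProjection _

theorem star_wtProj (m : ℤ) : star (wtProj q m) = wtProj q m :=
  isSelfAdjoint_starProjection _

theorem norm_casProj_le (j : ℕ) : ‖casProj q j‖ ≤ 1 := Submodule.starProjection_norm_le _

theorem norm_wtProj_le (m : ℤ) : ‖wtProj q m‖ ≤ 1 := Submodule.starProjection_norm_le _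

/-! ### Left multiplication as a `*`-representation compatible with the grading. -/

theorem leftMul_mul (a b : Poly q) : leftMul (a * b) = leftMul a * leftMul b :=
  clm_ext fun w l x hx => by
    rw [mul_apply_eq_comp, leftMul_toH, leftMul_toH, leftMul_toH, mul_assoc]

theorem leftMul_one : leftMul (1 : Poly q) = 1 :=
  clm_ext fun w l x hx => by
    rw [leftMul_toH, one_mul]; rfl

theorem leftMul_add (a b : Poly q) : leftMul (a + b) = leftMul a + leftMul b :=
  clm_ext fun w l x hx => by
    rw [add_apply, leftMul_toH, leftMul_toH, leftMul_toH, add_mul, map_add]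

theorem leftMul_smul (t : ℂ) (a : Poly q) : leftMul (t • a) = t • leftMul a :=
  clm_ext fun w l x hx => by
    rw [smul_apply, leftMul_toH, leftMul_toH, smul_mul_assoc, map_smul]

theorem leftMul_zero : leftMul (0 : Poly q) = 0 := by
  simpa using leftMul_smul (0 : ℂ) (0 : Poly q)

theorem leftMul_star (a : Poly q) : leftMul (star a) = star (leftMul a) := by
  have h : ∀ x y : H q, ⟪leftMul (star a) x, y⟫_ℂ = ⟪x, leftMul a y⟫_ℂ := by
    refine denseRange_toH.induction_on₂ ?_ ?_
    · exact isClosed_eq (by fun_prop) (by fun_prop)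
    · intro x y
      rw [leftMul_toH, leftMul_toH, inner_toH, inner_toH, star_mul, star_star, mul_assoc]
  exact (ContinuousLinearMap.eq_adjoint_iff _ _).2 h

theorem leftMul_wtProj {n : ℤ} {a : Poly q} (ha : a ∈ spectralPart q n) (m : ℤ) :
    leftMul a * wtProj q m = wtProj q (n + m) * leftMul a := by
  refine clm_ext fun w l x hx => ?_
  rw [mul_apply_eq_comp, mul_apply_eq_comp, wtProj_toH (mem_joint.1 hx).1,
    leftMul_toH, wtProj_toH (mul_mem_spectralPart ha (mem_joint.1 hx).1)]
  by_cases h : w = m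
  · rw [if_pos h, if_pos (by rw [h]), leftMul_toH]
  · rw [if_neg h, if_neg (by simpa using h), map_zero]

/-! ### Banded operators -/

/-- `T` maps the `j`-th eigenspace of the Casimir operator into the sum of the eigenspaces with
indices at distance at most `d` from `j`. -/
def IsBanded (d : ℕ) (T : H q →L[ℂ] H q) : Prop :=
  ∀ i j, i ∉ Finset.Icc (j - d) (j + d) → casProj q i * T * casProj q j = 0

theorem mem_Icc_comm {i j d : ℕ} : i ∈ Finset.Icc (j - d) (j + d) ↔ j ∈ Finset.Icc (i - d) (i + d) := by
  simp only [Finset.mem_Icc]; omega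

namespace IsBanded

theorem mono {d d' : ℕ} (hd : d ≤ d') {T : H q →L[ℂ] H q} (hT : IsBanded d T) : IsBanded d' T :=
  fun i j h => hT i j fun h' => h (by simp only [Finset.mem_Icc] at *; omega)

theorem one : IsBanded 0 (1 : H q →L[ℂ] H q) := fun i j h => by
  rw [mul_one, casProj_mul_casProj, if_neg]
  rintro rfl
  simp at h

theorem zero (d : ℕ) : IsBanded d (0 : H q →L[ℂ] H q) := fun i j _ => by simp

theorem add {d : ℕ} {T S : H q →L[ℂ] H q} (hT : IsBanded d T) (hS : IsBanded d S) :
    IsBanded d (T + S) := fun i j h => by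
  rw [mul_add, add_mul, hT i j h, hS i j h, add_zero]

theorem smul {d : ℕ} {T : H q →L[ℂ] H q} (hT : IsBanded d T) (t : ℂ) : IsBanded d (t • T) :=
  fun i j h => by rw [mul_smul_comm, smul_mul_assoc, hT i j h, smul_zero]

theorem star_casProj_mul (i j : ℕ) (T : H q →L[ℂ] H q) :
    star (casProj q i * T * casProj q j) = casProj q j * star T * casProj q i := by
  rw [star_mul, star_mul, star_casProj, star_casProj, mul_assoc]

theorem star {d : ℕ} {T : H q →L[ℂ] H q} (hT : IsBanded d T) : IsBanded d (star T) := fun i j h => by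
  rw [← star_casProj_mul, hT j i (fun h' => h (mem_Icc_comm.1 h')), star_zero]

/-- The expansion of the columns of a banded operator. -/
theorem mul_casProj {d : ℕ} {T : H q →L[ℂ] H q} (hT : IsBanded d T) (j : ℕ) :
    T * casProj q j = ∑ i ∈ Finset.Icc (j - d) (j + d), casProj q i * T * casProj q j := by
  have h : ∀ i, casProj q i * (T * casProj q j) =
      casProj q i * ∑ i ∈ Finset.Icc (j - d) (j + d), casProj q i * T * casProj q j := by
    intro i
    rw [Finset.mul_sum]
    simp only [← mul_assoc, casProj_mul_casProj, ite_mul, zero_mul, Finset.sum_ite_eq]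
    split_ifs with h
    · rfl
    · exact hT i j h
  -- Both sides agree after every `P_i` on the left. Taking adjoints moves `P_i` to the right, where
  -- it fixes the joint eigenvectors of index `i` and `clm_ext` applies.
  have h' := fun i => congrArg Star.star (h i)
  simp only [star_mul (casProj q _), star_casProj] at h'
  apply star_injective
  refine clm_ext fun w l x hx => ?_
  have := DFunLike.congr_fun (h' l) (toH q x)
  simpa only [mul_apply_eq_comp, casProj_toH hx, if_pos] using this

/-- The expansion of the rows of a banded operator. -/
theorem casProj_mul {d : ℕ} {T : H q →L[ℂ] H q} (hT : IsBanded d T) (i : ℕ) :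
    casProj q i * T = ∑ j ∈ Finset.Icc (i - d) (i + d), casProj q i * T * casProj q j := by
  have := congrArg Star.star (hT.star.mul_casProj i)
  simpa only [star_mul, star_star, star_casProj, star_sum, mul_assoc] using this

theorem mul {d d' : ℕ} {T S : H q →L[ℂ] H q} (hT : IsBanded d T) (hS : IsBanded d' S) :
    IsBanded (d + d') (T * S) := fun i j h => by
  rw [← mul_assoc, hT.casProj_mul i, Finset.sum_mul, Finset.sum_mul]
  refine Finset.sum_eq_zero fun l hl => ?_
  rw [mul_assoc _ S, mul_assoc _ (casProj q l), ← mul_assoc (casProj q l), hS l j, mul_zero]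
  intro h'
  exact h (by simp only [Finset.mem_Icc] at *; omega)

theorem mul_projF {d : ℕ} {T : H q →L[ℂ] H q} (hT : IsBanded d T) (S : Set ℤ) :
    IsBanded d (T * projF q S) := fun i j h => by
  rw [mul_assoc, mul_assoc, ← casProj_projF, ← mul_assoc, ← mul_assoc, hT i j h, zero_mul]

end IsBanded

theorem isBanded_projF (S : Set ℤ) : IsBanded 0 (projF q S) := by
  simpa using IsBanded.one.mul_projF (q := q) S

/-! ### Elements of `𝒜` are banded. -/

theorem casProj_toH_of_fil {J i : ℕ} {x : Poly q} (hx : x ∈ fil q J) (h : ¬(i ≤ J ∧ i % 2 = J % 2)) :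
    casProj q i (toH q x) = 0 := by
  have h1 : Submodule.span ℂ {x | ∃ w i, (i ≤ J ∧ i % 2 = J % 2) ∧ x ∈ joint q w i} ≤
      LinearMap.ker ((casProj q i).toLinearMap ∘ₗ toH q) := by
    refine Submodule.span_le.2 ?_
    rintro x ⟨w, l, h1, h2⟩
    change casProj q i (toH q x) = 0
    rw [casProj_toH h2, if_neg (by rintro rfl; exact h h1)]
  exact h1 (fil_le_span J hx)

/-- Joint eigenvectors of index `j` lie in `fil q j`, and a generator maps this into `fil q (j +
1)`. This bounds the index only from above; the lower bound comes from the adjoint. -/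
theorem casProj_leftMul_mk_eq_zero (g : Gen) {i j : ℕ} (h : ¬(i ≤ j + 1 ∧ i % 2 = (j + 1) % 2)) :
    casProj q i * leftMul (mk q g) * casProj q j = 0 := by
  refine clm_ext fun w l x hx => ?_
  rw [mul_apply_eq_comp, mul_apply_eq_comp, casProj_toH hx]
  split_ifs with h'
  · subst h'
    rw [leftMul_toH, casProj_toH_of_fil (gen_mul_fil g (mem_joint.1 hx).2.2) h]; rfl
  · simp

theorem isBanded_leftMul_mk (g : Gen) : IsBanded 1 (leftMul (mk q g)) := by
  intro i j h
  by_cases h1 : i ≤ j + 1 ∧ i % 2 = (j + 1) % 2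
  -- Here `i < j - 1`, so the adjoint generator would have to raise the index from `i` to `j > i +
  -- 1`.
  · rw [← star_star (casProj q i * _ * _), IsBanded.star_casProj_mul, ← leftMul_star, star_mk,
      casProj_leftMul_mk_eq_zero g.conj, star_zero]
    simp only [Finset.mem_Icc] at h
    omega
  · exact casProj_leftMul_mk_eq_zero g h1

theorem exists_isBanded_leftMul (a : Poly q) : ∃ d, IsBanded d (leftMul a) := by
  induction a using induction with
  | h1 => exact ⟨0, leftMul_one (q := q) ▸ IsBanded.one⟩
  | hg x => exact ⟨1, isBanded_leftMul_mk x⟩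
  | hadd x y hx hy =>
    obtain ⟨d, hd⟩ := hx
    obtain ⟨d', hd'⟩ := hy
    exact ⟨max d d', leftMul_add x y ▸ (hd.mono (le_max_left _ _)).add (hd'.mono (le_max_right _ _))⟩
  | hmul x y hx hy =>
    obtain ⟨d, hd⟩ := hx
    obtain ⟨d', hd'⟩ := hy
    exact ⟨d + d', leftMul_mul x y ▸ hd.mul hd'⟩
  | hsmul t x hx =>
    obtain ⟨d, hd⟩ := hx
    exact ⟨d, leftMul_smul t x ▸ hd.smul t⟩

/-! ### Growth of the eigenvalues -/

theorem log_ev (j : ℕ) : Real.log (ev q j) = 2 * Real.log (1 - (q : ℝ) ^ (j + 1)) -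
    (j + 1) * Real.log q - Real.log (((q : ℝ) - (q : ℝ)⁻¹) ^ 2) := by
  have h1 := (pow_pos q.2.1 (j + 1)).ne'
  have h2 := (sub_pos.2 (qpow_lt_one (q := q) j)).ne'
  have h3 := (qdiff_sq_pos (q := q)).ne'
  rw [ev_eq, Real.log_div (div_ne_zero (pow_ne_zero _ h2) h1) h3, Real.log_div (pow_ne_zero _ h2) h1,
    Real.log_pow, Real.log_pow]
  push_cast; ring

/-- With `y = q^{j+1}`, `-log (1 - y) = log (1/(1 - y)) ≤ 1/(1 - y) - 1 = y/(1 - y)`, and `y ≤ q`.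
-/
theorem abs_log_one_sub_le (j : ℕ) :
    |Real.log (1 - (q : ℝ) ^ (j + 1))| ≤ (q : ℝ) ^ (j + 1) / (1 - q) := by
  have h1 := pow_pos q.2.1 (j + 1)
  have h2 := sub_pos.2 (qpow_lt_one (q := q) j)
  have h3 : (0 : ℝ) < 1 - q := sub_pos.2 q.2.2
  have h4 : (q : ℝ) ^ (j + 1) ≤ q := by
    simpa using pow_le_pow_of_le_one q.2.1.le q.2.2.le (show 1 ≤ j + 1 by omega)
  rw [abs_of_nonpos (Real.log_nonpos h2.le (by linarith)), ← Real.log_inv]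
  refine (Real.log_le_sub_one_of_pos (inv_pos.2 h2)).trans ?_
  have h5 : (1 - (q : ℝ) ^ (j + 1))⁻¹ - 1 = (q : ℝ) ^ (j + 1) / (1 - (q : ℝ) ^ (j + 1)) := by
    field_simp; ring
  rw [h5]
  exact div_le_div_of_nonneg_left h1.le h3 (by linarith)

variable (q) in
/-- A bound for the differences of the logarithms of eigenvalues with indices at distance at
most `d`. -/
def logGap (d : ℕ) : ℝ := d * |Real.log q| + 4 / (1 - q)

theorem logGap_nonneg (d : ℕ) : 0 ≤ logGap q d := by
  have h3 : (0 : ℝ) < 1 - q := sub_pos.2 q.2.2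
  rw [logGap]; positivity

theorem abs_log_ev_sub_le {d i j : ℕ} (h : i ∈ Finset.Icc (j - d) (j + d)) :
    |Real.log (ev q i) - Real.log (ev q j)| ≤ logGap q d := by
  have h3 : (0 : ℝ) < 1 - q := sub_pos.2 q.2.2
  have hb : ∀ i : ℕ, |Real.log (1 - (q : ℝ) ^ (i + 1))| ≤ 1 / (1 - q) := fun i =>
    (abs_log_one_sub_le i).trans (div_le_div_of_nonneg_right (qpow_lt_one i).le h3.le)
  have h1 : Real.log (ev q i) - Real.log (ev q j) = ((j : ℝ) - i) * Real.log q +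
      (2 * Real.log (1 - (q : ℝ) ^ (i + 1)) - 2 * Real.log (1 - (q : ℝ) ^ (j + 1))) := by
    rw [log_ev, log_ev]; ring
  have h2 : |(j : ℝ) - i| ≤ d := by
    rw [Finset.mem_Icc] at h
    have h5 : (j : ℝ) ≤ i + d := by exact_mod_cast (by omega : j ≤ i + d)
    have h6 : (i : ℝ) ≤ j + d := by exact_mod_cast h.2
    rw [abs_le]; constructor <;> linarith
  rw [h1, logGap]
  refine (abs_add_le _ _).trans (add_le_add ?_ ?_)
  · rw [abs_mul]; exact mul_le_mul_of_nonneg_right h2 (abs_nonneg _)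
  · refine (abs_sub _ _).trans ?_
    rw [abs_mul, abs_mul, abs_two]
    have := hb i
    have := hb j
    have : (4 : ℝ) / (1 - q) = 2 * (1 / (1 - q)) + 2 * (1 / (1 - q)) := by ring
    linarith

/-- With `y = q^{j+1}` the square of the left side is `y (1 - y)² / (q - q⁻¹)²`. So an error
`O(q^j)` absorbs the factor `C^{1/2}` of the defect. -/
theorem qpow_mul_sqrt_ev_le (j : ℕ) :
    (q : ℝ) ^ (j + 1) * √(ev q j) ≤ √(1 / ((q : ℝ) - (q : ℝ)⁻¹) ^ 2) := by
  have h1 := pow_pos q.2.1 (j + 1)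
  have h2 := qpow_lt_one (q := q) j
  have h3 := qdiff_sq_pos (q := q)
  refine Real.le_sqrt_of_sq_le ?_
  rw [mul_pow, Real.sq_sqrt (ev_pos j).le, ev_eq]
  generalize (q : ℝ) ^ (j + 1) = y at *
  have : y ^ 2 * ((1 - y) ^ 2 / y / ((q : ℝ) - (q : ℝ)⁻¹) ^ 2) =
      y * (1 - y) ^ 2 / ((q : ℝ) - (q : ℝ)⁻¹) ^ 2 := by field_simp
  rw [this]
  refine div_le_div_of_nonneg_right ?_ h3.le
  exact mul_le_one₀ h2.le (by positivity) (pow_le_one₀ (by linarith) (by linarith))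

/-- In `log_ev` the linear part contributes exactly `(j - i) log q = n log q`, so only the terms `2
log (1 - q^{·})` survive, and these are `O(q^j)`. This is the origin of the factor `q^{nz}` in the
defect. -/
theorem exists_log_ev_sub_le (n : ℤ) : ∃ c : ℝ, 0 ≤ c ∧ ∀ i j : ℕ, (i : ℤ) = j - n →
    |Real.log (ev q i) - Real.log (ev q j) - n * Real.log q| * √(ev q j) ≤ c := by
  have h3 : (0 : ℝ) < 1 - q := sub_pos.2 q.2.2
  have h0 := q.2.1
  refine ⟨2 * ((q : ℝ) ^ (-n) + 1) / (1 - q) * √(1 / ((q : ℝ) - (q : ℝ)⁻¹) ^ 2), by positivity,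
    fun i j hij => ?_⟩
  have hij' : (i : ℝ) = j - n := by exact_mod_cast hij
  have h1 : Real.log (ev q i) - Real.log (ev q j) - n * Real.log q =
      2 * Real.log (1 - (q : ℝ) ^ (i + 1)) - 2 * Real.log (1 - (q : ℝ) ^ (j + 1)) := by
    rw [log_ev, log_ev, hij']; ring
  have h2 : (q : ℝ) ^ (i + 1) = (q : ℝ) ^ (-n) * (q : ℝ) ^ (j + 1) := by
    rw [← zpow_natCast, ← zpow_natCast, ← zpow_add₀ h0.ne']
    congr 1; push_cast; omega
  have h4 : |Real.log (ev q i) - Real.log (ev q j) - n * Real.log q| ≤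
      2 * ((q : ℝ) ^ (-n) + 1) / (1 - q) * (q : ℝ) ^ (j + 1) := by
    rw [h1]
    refine (abs_sub _ _).trans ?_
    rw [abs_mul, abs_mul, abs_two]
    have h5 := abs_log_one_sub_le (q := q) i
    have h6 := abs_log_one_sub_le (q := q) j
    rw [h2] at h5
    have : 2 * ((q : ℝ) ^ (-n) + 1) / (1 - q) * (q : ℝ) ^ (j + 1) =
      2 * ((q : ℝ) ^ (-n) * (q : ℝ) ^ (j + 1) / (1 - q)) + 2 * ((q : ℝ) ^ (j + 1) / (1 - q)) := by ring
    rw [this, h2]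
    linarith
  refine (mul_le_mul_of_nonneg_right h4 (Real.sqrt_nonneg _)).trans ?_
  rw [mul_assoc]
  exact mul_le_mul_of_nonneg_left (qpow_mul_sqrt_ev_le j) (by positivity)

theorem rpow_ev_le {d i j : ℕ} (h : i ∈ Finset.Icc (j - d) (j + d)) (t : ℝ) :
    ev q i ^ t ≤ Real.exp (|t| * logGap q d) * ev q j ^ t := by
  rw [Real.rpow_def_of_pos (ev_pos i), Real.rpow_def_of_pos (ev_pos j), ← Real.exp_add,
    Real.exp_le_exp]
  have h1 := abs_log_ev_sub_le (q := q) h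
  have h2 : (Real.log (ev q i) - Real.log (ev q j)) * t ≤ |t| * logGap q d := by
    refine (le_abs_self _).trans ?_
    rw [abs_mul, mul_comm]
    exact mul_le_mul_of_nonneg_left h1 (abs_nonneg _)
  linarith

theorem sqrt_ev_pos (j : ℕ) : 0 < √(ev q j) := Real.sqrt_pos.2 (ev_pos j)

theorem inv_sqrt_ev_le {d i j : ℕ} (h : i ∈ Finset.Icc (j - d) (j + d)) :
    1 / √(ev q i) ≤ Real.exp (logGap q d) * (1 / √(ev q j)) := by
  have h1 := rpow_ev_le (q := q) h (-1 / 2)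
  have h2 : ∀ j, 1 / √(ev q j) = ev q j ^ (-1 / 2 : ℝ) := fun j => by
    rw [Real.sqrt_eq_rpow, neg_div, Real.rpow_neg (ev_pos j).le, one_div]
  rw [h2, h2]
  refine h1.trans (mul_le_mul_of_nonneg_right (Real.exp_le_exp.2 ?_) (Real.rpow_nonneg (ev_pos j).le _))
  have := logGap_nonneg (q := q) d
  have h3 : |(-1 / 2 : ℝ)| = 1 / 2 := by norm_num [abs_of_neg]
  rw [h3]; linarith

/-! ### Off-diagonal decay of the components of elements of `𝒜_n` -/

theorem casProj_toH_casimir (i : ℕ) (x : Poly q) :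
    casProj q i (toH q (casimir q x)) = ((ev q i : ℝ) : ℂ) • casProj q i (toH q x) := by
  have h : (casProj q i).toLinearMap ∘ₗ toH q ∘ₗ casimir q =
      ((ev q i : ℝ) : ℂ) • ((casProj q i).toLinearMap ∘ₗ toH q) := by
    refine LinearMap.ext_on (s := {x | ∃ w j, x ∈ joint q w j}) span_joint_eq_top ?_
    rintro x ⟨w, j, hx⟩
    change casProj q i (toH q (casimir q x)) = ((ev q i : ℝ) : ℂ) • casProj q i (toH q x)
    rw [(mem_joint.1 hx).2.1, map_smul, map_smul, casProj_toH hx]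
    split_ifs with h
    · rw [h]
    · rw [smul_zero, smul_zero]
  exact DFunLike.congr_fun h x

/-- Both projections act diagonally on joint eigenvectors, so they preserve `𝒜`. Norm bounds for a
block can then be checked on elements of `joint q m j`, where `∂_e` and the Casimir act
algebraically. -/
theorem exists_mem_joint (m : ℤ) (j : ℕ) (a : Poly q) :
    ∃ x ∈ joint q m j, wtProj q m (casProj q j (toH q a)) = toH q x := by
  have h : (⊤ : Submodule ℂ (Poly q)) ≤ ((joint q m j).map (toH q)).comap
      (((wtProj q m).comp (casProj q j)).toLinearMap ∘ₗ toH q) := by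
    rw [← span_joint_eq_top]
    refine Submodule.span_le.2 ?_
    rintro x ⟨w, l, hx⟩
    change wtProj q m (casProj q j (toH q x)) ∈ (joint q m j).map (toH q)
    rw [casProj_toH hx]
    by_cases h1 : j = l
    · subst h1
      rw [if_pos rfl, wtProj_toH (mem_joint.1 hx).1]
      by_cases h2 : w = m
      · subst h2; rw [if_pos rfl]; exact ⟨x, hx, rfl⟩
      · rw [if_neg h2]; exact zero_mem _
    · rw [if_neg h1, map_zero]; exact zero_mem _
  obtain ⟨x, hx, hx'⟩ := h (Submodule.mem_top : a ∈ _)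
  exact ⟨x, hx, hx'.symm⟩

/-- By `casimir_of_mem`, `∂_f ∂_e x = (ev q j - wtCasimir q m) x`. Pairing with `x` gives `‖∂_e
x‖²`, and the subtracted weight term is nonnegative. -/
theorem norm_toH_dE_le {m : ℤ} {j : ℕ} {x : Poly q} (hx : x ∈ joint q m j) :
    ‖toH q (dE q x)‖ ≤ √(ev q j) * ‖toH q x‖ := by
  have hn : ∀ y : Poly q, ‖toH q y‖ ^ 2 = (haar q (star y * y)).re := fun y => by
    rw [← inner_toH, ← inner_self_eq_norm_sq (𝕜 := ℂ)]; rfl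
  obtain ⟨h1, h2, -⟩ := mem_joint.1 hx
  have h3 := casimir_of_mem h1
  rw [h2, ← sub_eq_iff_eq_add, ← sub_smul] at h3
  have h4 : ‖toH q (dE q x)‖ ^ 2 = (ev q j - wtCasimir q m) * ‖toH q x‖ ^ 2 := by
    rw [hn, haar_star_dE_mul h1, ← h3, mul_smul_comm, map_smul, hn, smul_eq_mul, ← Complex.ofReal_sub,
      Complex.re_ofReal_mul]
  rw [← sq_le_sq₀ (norm_nonneg _) (by positivity), h4, mul_pow, Real.sq_sqrt (ev_pos j).le]
  have := wtCasimir_nonneg (q := q) m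
  exact mul_le_mul_of_nonneg_right (by linarith) (sq_nonneg _)

/-- Since `∂_e u = 0`, the Leibniz rule leaves `∂_e(ux) = q^{1/2} u ∂_e(x)`, and `∂_f` of this has
two terms. The factor `q = q^{1/2} q^{1/2}` in front of `ev q j` is what matters; the remainder
involves only `∂_e x`, of size `ev_j^{1/2}`. -/
theorem casimir_mul_of_highest {u u' x : Poly q} (hu : u ∈ spectralPart q 1) (hE : dE q u = 0)
    (hF : dF q u = u') {m : ℤ} {j : ℕ} (hx : x ∈ joint q m j) :
    casimir q (u * x) = (((q : ℝ) * (ev q j - wtCasimir q m) + wtCasimir q (1 + m) : ℝ) : ℂ) • (u * x) +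
      (sq q * (((wt q (m + 2))⁻¹ : ℝ) : ℂ)) • (u' * dE q x) := by
  obtain ⟨h1, h2, -⟩ := mem_joint.1 hx
  have h3 := casimir_of_mem h1
  rw [h2, ← sub_eq_iff_eq_add, ← sub_smul, ← Complex.ofReal_sub] at h3
  have hk : dK q u = sq q • u := by rw [mem_spectralPart.1 hu, wt_one]
  rw [casimir_of_mem (mul_mem_spectralPart hu h1), dE_mul, hE, zero_mul, zero_add, hk, smul_mul_assoc,
    map_smul, dF_mul, hF, hk, dKinv_of_mem (dE_mem_spectralPart h1), ← h3]
  simp only [smul_add, smul_mul_assoc, mul_smul_comm, smul_smul]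
  push_cast
  rw [← sq_mul]
  module

/-- Eigenvalues grow asymptotically by the factor `q⁻¹ > q` per step, so `ev q (j + 1)` stays away
from the approximate eigenvalue `q ev q j` of `C` on `ux`, by a multiple of `ev q j`. -/
theorem ev_succ_sub_ge (j : ℕ) : ((q : ℝ)⁻¹ - q) * ev q j ≤
    ev q (j + 1) - q * ev q j + 2 / ((q : ℝ) - (q : ℝ)⁻¹) ^ 2 := by
  have h0 := q.2.1
  have h1 := pow_pos q.2.1 (j + 1)
  have h2 := qpow_lt_one (q := q) j
  have h3 := qdiff_sq_pos (q := q)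
  have h5 := q.2.2
  rw [ev, ev, pow_succ _ (j + 1)]
  generalize (q : ℝ) ^ (j + 1) = y at *
  generalize ((q : ℝ) - (q : ℝ)⁻¹) ^ 2 = D at *
  rw [← sub_nonneg]
  generalize (q : ℝ) = p at *
  have : (y * p + (y * p)⁻¹ - 2) / D - p * ((y + y⁻¹ - 2) / D) + 2 / D - (p⁻¹ - p) * ((y + y⁻¹ - 2) / D) =
      (2 * p⁻¹ - (p⁻¹ - p) * y) / D := by
    field_simp
    ring
  rw [this]
  refine div_nonneg ?_ h3.le
  have h6 : 1 < p⁻¹ := (one_lt_inv₀ h0).2 h5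
  nlinarith

/-- Applying `P_{j+1}` to the formula for `C(ux)` gives `(ev_{j+1} - q ev_j + const) P_{j+1}(ux) =
const · P_{j+1}(u' ∂_e x)`. The right side is `O(ev_j^{1/2})` and the scalar on the left is of order
`ev_j`. -/
theorem exists_norm_casProj_succ_le {u u' : Poly q} (hu : u ∈ spectralPart q 1) (hE : dE q u = 0)
    (hF : dF q u = u') (m : ℤ) : ∃ c : ℝ, 0 ≤ c ∧ ∀ (j : ℕ), ∀ x ∈ joint q m j,
      ‖casProj q (j + 1) (toH q (u * x))‖ ≤ c / √(ev q j) * ‖toH q x‖ := by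
  have hδ : 0 < (q : ℝ)⁻¹ - q := by have := qdiff_real_neg (q := q); linarith
  have h3 := qdiff_sq_pos (q := q)
  -- `A` collects the lower order constants: the one of `ev_succ_sub_ge` and the weight
  -- contributions.
  set A : ℝ := 2 / ((q : ℝ) - (q : ℝ)⁻¹) ^ 2 + |wtCasimir q (1 + m) - q * wtCasimir q m| with hA
  set t : ℂ := sq q * (((wt q (m + 2))⁻¹ : ℝ) : ℂ) with ht
  have hs0 := sqrt_ev_pos (q := q) 0
  have hA0 : 0 ≤ A := by positivity
  refine ⟨(A * ‖leftMul u‖ / √(ev q 0) + ‖t‖ * ‖leftMul u'‖) / ((q : ℝ)⁻¹ - q), by positivity,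
    fun j x hx => ?_⟩
  have hsj := sqrt_ev_pos (q := q) j
  have hC := (casProj_toH_casimir (j + 1) (u * x)).symm
  rw [casimir_mul_of_highest hu hE hF hx, ← ht, map_add, map_add, map_smul, map_smul, map_smul, map_smul,
    ← sub_eq_iff_eq_add', ← sub_smul, ← Complex.ofReal_sub] at hC
  have hY : ‖casProj q (j + 1) (toH q (u * x))‖ ≤ ‖leftMul u‖ * ‖toH q x‖ := by
    rw [← leftMul_toH]
    refine ((casProj q (j + 1)).le_of_opNorm_le (norm_casProj_le _) _).trans ?_
    rw [one_mul]; exact (leftMul u).le_opNorm _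
  have hZ : ‖casProj q (j + 1) (toH q (u' * dE q x))‖ ≤ ‖leftMul u'‖ * (√(ev q j) * ‖toH q x‖) := by
    rw [← leftMul_toH]
    refine ((casProj q (j + 1)).le_of_opNorm_le (norm_casProj_le _) _).trans ?_
    rw [one_mul]
    exact ((leftMul u').le_opNorm _).trans
      (mul_le_mul_of_nonneg_left (norm_toH_dE_le hx) (norm_nonneg _))
  have hC' := congrArg norm hC
  rw [norm_smul, norm_smul, Complex.norm_real, Real.norm_eq_abs] at hC'
  set Y := ‖casProj q (j + 1) (toH q (u * x))‖
  set X := ‖toH q x‖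
  have hX : 0 ≤ X := norm_nonneg _
  have hY0 : 0 ≤ Y := norm_nonneg _
  have h4 : ((q : ℝ)⁻¹ - q) * ev q j ≤ |ev q (j + 1) - (q * (ev q j - wtCasimir q m) + wtCasimir q (1 + m))| + A := by
    have h5 := ev_succ_sub_ge (q := q) j
    have h6 := le_abs_self (ev q (j + 1) - (q * (ev q j - wtCasimir q m) + wtCasimir q (1 + m)))
    have h7 := le_abs_self (wtCasimir q (1 + m) - q * wtCasimir q m)
    rw [hA]; linarith
  have h8 : ((q : ℝ)⁻¹ - q) * ev q j * Y ≤ ‖t‖ * (‖leftMul u'‖ * (√(ev q j) * X)) + A * (‖leftMul u‖ * X) := by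
    refine (mul_le_mul_of_nonneg_right h4 hY0).trans ?_
    rw [add_mul, hC']
    exact add_le_add (mul_le_mul_of_nonneg_left hZ (norm_nonneg _)) (mul_le_mul_of_nonneg_left hY hA0)
  -- The smallest eigenvalue is positive, so the constant term is also at most a multiple of `√(ev q
  -- j)`, and one factor `√(ev q j)` can be cancelled.
  have h9 : √(ev q 0) ≤ √(ev q j) := Real.sqrt_le_sqrt (ev_strictMono.monotone (Nat.zero_le j))
  have h10 : A * (‖leftMul u‖ * X) ≤ A * ‖leftMul u‖ / √(ev q 0) * X * √(ev q j) := by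
    have : A * (‖leftMul u‖ * X) = A * ‖leftMul u‖ / √(ev q 0) * X * √(ev q 0) := by field_simp
    rw [this]
    exact mul_le_mul_of_nonneg_left h9 (by positivity)
  have h11 : ((q : ℝ)⁻¹ - q) * ev q j * Y = √(ev q j) * (((q : ℝ)⁻¹ - q) * √(ev q j) * Y) := by
    nth_rw 1 [← Real.mul_self_sqrt (ev_pos j).le]; ring
  have h12 : ((q : ℝ)⁻¹ - q) * √(ev q j) * Y ≤ (A * ‖leftMul u‖ / √(ev q 0) + ‖t‖ * ‖leftMul u'‖) * X := by
    refine le_of_mul_le_mul_left ?_ hsj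
    rw [← h11]
    refine h8.trans ((add_le_add_right h10 _).trans (le_of_eq ?_))
    ring
  rw [div_div, div_mul_eq_mul_div, le_div_iff₀ (by positivity)]
  linarith

/-- An operator `T` of degree `n` with respect to the grading `H = ⨁ L²(A_m, h)`, banded with
respect to the spectral decomposition of the Casimir operator, such that the components of the
restrictions of `T` to the spaces `L²(A_m, h)` decay, apart from those which lower the index by `n`. -/
structure IsHomog (n : ℤ) (T : H q →L[ℂ] H q) : Prop where
  band : ∃ d, IsBanded d T
  weight : ∀ m, T * wtProj q m = wtProj q (n + m) * T
  small : ∀ m, ∃ c : ℝ, 0 ≤ c ∧ ∀ i j : ℕ, (i : ℤ) ≠ j - n →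
    ‖casProj q i * T * wtProj q m * casProj q j‖ ≤ c * (1 / √(ev q j))

theorem isHomog_of_highest {g : Gen} (hg : g.deg = 1) (hE : dE q (mk q g) = 0) :
    IsHomog 1 (leftMul (mk q g)) where
  band := ⟨1, isBanded_leftMul_mk g⟩
  weight := leftMul_wtProj (hg ▸ mk_mem_spectralPart g)
  small m := by
    obtain ⟨c, hc, h⟩ := exists_norm_casProj_succ_le (hg ▸ mk_mem_spectralPart (q := q) g) hE rfl m
    refine ⟨c, hc, fun i j hij => ?_⟩
    have hr : 0 ≤ c * (1 / √(ev q j)) := by positivity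
    by_cases hi : i = j + 1
    · subst hi
      refine ContinuousLinearMap.opNorm_le_bound _ hr fun ξ => ?_
      refine denseRange_toH.induction_on (p := fun ξ => ‖(casProj q (j + 1) * leftMul (mk q g) *
        wtProj q m * casProj q j) ξ‖ ≤ c * (1 / √(ev q j)) * ‖ξ‖) ξ
        (isClosed_le (by fun_prop) (by fun_prop)) fun a => ?_
      obtain ⟨x, hx, hax⟩ := exists_mem_joint m j a
      have h1 : ‖toH q x‖ ≤ ‖toH q a‖ := by
        rw [← hax]
        refine ((wtProj q m).le_of_opNorm_le (norm_wtProj_le _) _).trans ?_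
        rw [one_mul]
        refine ((casProj q j).le_of_opNorm_le (norm_casProj_le _) _).trans ?_
        rw [one_mul]
      rw [mul_apply_eq_comp, mul_apply_eq_comp, mul_apply_eq_comp, hax, leftMul_toH]
      refine (h j x hx).trans ?_
      rw [mul_one_div]
      exact mul_le_mul_of_nonneg_left h1 (by positivity)
    · rw [mul_assoc, ← casProj_wtProj, ← mul_assoc]
      have h0 : casProj q i * leftMul (mk q g) * casProj q j = 0 := by
        -- Within the band only `i = j` is left, and that block vanishes by parity.
        by_cases h1 : i ∈ Finset.Icc (j - 1) (j + 1)
        · refine casProj_leftMul_mk_eq_zero g ?_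
          rw [Finset.mem_Icc] at h1
          omega
        · exact isBanded_leftMul_mk g i j h1
      rw [h0, zero_mul, norm_zero]
      exact hr

/-! ### Stability of the decay condition under algebraic operations. -/

theorem norm_mul_casProj_le (T : H q →L[ℂ] H q) (j : ℕ) : ‖T * casProj q j‖ ≤ ‖T‖ :=
  (norm_mul_le _ _).trans (mul_le_of_le_one_right (norm_nonneg _) (norm_casProj_le j))

theorem norm_casProj_mul_le (T : H q →L[ℂ] H q) (j : ℕ) : ‖casProj q j * T‖ ≤ ‖T‖ :=
  (norm_mul_le _ _).trans (mul_le_of_le_one_left (norm_nonneg _) (norm_casProj_le j))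

namespace IsHomog

variable {n n' : ℤ} {T S : H q →L[ℂ] H q}

theorem one : IsHomog 0 (1 : H q →L[ℂ] H q) where
  band := ⟨0, .one⟩
  weight m := by rw [one_mul, mul_one, zero_add]
  small m := ⟨0, le_rfl, fun i j hij => by
    rw [mul_one, mul_assoc, ← casProj_wtProj, ← mul_assoc, casProj_mul_casProj,
      if_neg (by omega), zero_mul, norm_zero, zero_mul]⟩

theorem zero : IsHomog n (0 : H q →L[ℂ] H q) where
  band := ⟨0, .zero 0⟩
  weight m := by rw [zero_mul, mul_zero]
  small m := ⟨0, le_rfl, fun i j hij => by simp⟩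

theorem add (hT : IsHomog n T) (hS : IsHomog n S) : IsHomog n (T + S) where
  band := by
    obtain ⟨d, hd⟩ := hT.band
    obtain ⟨d', hd'⟩ := hS.band
    exact ⟨max d d', (hd.mono (le_max_left _ _)).add (hd'.mono (le_max_right _ _))⟩
  weight m := by rw [add_mul, mul_add, hT.weight, hS.weight]
  small m := by
    obtain ⟨c, hc, h⟩ := hT.small m
    obtain ⟨c', hc', h'⟩ := hS.small m
    refine ⟨c + c', add_nonneg hc hc', fun i j hij => ?_⟩
    rw [mul_add, add_mul, add_mul, add_mul]
    exact norm_add_le_of_le (h i j hij) (h' i j hij)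

theorem smul (hT : IsHomog n T) (t : ℂ) : IsHomog n (t • T) where
  band := by
    obtain ⟨d, hd⟩ := hT.band
    exact ⟨d, hd.smul t⟩
  weight m := by rw [smul_mul_assoc, mul_smul_comm, hT.weight]
  small m := by
    obtain ⟨c, hc, h⟩ := hT.small m
    refine ⟨‖t‖ * c, mul_nonneg (norm_nonneg t) hc, fun i j hij => ?_⟩
    rw [mul_smul_comm, smul_mul_assoc, smul_mul_assoc, norm_smul, mul_assoc ‖t‖]
    exact mul_le_mul_of_nonneg_left (h i j hij) (norm_nonneg _)

theorem star_weight (hT : IsHomog n T) (m : ℤ) : star T * wtProj q m = wtProj q (-n + m) * star T := by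
  have := congrArg Star.star (hT.weight (-n + m))
  rw [star_mul, star_mul, star_wtProj, star_wtProj, add_neg_cancel_left] at this
  exact this.symm

/-- Taking adjoints swaps `i` and `j` and moves the weight `m` to `-n + m`. The bound then comes in
terms of `ev q i`, which inside the band is comparable with `ev q j`. -/
theorem star (hT : IsHomog n T) : IsHomog (-n) (star T) where
  band := by
    obtain ⟨d, hd⟩ := hT.band
    exact ⟨d, hd.star⟩
  weight := hT.star_weight
  small m := by
    obtain ⟨d, hd⟩ := hT.band
    obtain ⟨c, hc, h⟩ := hT.small (-n + m)
    refine ⟨c * Real.exp (logGap q d), by positivity, fun i j hij => ?_⟩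
    have h0 : casProj q i * Star.star T * wtProj q m * casProj q j =
        Star.star (casProj q j * T * wtProj q (-n + m) * casProj q i) := by
      rw [star_mul, star_mul, star_mul, star_casProj, star_casProj, star_wtProj, mul_assoc _ (Star.star T),
        hT.star_weight]
      noncomm_ring
    by_cases hb : i ∈ Finset.Icc (j - d) (j + d)
    · rw [h0, ContinuousLinearMap.star_eq_adjoint, LinearIsometryEquiv.norm_map, mul_assoc c]
      exact (h j i (by omega)).trans (mul_le_mul_of_nonneg_left (inv_sqrt_ev_le hb) hc)
    · rw [mul_assoc, ← casProj_wtProj, ← mul_assoc, hd.star i j hb, zero_mul, norm_zero]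
      positivity

/-- A path `j → l → i` whose total shift is not `-(n + n')` has an exceptional shift in at least one
factor, which supplies the decay while the other factor is merely bounded. The band of `S` leaves at
most `2d + 1` intermediate indices `l`. -/
theorem mul (hT : IsHomog n T) (hS : IsHomog n' S) : IsHomog (n + n') (T * S) where
  band := by
    obtain ⟨d, hd⟩ := hT.band
    obtain ⟨d', hd'⟩ := hS.band
    exact ⟨d + d', hd.mul hd'⟩
  weight m := by rw [mul_assoc, hS.weight, ← mul_assoc, hT.weight, mul_assoc, add_assoc]
  small m := by
    obtain ⟨d, hd⟩ := hS.band
    obtain ⟨c, hc, h⟩ := hT.small (n' + m)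
    obtain ⟨c', hc', h'⟩ := hS.small m
    refine ⟨(2 * d + 1) * (‖T‖ * c' + c * Real.exp (logGap q d) * ‖S‖), by positivity,
      fun i j hij => ?_⟩
    have h0 : casProj q i * (T * S) * wtProj q m * casProj q j =
        ∑ l ∈ Finset.Icc (j - d) (j + d),
          casProj q i * T * (casProj q l * S * wtProj q m * casProj q j) := by
      rw [mul_assoc, mul_assoc, mul_assoc T, ← casProj_wtProj, ← mul_assoc S, hd.mul_casProj,
        Finset.sum_mul, Finset.mul_sum, Finset.mul_sum]
      refine Finset.sum_congr rfl fun l _ => ?_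
      simp only [mul_assoc, casProj_wtProj]
    have hcard : ((Finset.Icc (j - d) (j + d)).card : ℝ) ≤ 2 * d + 1 := by
      rw [Nat.card_Icc]
      exact_mod_cast (by omega : j + d + 1 - (j - d) ≤ 2 * d + 1)
    have hs := sqrt_ev_pos (q := q) j
    rw [h0, mul_assoc]
    refine (norm_sum_le _ _).trans ((Finset.sum_le_card_nsmul _ _
      ((‖T‖ * c' + c * Real.exp (logGap q d) * ‖S‖) * (1 / √(ev q j))) fun l hl => ?_).trans ?_)
    · rw [add_mul]
      -- If `S` has its regular shift, then `T` does not, and its decay on weight `n' + m` is used;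
      -- otherwise the decay of `S` is used.
      by_cases h1 : (l : ℤ) = j - n'
      · have h2 : casProj q i * T * (casProj q l * S * wtProj q m * casProj q j) =
            (casProj q i * T * wtProj q (n' + m) * casProj q l) * (S * casProj q j) := by
          rw [mul_assoc _ S, hS.weight]
          simp only [mul_assoc]
          rw [← mul_assoc (casProj q l) (wtProj q _), casProj_wtProj]
          simp only [mul_assoc]
        rw [h2]
        refine le_add_of_nonneg_of_le (by positivity) ?_
        refine (norm_mul_le _ _).trans ?_
        have h3 : ‖casProj q i * T * wtProj q (n' + m) * casProj q l‖ ≤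
            c * (Real.exp (logGap q d) * (1 / √(ev q j))) :=
          (h i l (by omega)).trans (mul_le_mul_of_nonneg_left (inv_sqrt_ev_le hl) hc)
        refine (mul_le_mul h3 (norm_mul_casProj_le S j) (norm_nonneg _) (by positivity)).trans
          (le_of_eq (by ring))
      · refine le_add_of_le_of_nonneg ?_ (by positivity)
        refine (norm_mul_le _ _).trans ?_
        rw [mul_assoc ‖T‖]
        exact mul_le_mul (norm_casProj_mul_le T i) (h' l j h1) (norm_nonneg _) (norm_nonneg _)
    · rw [nsmul_eq_mul]
      exact mul_le_mul_of_nonneg_right hcard (by positivity)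

end IsHomog

theorem isHomog_leftMul_mk (g : Gen) : IsHomog g.deg (leftMul (mk q g)) := by
  have h1 : IsHomog 1 (leftMul (α q)) := isHomog_of_highest rfl (by rw [dE_mk])
  have h2 : IsHomog 1 (leftMul (γ q)) := isHomog_of_highest rfl (by rw [dE_mk])
  cases g
  · exact h1
  · have := h1.star
    rw [← leftMul_star, star_mk] at this
    exact this
  · exact h2
  · have := h2.star
    rw [← leftMul_star, star_mk] at this
    exact this

theorem isHomog_leftMul_pow {n : ℤ} {a : Poly q} (ha : IsHomog n (leftMul a)) (k : ℕ) :
    IsHomog (k * n) (leftMul (a ^ k)) := by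
  induction k with
  | zero => simpa [leftMul_one] using IsHomog.one (q := q)
  | succ k ih =>
    rw [pow_succ, leftMul_mul, Nat.cast_succ, add_mul, one_mul]
    exact ih.mul ha

theorem isHomog_leftMul {n : ℤ} {a : Poly q} (ha : a ∈ spectralPart q n) : IsHomog n (leftMul a) := by
  rw [spectralPart_eq_homSpan] at ha
  induction ha using Submodule.span_induction with
  | zero => rw [leftMul_zero]; exact .zero
  | add x y _ _ hx hy => rw [leftMul_add]; exact hx.add hy
  | smul t x _ hx => rw [leftMul_smul]; exact hx.smul t
  | mem x hx =>
    have h := fun m l => (isHomog_leftMul_pow (isHomog_leftMul_mk (q := q) .c) m).mul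
      (isHomog_leftMul_pow (isHomog_leftMul_mk (q := q) .cstar) l)
    obtain ⟨m, l, k, rfl, rfl⟩ | ⟨m, l, k, rfl, rfl⟩ := hx
    · have := (h m l).mul (isHomog_leftMul_pow (isHomog_leftMul_mk (q := q) .a) k)
      simp only [Gen.deg, mul_one, mul_neg, ← sub_eq_add_neg, ← leftMul_mul] at this
      exact this
    · have := (h m l).mul (isHomog_leftMul_pow (isHomog_leftMul_mk (q := q) .astar) k)
      simp only [Gen.deg, mul_one, mul_neg, ← sub_eq_add_neg, ← leftMul_mul] at this
      exact this

/-! ### The Sobolev norms in terms of the spectral decomposition -/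

/-- Pythagoras for a convergent orthogonal series, by continuity of the inner product. It turns
Sobolev norms into weighted `ℓ²` norms of spectral components. -/
theorem norm_tsum_sq_of_inner_eq_zero {ι E : Type*} [NormedAddCommGroup E] [InnerProductSpace ℂ E]
    {f : ι → E} (hf : Summable f) (h : ∀ i j, i ≠ j → ⟪f i, f j⟫_ℂ = 0) :
    ‖∑' i, f i‖ ^ 2 = ∑' i, ‖f i‖ ^ 2 := by
  have h1 : ∀ j, ⟪f j, ∑' i, f i⟫_ℂ = ((‖f j‖ ^ 2 : ℝ) : ℂ) := by
    intro j
    rw [← innerSL_apply_apply ℂ, (innerSL ℂ (f j)).map_tsum hf, tsum_eq_single j]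
    · rw [innerSL_apply_apply, inner_self_eq_norm_sq_to_K]; push_cast; rfl
    · intro i hi
      rw [innerSL_apply_apply, h j i hi.symm]
  have h2 : ⟪∑' i, f i, ∑' i, f i⟫_ℂ = ∑' i, ((‖f i‖ ^ 2 : ℝ) : ℂ) := by
    rw [← innerSL_apply_apply ℂ, (innerSL ℂ (∑' i, f i)).map_tsum hf]
    refine tsum_congr fun j => ?_
    rw [innerSL_apply_apply, ← inner_conj_symm, h1, Complex.conj_ofReal]
  rw [inner_self_eq_norm_sq_to_K, ← Complex.ofReal_tsum] at h2
  exact Complex.ofReal_injective ((Complex.ofReal_pow _ _).trans h2)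

variable (q) in
/-- The eigenvalues as positive real numbers. -/
def evPos (j : ℕ) : Set.Ioi (0 : ℝ) := ⟨ev q j, ev_pos j⟩

theorem evPos_injective : Function.Injective (evPos q) := fun _ _ h =>
  ev_injective (congrArg Subtype.val h)

theorem specProj_eq_zero_of_notMem_range {lam : Set.Ioi (0 : ℝ)} (h : lam ∉ Set.range (evPos q)) :
    specProj q lam = 0 :=
  specProj_eq_zero fun ⟨j, hj⟩ => h ⟨j, Subtype.ext hj⟩

theorem norm_ev_cpow (j : ℕ) (z : ℂ) : ‖((ev q j : ℝ) : ℂ) ^ z‖ = ev q j ^ z.re :=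
  Complex.norm_cpow_eq_rpow_re_of_pos (ev_pos j) z

theorem norm_ev_cpow_smul_sq (j : ℕ) (t : ℝ) (ξ : H q) :
    ‖((ev q j : ℝ) : ℂ) ^ ((t / 2 : ℝ) : ℂ) • casProj q j ξ‖ ^ 2 = ev q j ^ t * ‖casProj q j ξ‖ ^ 2 := by
  rw [norm_smul, norm_ev_cpow, mul_pow, Complex.ofReal_re, ← Real.rpow_natCast, ← Real.rpow_mul (ev_pos j).le]
  norm_num

theorem mem_domPow_iff_summable {t : ℝ} {ξ : H q} : ξ ∈ domPow q ((t / 2 : ℝ) : ℂ) ↔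
    Summable fun j => ev q j ^ t * ‖casProj q j ξ‖ ^ 2 := by
  rw [mem_domPow_iff, ← evPos_injective.summable_iff]
  · simp only [← norm_ev_cpow_smul_sq]; rfl
  · intro lam h
    simp [specProj_eq_zero_of_notMem_range h]

theorem mem_Hinf_iff {ξ : H q} : ξ ∈ Hinf q ↔
    ∀ t : ℝ, Summable fun j => ev q j ^ t * ‖casProj q j ξ‖ ^ 2 := by
  rw [Hinf, Submodule.mem_iInf]
  exact forall_congr' fun t => mem_domPow_iff_summable

theorem sobNorm_sq (t : ℝ) (ξ : Hinf q) :
    sobNorm t ξ ^ 2 = ∑' j, ev q j ^ t * ‖casProj q j (ξ : H q)‖ ^ 2 := by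
  change ‖powSum q _ (ξ : H q)‖ ^ 2 = _
  rw [powSum, norm_tsum_sq_of_inner_eq_zero (summable_pow (Hinf_le _ ξ.2)), ← evPos_injective.tsum_eq]
  · refine tsum_congr fun j => ?_
    rw [← norm_ev_cpow_smul_sq]; rfl
  · intro lam h
    by_contra h'
    simp [specProj_eq_zero_of_notMem_range h'] at h
  · intro lam mu hne
    have h : ⟪specProj q lam (ξ : H q), specProj q mu (ξ : H q)⟫_ℂ = 0 :=
      (Submodule.isOrtho_iff_inner_eq.1 (eigenspace_ortho (fun h => hne (Subtype.ext h)))) _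
        (Submodule.starProjection_apply_mem _ _) _ (Submodule.starProjection_apply_mem _ _)
    rw [inner_smul_left, inner_smul_right, h, mul_zero, mul_zero]

theorem sobNorm_nonneg (t : ℝ) (ξ : Hinf q) : 0 ≤ sobNorm t ξ := norm_nonneg _

theorem casProj_cpow (z : ℂ) (ξ : Hinf q) (j : ℕ) :
    casProj q j (cpow q z ξ : H q) = ((ev q j : ℝ) : ℂ) ^ z • casProj q j (ξ : H q) :=
  specProj_powSum (Hinf_le z ξ.2) (evPos q j)

/-! ### Banded estimates -/

/-- After exchanging the summations, each `a j` is counted at most `2d + 1` times. -/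
theorem summable_sum_Icc {a : ℕ → ℝ} (ha : ∀ j, 0 ≤ a j) (hs : Summable a) (d : ℕ) :
    Summable (fun i => ∑ j ∈ Finset.Icc (i - d) (i + d), a j) ∧
      ∑' i, ∑ j ∈ Finset.Icc (i - d) (i + d), a j ≤ (2 * d + 1) * ∑' j, a j := by
  have key : ∀ s : Finset ℕ, ∑ i ∈ s, ∑ j ∈ Finset.Icc (i - d) (i + d), a j ≤
      (2 * d + 1) * ∑' j, a j := by
    intro s
    rw [Finset.sum_comm' (t' := s.biUnion fun i => Finset.Icc (i - d) (i + d))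
      (s' := fun j => s.filter fun i => j ∈ Finset.Icc (i - d) (i + d))]
    · refine le_trans (Finset.sum_le_sum (g := fun j => (2 * d + 1) * a j) fun j _ => ?_) ?_
      · rw [Finset.sum_const, nsmul_eq_mul]
        refine mul_le_mul_of_nonneg_right ?_ (ha j)
        have h1 : (s.filter fun i => j ∈ Finset.Icc (i - d) (i + d)) ⊆ Finset.Icc (j - d) (j + d) :=
          fun i hi => mem_Icc_comm.2 (Finset.mem_filter.1 hi).2
        have h2 := Finset.card_le_card h1
        rw [Nat.card_Icc] at h2
        exact_mod_cast h2.trans (by omega : j + d + 1 - (j - d) ≤ 2 * d + 1)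
      · rw [← Finset.mul_sum]
        exact mul_le_mul_of_nonneg_left (hs.sum_le_tsum _ fun j _ => ha j) (by positivity)
    · intro i j
      simp only [Finset.mem_filter, Finset.mem_biUnion]
      tauto
  have hn : ∀ i, 0 ≤ ∑ j ∈ Finset.Icc (i - d) (i + d), a j := fun i => Finset.sum_nonneg fun j _ => ha j
  have hsum := summable_of_sum_le hn key
  exact ⟨hsum, hsum.tsum_le_of_sum_le key⟩

/-- Cauchy–Schwarz on windows of at most `2d + 1` terms, and comparability of `ev_i^t` and `ev_j^t`
inside a window. The hypothesis concerns a pair of vectors rather than an operator, so that it also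
covers the defect, which is defined only on `H_∞`. -/
theorem summable_of_banded {d : ℕ} {M : ℝ} {ξ η : H q}
    (h : ∀ i, ‖casProj q i η‖ ≤ M * ∑ j ∈ Finset.Icc (i - d) (i + d), ‖casProj q j ξ‖) {t : ℝ}
    (hs : Summable fun j => ev q j ^ t * ‖casProj q j ξ‖ ^ 2) :
    Summable (fun j => ev q j ^ t * ‖casProj q j η‖ ^ 2) ∧
      ∑' j, ev q j ^ t * ‖casProj q j η‖ ^ 2 ≤
        M ^ 2 * (2 * d + 1) ^ 2 * Real.exp (|t| * logGap q d) * ∑' j, ev q j ^ t * ‖casProj q j ξ‖ ^ 2 := by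
  have hp : ∀ j, 0 ≤ ev q j ^ t := fun j => Real.rpow_nonneg (ev_pos j).le _
  set a : ℕ → ℝ := fun j => ev q j ^ t * ‖casProj q j ξ‖ ^ 2 with ha
  obtain ⟨h1, h2⟩ := summable_sum_Icc (a := a) (fun j => mul_nonneg (hp j) (sq_nonneg _)) hs d
  set c : ℝ := M ^ 2 * (2 * d + 1) * Real.exp (|t| * logGap q d) with hc
  have hc0 : 0 ≤ c := by positivity
  have key : ∀ i, ev q i ^ t * ‖casProj q i η‖ ^ 2 ≤ c * ∑ j ∈ Finset.Icc (i - d) (i + d), a j := by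
    intro i
    have h3 : ‖casProj q i η‖ ^ 2 ≤
        M ^ 2 * ((2 * d + 1) * ∑ j ∈ Finset.Icc (i - d) (i + d), ‖casProj q j ξ‖ ^ 2) := by
      refine (pow_le_pow_left₀ (norm_nonneg _) (h i) 2).trans ?_
      rw [mul_pow]
      refine mul_le_mul_of_nonneg_left (sq_sum_le_card_mul_sum_sq.trans ?_) (sq_nonneg _)
      refine mul_le_mul_of_nonneg_right ?_ (Finset.sum_nonneg fun j _ => sq_nonneg _)
      rw [Nat.card_Icc]
      exact_mod_cast (by omega : i + d + 1 - (i - d) ≤ 2 * d + 1)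
    have h4 : ev q i ^ t * ∑ j ∈ Finset.Icc (i - d) (i + d), ‖casProj q j ξ‖ ^ 2 ≤
        Real.exp (|t| * logGap q d) * ∑ j ∈ Finset.Icc (i - d) (i + d), a j := by
      rw [Finset.mul_sum, Finset.mul_sum]
      refine Finset.sum_le_sum fun j hj => ?_
      rw [ha, ← mul_assoc]
      exact mul_le_mul_of_nonneg_right (rpow_ev_le (mem_Icc_comm.1 hj) t) (sq_nonneg _)
    calc ev q i ^ t * ‖casProj q i η‖ ^ 2
        ≤ ev q i ^ t * (M ^ 2 * ((2 * d + 1) * ∑ j ∈ Finset.Icc (i - d) (i + d), ‖casProj q j ξ‖ ^ 2)) :=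
          mul_le_mul_of_nonneg_left h3 (hp i)
      _ = M ^ 2 * (2 * d + 1) * (ev q i ^ t * ∑ j ∈ Finset.Icc (i - d) (i + d), ‖casProj q j ξ‖ ^ 2) := by ring
      _ ≤ M ^ 2 * (2 * d + 1) * (Real.exp (|t| * logGap q d) * ∑ j ∈ Finset.Icc (i - d) (i + d), a j) :=
          mul_le_mul_of_nonneg_left h4 (by positivity)
      _ = c * ∑ j ∈ Finset.Icc (i - d) (i + d), a j := by rw [hc]; ring
  have h5 := h1.mul_left c
  have h6 : Summable (fun j => ev q j ^ t * ‖casProj q j η‖ ^ 2) :=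
    Summable.of_nonneg_of_le (fun j => mul_nonneg (hp j) (sq_nonneg _)) key h5
  refine ⟨h6, (h6.tsum_le_tsum key h5).trans ?_⟩
  rw [tsum_mul_left]
  refine (mul_le_mul_of_nonneg_left h2 hc0).trans (le_of_eq ?_)
  rw [hc]; ring

theorem mem_Hinf_of_banded {d : ℕ} {M : ℝ} {ξ η : H q} (hξ : ξ ∈ Hinf q)
    (h : ∀ i, ‖casProj q i η‖ ≤ M * ∑ j ∈ Finset.Icc (i - d) (i + d), ‖casProj q j ξ‖) : η ∈ Hinf q :=
  mem_Hinf_iff.2 fun t => (summable_of_banded h (mem_Hinf_iff.1 hξ t)).1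

theorem sobNorm_le_of_banded {d : ℕ} {M : ℝ} (hM : 0 ≤ M) {ξ η : Hinf q}
    (h : ∀ i, ‖casProj q i (η : H q)‖ ≤ M * ∑ j ∈ Finset.Icc (i - d) (i + d), ‖casProj q j (ξ : H q)‖)
    (t : ℝ) : sobNorm t η ≤ M * (2 * d + 1) * Real.exp (|t| * logGap q d) * sobNorm t ξ := by
  have h1 := (summable_of_banded h (mem_Hinf_iff.1 ξ.2 t)).2
  have hx := sobNorm_nonneg t ξ
  rw [← sobNorm_sq, ← sobNorm_sq] at h1
  rw [← sq_le_sq₀ (sobNorm_nonneg t η) (by positivity)]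
  refine h1.trans ?_
  -- The squared estimate contains the exponential only once; being at least one, it may be replaced
  -- by its square.
  have h2 : 1 ≤ Real.exp (|t| * logGap q d) :=
    Real.one_le_exp (mul_nonneg (abs_nonneg _) (logGap_nonneg d))
  rw [mul_pow, mul_pow, mul_pow]
  refine mul_le_mul_of_nonneg_right (mul_le_mul_of_nonneg_left ?_ (by positivity)) (sq_nonneg _)
  nlinarith

theorem IsBanded.casProj_apply {d : ℕ} {T : H q →L[ℂ] H q} (hT : IsBanded d T) (i : ℕ) (ξ : H q) :
    casProj q i (T ξ) = ∑ j ∈ Finset.Icc (i - d) (i + d), casProj q i (T (casProj q j ξ)) := by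
  have := DFunLike.congr_fun (hT.casProj_mul i) ξ
  rw [sum_apply] at this
  exact this

theorem IsBanded.norm_casProj_apply_le {d : ℕ} {T : H q →L[ℂ] H q} (hT : IsBanded d T) (i : ℕ) (ξ : H q) :
    ‖casProj q i (T ξ)‖ ≤ ‖T‖ * ∑ j ∈ Finset.Icc (i - d) (i + d), ‖casProj q j ξ‖ := by
  rw [hT.casProj_apply, Finset.mul_sum]
  refine norm_sum_le_of_le _ fun j _ => ?_
  refine ((casProj q i).le_of_opNorm_le (norm_casProj_le _) _).trans ?_
  rw [one_mul]; exact T.le_opNorm _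

theorem IsBanded.exists_isOfOrder {d : ℕ} {T : H q →L[ℂ] H q} (hT : IsBanded d T) :
    ∃ h : ∀ ξ ∈ Hinf q, (T : H q →ₗ[ℂ] H q) ξ ∈ Hinf q,
      IsOfOrder 0 ((T : H q →ₗ[ℂ] H q).restrict h) := by
  refine ⟨fun ξ hξ => mem_Hinf_of_banded hξ fun i => hT.norm_casProj_apply_le i ξ, fun t => ?_⟩
  refine ⟨‖T‖ * (2 * d + 1) * Real.exp (|t| * logGap q d), fun ξ => ?_⟩
  rw [sub_zero]
  exact sobNorm_le_of_banded (norm_nonneg T) (fun i => hT.norm_casProj_apply_le i ξ) t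

/-! ### Complex powers -/

theorem ofReal_cpow_eq_exp {x : ℝ} (hx : 0 < x) (z : ℂ) :
    (x : ℂ) ^ z = Complex.exp (z * (Real.log x : ℝ)) := by
  rw [Complex.cpow_def_of_ne_zero (by exact_mod_cast hx.ne'), Complex.ofReal_log hx.le, mul_comm]

/-- The mean value inequality along a real segment, where `|d/dx e^{zx}| = |z| e^{x Re z}`. The
imaginary part of `z` enters only through the factor `|z|`, which is the source of the linear
growth. -/
theorem norm_exp_mul_sub_exp_mul_le {z : ℂ} {R A a b : ℝ} (hz : |z.re| ≤ R) (ha : |a| ≤ A) (hb : |b| ≤ A) :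
    ‖Complex.exp (z * a) - Complex.exp (z * b)‖ ≤ ‖z‖ * Real.exp (R * A) * |a - b| := by
  have h1 : ∀ x ∈ Set.Icc (-A) A, HasDerivWithinAt (fun x : ℝ => Complex.exp (z * x))
      (Complex.exp (z * x) * (z * 1)) (Set.Icc (-A) A) x := by
    intro x _
    exact ((Complex.ofRealCLM.hasDerivAt.const_mul z).cexp).hasDerivWithinAt
  have h2 : ∀ x ∈ Set.Icc (-A) A, ‖Complex.exp (z * x) * (z * 1)‖ ≤ ‖z‖ * Real.exp (R * A) := by
    intro x hx
    rw [mul_one, norm_mul, mul_comm, Complex.norm_exp]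
    refine mul_le_mul_of_nonneg_left (Real.exp_le_exp.2 ?_) (norm_nonneg _)
    rw [Complex.re_mul_ofReal]
    refine (le_abs_self _).trans ?_
    rw [abs_mul]
    exact mul_le_mul hz (abs_le.2 hx) (abs_nonneg _) ((abs_nonneg _).trans hz)
  have := Convex.norm_image_sub_le_of_norm_hasDerivWithin_le h1 h2 (convex_Icc _ _)
    (abs_le.1 hb) (abs_le.1 ha)
  simpa only [Real.norm_eq_abs] using this

theorem norm_ev_cpow_sub_le {d i j : ℕ} (h : i ∈ Finset.Icc (j - d) (j + d)) (n : ℤ) {z : ℂ} {R : ℝ}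
    (hz : |z.re| ≤ R) :
    ‖((ev q i : ℝ) : ℂ) ^ z * ((ev q j : ℝ) : ℂ) ^ (-z) - ((q : ℝ) : ℂ) ^ ((n : ℂ) * z)‖ ≤
      ‖z‖ * Real.exp (R * (logGap q d + |n * Real.log q|)) *
        |Real.log (ev q i) - Real.log (ev q j) - n * Real.log q| := by
  have h1 : ((ev q i : ℝ) : ℂ) ^ z * ((ev q j : ℝ) : ℂ) ^ (-z) =
      Complex.exp (z * ((Real.log (ev q i) - Real.log (ev q j) : ℝ) : ℂ)) := by
    rw [ofReal_cpow_eq_exp (ev_pos i), ofReal_cpow_eq_exp (ev_pos j), ← Complex.exp_add]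
    congr 1; push_cast; ring
  have h2 : ((q : ℝ) : ℂ) ^ ((n : ℂ) * z) = Complex.exp (z * ((n * Real.log q : ℝ) : ℂ)) := by
    rw [ofReal_cpow_eq_exp q.2.1]
    congr 1; push_cast; ring
  rw [h1, h2]
  have := logGap_nonneg (q := q) d
  refine norm_exp_mul_sub_exp_mul_le hz ?_ ?_
  · exact (abs_log_ev_sub_le h).trans (le_add_of_nonneg_right (abs_nonneg _))
  · exact le_add_of_nonneg_left this

theorem norm_ev_cpow_half (j : ℕ) : ‖((ev q j : ℝ) : ℂ) ^ (1 / 2 : ℂ)‖ = √(ev q j) := by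
  rw [norm_ev_cpow, Real.sqrt_eq_rpow]; norm_num

/-! ### The estimate for the defect -/

/-- Complex powers of `C` act as scalars on each eigenspace, so every block of the defect is a
scalar multiple of the same block of `T`, and the band makes the sum finite. -/
theorem casProj_defect {d : ℕ} {T : H q →L[ℂ] H q} (hT : IsBanded d T)
    (hx : ∀ ξ ∈ Hinf q, (T : H q →ₗ[ℂ] H q) ξ ∈ Hinf q) (n : ℤ) (z : ℂ) (ξ : Hinf q) (i : ℕ) :
    casProj q i (defect n ((T : H q →ₗ[ℂ] H q).restrict hx) z ξ : H q) =
      ∑ j ∈ Finset.Icc (i - d) (i + d), ((((ev q i : ℝ) : ℂ) ^ z * ((ev q j : ℝ) : ℂ) ^ (-z) -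
        ((q : ℝ) : ℂ) ^ ((n : ℂ) * z)) * ((ev q j : ℝ) : ℂ) ^ (1 / 2 : ℂ)) •
          casProj q i (T (casProj q j (ξ : H q))) := by
  have h1 : ∀ η : Hinf q, ((((T : H q →ₗ[ℂ] H q).restrict hx) η : Hinf q) : H q) = T η := fun η => rfl
  have h2 : casProj q i (defect n ((T : H q →ₗ[ℂ] H q).restrict hx) z ξ : H q) =
      ((ev q i : ℝ) : ℂ) ^ z • casProj q i (T (cpow q (-z) (cpow q (1 / 2) ξ) : Hinf q)) -
        ((q : ℝ) : ℂ) ^ ((n : ℂ) * z) • casProj q i (T (cpow q (1 / 2) ξ : Hinf q)) := by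
    rw [defect, LinearMap.comp_apply, LinearMap.sub_apply, LinearMap.comp_apply, LinearMap.comp_apply,
      LinearMap.smul_apply, Submodule.coe_sub, Submodule.coe_smul, map_sub, map_smul, casProj_cpow, h1, h1]
  rw [h2, hT.casProj_apply, hT.casProj_apply i (cpow q (1 / 2) ξ : Hinf q), Finset.smul_sum, Finset.smul_sum,
    ← Finset.sum_sub_distrib]
  refine Finset.sum_congr rfl fun j _ => ?_
  rw [casProj_cpow, casProj_cpow]
  simp only [map_smul, smul_smul, ← sub_smul]
  congr 1; ring

/-- The two sources of decay meet here: the eigenvalue asymptotics for `i = j - n`, and the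
smallness of the blocks of `a` for all other `i`. The band and the constant `B` do not depend on
`z`, `i`, `j` or `ξ`. -/
theorem exists_norm_casProj_defect_le {n : ℤ} {a : Poly q} (ha : a ∈ spectralPart q n) (S : Finset ℤ) :
    ∃ d, IsBanded d (leftMul a * projF q S) ∧ ∀ R : ℝ, ∃ B : ℝ, 0 ≤ B ∧ ∀ z : ℂ, |z.re| ≤ R →
      ∀ i j : ℕ, i ∈ Finset.Icc (j - d) (j + d) → ∀ ξ : H q,
        ‖((((ev q i : ℝ) : ℂ) ^ z * ((ev q j : ℝ) : ℂ) ^ (-z) - ((q : ℝ) : ℂ) ^ ((n : ℂ) * z)) *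
          ((ev q j : ℝ) : ℂ) ^ (1 / 2 : ℂ)) • casProj q i ((leftMul a * projF q S) (casProj q j ξ))‖ ≤
        ‖z‖ * B * ‖casProj q j ξ‖ := by
  have hh := isHomog_leftMul ha
  obtain ⟨d, hd⟩ := hh.band
  obtain ⟨c₀, hc₀, h₀⟩ := exists_log_ev_sub_le (q := q) n
  choose c hc h using hh.small
  set T := leftMul a * projF q S with hTdef
  refine ⟨d, hd.mul_projF _, fun R => ?_⟩
  set E := Real.exp (R * (logGap q d + |n * Real.log q|)) with hE
  have hg := logGap_nonneg (q := q) d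
  have hcS : 0 ≤ ∑ m ∈ S, c m := Finset.sum_nonneg fun m _ => hc m
  refine ⟨E * ((logGap q d + |n * Real.log q|) * ∑ m ∈ S, c m + c₀ * ‖T‖), by positivity,
    fun z hz i j hij ξ => ?_⟩
  have hs := sqrt_ev_pos (q := q) j
  have h1 := norm_ev_cpow_sub_le (q := q) hij n hz
  rw [← hE] at h1
  have h2 : casProj q i (T (casProj q j ξ)) = (casProj q i * T * casProj q j) (casProj q j ξ) := by
    have : casProj q j (casProj q j ξ) = casProj q j ξ := by
      have := DFunLike.congr_fun (casProj_mul_casProj (q := q) j j) ξ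
      rwa [if_pos rfl] at this
    change _ = casProj q i (T (casProj q j (casProj q j ξ)))
    rw [this]
  have h3 : ‖casProj q i (T (casProj q j ξ))‖ ≤ ‖casProj q i * T * casProj q j‖ * ‖casProj q j ξ‖ := by
    rw [h2]; exact ContinuousLinearMap.le_opNorm _ _
  rw [norm_smul, norm_mul, norm_ev_cpow_half]
  set X := ‖casProj q j ξ‖
  set N := ‖casProj q i * T * casProj q j‖ with hN
  have hX : 0 ≤ X := norm_nonneg _
  have hN0 : 0 ≤ N := norm_nonneg _
  set l := |Real.log (ev q i) - Real.log (ev q j) - n * Real.log q| with hl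
  have hl0 : 0 ≤ l := abs_nonneg _
  -- The factor `√(ev q j)` from `C^{1/2}` is absorbed by `l` on the regular diagonal and by the
  -- block norm `N` elsewhere.
  have key : l * √(ev q j) * N ≤ (logGap q d + |n * Real.log q|) * ∑ m ∈ S, c m + c₀ * ‖T‖ := by
    by_cases hn : (i : ℤ) = j - n
    · refine le_add_of_nonneg_of_le (by positivity) (mul_le_mul (h₀ i j hn) ?_ hN0 hc₀)
      exact (norm_mul_casProj_le _ _).trans (norm_casProj_mul_le _ _)
    · refine le_add_of_le_of_nonneg ?_ (by positivity)
      have h4 : l ≤ logGap q d + |n * Real.log q| :=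
        (abs_sub _ _).trans (add_le_add_left (abs_log_ev_sub_le hij) _)
      have h5 : N ≤ (∑ m ∈ S, c m) * (1 / √(ev q j)) := by
        -- The decay constants depend on the weight `m`, so they are summed over the finite set `S`.
        rw [hN, hTdef, projF_eq_sum, Finset.mul_sum, Finset.mul_sum, Finset.sum_mul, Finset.sum_mul]
        refine norm_sum_le_of_le _ fun m _ => ?_
        rw [← mul_assoc]
        exact h m i j hn
      have h6 : √(ev q j) * N ≤ ∑ m ∈ S, c m := by
        rw [mul_one_div, le_div_iff₀ hs] at h5
        linarith
      rw [mul_assoc]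
      exact mul_le_mul h4 h6 (by positivity) (by positivity)
  calc _ ≤ ‖z‖ * E * l * √(ev q j) * (N * X) := by
        exact mul_le_mul (mul_le_mul_of_nonneg_right h1 hs.le) h3 (norm_nonneg _) (by positivity)
    _ = ‖z‖ * E * (l * √(ev q j) * N) * X := by ring
    _ ≤ ‖z‖ * E * ((logGap q d + |n * Real.log q|) * ∑ m ∈ S, c m + c₀ * ‖T‖) * X := by gcongr
    _ = _ := by ring

theorem exists_sobNorm_defect_le {n : ℤ} {a : Poly q} (ha : a ∈ spectralPart q n) (S : Finset ℤ)
    (hx : ∀ ξ ∈ Hinf q, (leftMul a ∘L projF q S : H q →ₗ[ℂ] H q) ξ ∈ Hinf q) (R : ℝ) :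
    ∃ C : ℝ, 0 < C ∧ ∀ t z, |t| ≤ R → |z.re| ≤ R → ∀ ξ : Hinf q,
      sobNorm t (defect n ((leftMul a ∘L projF q S : H q →ₗ[ℂ] H q).restrict hx) z ξ) ≤
        C * ‖z‖ * sobNorm t ξ := by
  obtain ⟨d, hd, h⟩ := exists_norm_casProj_defect_le ha S
  obtain ⟨B, hB, h⟩ := h R
  -- Adding `1` makes the constant strictly positive even when `B = 0`.
  refine ⟨B * (2 * d + 1) * Real.exp (R * logGap q d) + 1, by positivity, fun t z ht hz ξ => ?_⟩
  have hX := sobNorm_nonneg t ξ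
  have h1 : ∀ i, ‖casProj q i (defect n ((leftMul a ∘L projF q S : H q →ₗ[ℂ] H q).restrict hx) z ξ : H q)‖ ≤
      ‖z‖ * B * ∑ j ∈ Finset.Icc (i - d) (i + d), ‖casProj q j (ξ : H q)‖ := by
    intro i
    refine (congrArg norm (casProj_defect hd hx n z ξ i)).trans_le ?_
    rw [Finset.mul_sum]
    exact norm_sum_le_of_le _ fun j hj => h z hz i j (mem_Icc_comm.1 hj) ξ
  refine (sobNorm_le_of_banded (by positivity) h1 t).trans (mul_le_mul_of_nonneg_right ?_ hX)
  have h2 : Real.exp (|t| * logGap q d) ≤ Real.exp (R * logGap q d) :=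
    Real.exp_le_exp.2 (mul_le_mul_of_nonneg_right ht (logGap_nonneg d))
  calc ‖z‖ * B * (2 * d + 1) * Real.exp (|t| * logGap q d)
      ≤ ‖z‖ * B * (2 * d + 1) * Real.exp (R * logGap q d) := by gcongr
    _ ≤ _ := by nlinarith [norm_nonneg z]

theorem opNorm_le {t M : ℝ} (hM : 0 ≤ M) {T : Hinf q →ₗ[ℂ] Hinf q}
    (h : ∀ ξ, sobNorm t (T ξ) ≤ M * sobNorm t ξ) : opNorm t T ≤ M :=
  csInf_le ⟨0, fun _ h => h.1⟩ ⟨hM, h⟩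

end SUq2

end

/-! ### The proposition. -/

theorem proposition3p2 (q : Set.Ioo (0 : ℝ) 1) :
    -- (i) elements of `𝒜` and the projections `p_F` are of order `0`
    (∀ a : SUq2.Poly q, ∃ ha : ∀ ξ ∈ SUq2.Hinf q, (SUq2.leftMul a : SUq2.H q →ₗ[ℂ] SUq2.H q) ξ ∈ SUq2.Hinf q,
      SUq2.IsOfOrder 0 ((SUq2.leftMul a : SUq2.H q →ₗ[ℂ] SUq2.H q).restrict ha)) ∧
    (∀ F : Set ℤ, ∃ hF : ∀ ξ ∈ SUq2.Hinf q, (SUq2.projF q F : SUq2.H q →ₗ[ℂ] SUq2.H q) ξ ∈ SUq2.Hinf q,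
      SUq2.IsOfOrder 0 ((SUq2.projF q F : SUq2.H q →ₗ[ℂ] SUq2.H q).restrict hF)) ∧
    -- (ii) the estimate for `x = a p_F`
    (∀ (n : ℤ) (a : SUq2.Poly q) (_ : a ∈ SUq2.spectralPart q n) (F : Set ℤ) (_ : F.Finite),
      ∃ hx : ∀ ξ ∈ SUq2.Hinf q, (SUq2.leftMul a ∘L SUq2.projF q F : SUq2.H q →ₗ[ℂ] SUq2.H q) ξ ∈ SUq2.Hinf q,
        (∀ z : ℂ, SUq2.IsOfOrder 0
          (SUq2.defect n ((SUq2.leftMul a ∘L SUq2.projF q F : SUq2.H q →ₗ[ℂ] SUq2.H q).restrict hx) z)) ∧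
        ∀ u v : ℝ, ∃ C : ℝ, 0 < C ∧ ∀ t ∈ Set.Icc u v, ∀ z : ℂ, z.re ∈ Set.Icc u v →
          SUq2.opNorm t (SUq2.defect n ((SUq2.leftMul a ∘L SUq2.projF q F : SUq2.H q →ₗ[ℂ] SUq2.H q).restrict hx) z) ≤
            C * ‖z‖) := by
  refine ⟨fun a => ?_, fun F => (SUq2.isBanded_projF F).exists_isOfOrder, fun n a ha F hF => ?_⟩
  · obtain ⟨d, hd⟩ := SUq2.exists_isBanded_leftMul a
    exact hd.exists_isOfOrder
  · obtain ⟨S, rfl⟩ := hF.exists_finset_coe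
    obtain ⟨d, hd⟩ := SUq2.exists_isBanded_leftMul a
    obtain ⟨hx, -⟩ := (hd.mul_projF (S : Set ℤ)).exists_isOfOrder
    refine ⟨hx, fun z t => ?_, fun u v => ?_⟩
    -- Order zero is a statement for single `t` and `z`, so the radius may depend on both.
    · obtain ⟨C, -, h⟩ := SUq2.exists_sobNorm_defect_le ha S hx (max |t| |z.re|)
      refine ⟨C * ‖z‖, fun ξ => ?_⟩
      rw [sub_zero]
      exact h t z (le_max_left _ _) (le_max_right _ _) ξ
    -- One radius covers both `t` and `Re z` in `[u, v]`, which gives a single constant for the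
    -- whole strip.
    · obtain ⟨C, hC, h⟩ := SUq2.exists_sobNorm_defect_le ha S hx (max |u| |v|)
      refine ⟨C, hC, fun t ht z hz => SUq2.opNorm_le (by positivity) (h t z ?_ ?_)⟩
      · exact abs_le_max_abs_abs ht.1 ht.2
      · exact abs_le_max_abs_abs hz.1 hz.2
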